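/- Fix an arbitrary o-minimal structure on $(\mathbb R,+,\cdot)$; "definable" refers to it. Let $I\subseteq\mathbb R$ be a nonempty open interval and let $$P(t)(x)=x^n+\sum_{j=1}^n(-1)^ja_j(t)x^{n-j}\qquad(t\in I,\ n\ge 1)$$ be a curve of hyperbolic polynomials (all roots of $P(t)$ are real for every $t\in I$) with definable coefficients $a_j:I\to\mathbb R$. **The integers $\Gamma$ and $\gamma$.** For a function $f$ defined near $t_0$ let $m_{t_0}(f)\in\mathbb N\cup\{\infty\}$ be the supremum of all $p\in\mathbb N$ such that $f(t)=(t-t_0)^pg(t)$ near $t_0$ with $g$ continuous near $t_0$. For a curve $P$ of monic hyperbolic polynomials of degree $n\ge1$ with continuous coefficients near $t_0$, integers $\Gamma_{t_0}(P)$, $\gamma_{t_0}(P)$ are defined inductively: (I) If $P=P_1P_2$ near $t_0$, where $P_1,P_2$ are curves of monic hyperbolic polynomials of positive degree with continuous coefficients such that $P_1(t_0)$ and $P_2(t_0)$ have no common root, then $\Gamma_{t_0}(P)=\max_i\Gamma_{t_0}(P_i)$ and $\gamma_{t_0}(P)=\Gamma_{t_0}(P)-\max_i\big(\Gamma_{t_0}(P_i)-\gamma_{t_0}(P_i)\big)$.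 (II) If $n>1$ and all roots of $P(t_0)$ coincide, replace $P(t)(x)$ by $P(t)(x+a_1(t)/n)$, so that $a_1=0$. If $m_{t_0}(a_2)=2r<\infty$, and $a_k(t)=(t-t_0)^{kr}a_{(r),k}(t)$ near $t_0$ with continuous $a_{(r),k}$ ($2\le k\le n$), put $P_{(r)}(t)(x)=x^n+\sum_{j=2}^n(-1)^ja_{(r),j}(t)x^{n-j}$ and $\Gamma_{t_0}(P)=\Gamma_{t_0}(P_{(r)})+nr$, $\gamma_{t_0}(P)=\gamma_{t_0}(P_{(r)})+r$. If $m_{t_0}(a_2)=\infty$, put $\Gamma_{t_0}(P)=\gamma_{t_0}(P)=0$. (III) If $n=1$, put $\Gamma_{t_0}(P)=\gamma_{t_0}(P)=0$. We say that $\Gamma(P),\gamma(P)$ are defined if for every $t\in I$ this recursion assigns (in finitely many steps) integers $\Gamma_t(P),\gamma_t(P)$ to $P$ and the suprema $\Gamma(P)=\sup_{t\in I}\Gamma_t(P)$ and $\sup_{t\in I}(\Gamma_t(P)-\gamma_t(P))$ are finite; then $\gamma(P)=\Gamma(P)-\sup_{t\in I}(\Gamma_t(P)-\gamma_t(P))$.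 Let $d(n)=n(n+1)/2-1$, and let $\overline m(P)$ be the supremum of all finite orders of contact at points of $I$ of two roots in a continuous parameterization $\lambda_1,\dots,\lambda_n$ of the roots of $P$ on $I$ (and $0$ if there are none), where the order of contact of $\lambda_i,\lambda_j$ at $t_0$ is the supremum of all $p$ with $\lambda_i(t)-\lambda_j(t)=O((t-t_0)^p)$ as $t\to t_0$. **Theorem.** (0) If the $a_j$ are of class $C^{d(n)\overline m(P)+2}$ on $I$, then $\Gamma(P)$ and $\gamma(P)$ are defined. Whenever they are defined, they are uniquely determined (they do not depend on the choices made in the recursion), and $\gamma(P)\le\Gamma(P)\le d(n)\overline m(P)+1$. (1) Suppose that $\Gamma(P),\gamma(P)$ are defined, and let $p\in\mathbb N_{>0}$. If the $a_j$ are of class $C^{p+\Gamma(P)}$ on $I$, then the roots of $P$ can be parameterized on all of $I$, with multiplicities, by $n$ definable functions of class $C^{p+\gamma(P)}$. (2) This is sharp: let $q>3$ be an integer, $f_q(t)=t^{q+1}$ for $t\ge0$ and $f_q(t)=0$ for $t<0$, and $$P_q(t)(x)=x^3-f_q(t)x^2+(2f_q(t)-t^2)x-f_q(t).$$ There is $\varepsilon>0$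 such that on every open interval $J$ with $0\in J\subseteq(-\varepsilon,\varepsilon)$ the following holds: the coefficients of $P_q$ are definable and of class $C^{q,1}$ (i.e. $C^q$ with locally Lipschitz $q$-th derivative), $P_q$ is hyperbolic, $\Gamma(P_q)=3$ and $\gamma(P_q)=1$; the roots of $P_q$ can be parameterized on $J$ by definable $C^{q-2}$ functions, but not by $C^{q-1}$ functions (definable or not). -/

import Mathlib

open Polynomial Filter Topology Asymptotics

/-- An o-minimal structure on `(ℝ, +, ·)`: a family of subsets of each `ℝⁿ`. (The level `n = 0`,
which is carried along for uniformity, adds no information: it is forced to be `{∅, ℝ⁰}`.) -/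
structure OMinimalStructure where
  /-- the definable subsets of `ℝⁿ` -/
  sets : ∀ n : ℕ, Set (Set (Fin n → ℝ))
  union_mem : ∀ {n : ℕ} {A B : Set (Fin n → ℝ)}, A ∈ sets n → B ∈ sets n → A ∪ B ∈ sets n
  compl_mem : ∀ {n : ℕ} {A : Set (Fin n → ℝ)}, A ∈ sets n → Aᶜ ∈ sets n
  prod_mem : ∀ {n m : ℕ} {A : Set (Fin n → ℝ)} {B : Set (Fin m → ℝ)}, A ∈ sets n → B ∈ sets m →
    {x : Fin (n + m) → ℝ | (fun i => x (Fin.castAdd m i)) ∈ A ∧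
      (fun i => x (Fin.natAdd n i)) ∈ B} ∈ sets (n + m)
  proj_mem : ∀ {n m : ℕ} {A : Set (Fin (n + m) → ℝ)}, A ∈ sets (n + m) →
    (fun (x : Fin (n + m) → ℝ) (i : Fin n) => x (Fin.castAdd m i)) '' A ∈ sets n
  semialgebraic_mem : ∀ {n : ℕ} (f : MvPolynomial (Fin n) ℝ)
    (s : Finset (MvPolynomial (Fin n) ℝ)),
    {x : Fin n → ℝ | MvPolynomial.eval x f = 0 ∧ ∀ g ∈ s, 0 < MvPolynomial.eval x g} ∈ sets n
  /-- the definable subsets of `ℝ` are exactly the finite unions of open intervals and points -/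
  mem_one_iff : ∀ A : Set (Fin 1 → ℝ), A ∈ sets 1 ↔
    ∃ S : Set (Set ℝ), S.Finite ∧
      (∀ s ∈ S, (IsOpen s ∧ s.OrdConnected) ∨ ∃ x : ℝ, s = {x}) ∧ A = {x | x 0 ∈ ⋃₀ S}

/-- The restriction of `f` to `I` is definable, i.e. its graph is. -/
def OMinimalStructure.DefinableOn (M : OMinimalStructure) (I : Set ℝ) (f : ℝ → ℝ) : Prop :=
  {x : Fin 2 → ℝ | x 0 ∈ I ∧ x 1 = f (x 0)} ∈ M.sets 2

/-- The curve of monic polynomials `P(t)(x) = xⁿ + ∑_{j=1}^n (-1)^j a_j(t) x^{n-j}`. -/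
noncomputable def monicCurve (n : ℕ) (a : ℕ → ℝ → ℝ) (t : ℝ) : ℝ[X] :=
  X ^ n + ∑ j ∈ Finset.Icc 1 n, C ((-1) ^ j * a j t) * X ^ (n - j)

/-- The coefficient `a_j` of a monic polynomial `xⁿ + ∑_{j=1}^n (-1)^j a_j x^{n-j}`. -/
noncomputable def signedCoeff (n : ℕ) (Q : ℝ[X]) (j : ℕ) : ℝ := (-1) ^ j * Q.coeff (n - j)

/-- The functions `r i` parameterize the roots (with multiplicity) of the curve `P` on `I`. -/
def IsRootParam (I : Set ℝ) (n : ℕ) (P : ℝ → ℝ[X]) (r : Fin n → ℝ → ℝ) : Prop :=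
  ∀ t ∈ I, P t = ∏ i, (X - C (r i t))

/-- The multiplicity of `f` at `t₀`: the supremum of all `p` such that `f(t) = (t - t₀)^p g(t)`
near `t₀` for some continuous `g`. -/
noncomputable def multiplicityAt (t₀ : ℝ) (f : ℝ → ℝ) : ℕ∞ :=
  ⨆ (p : ℕ) (_ : ∃ g : ℝ → ℝ, ∀ᶠ t in 𝓝 t₀, ContinuousAt g t ∧ f t = (t - t₀) ^ p * g t), (p : ℕ∞)

/-- The order of vanishing of `f` at `t₀`: the supremum of all `p` with `f(t) = O((t - t₀)^p)`. -/
noncomputable def vanishingOrder (t₀ : ℝ) (f : ℝ → ℝ) : ℕ∞ :=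
  ⨆ (p : ℕ) (_ : f =O[𝓝 t₀] fun t => (t - t₀) ^ p), (p : ℕ∞)

/-- The maximal finite order of contact, at points of `I`, of two roots of `P` in a
continuous parameterization of the roots; it is `0` if there is no finite order of contact. -/
noncomputable def maxContactOrder (I : Set ℝ) (n : ℕ) (P : ℝ → ℝ[X]) : ℕ∞ :=
  sSup {m : ℕ∞ | m ≠ ⊤ ∧ ∃ t₀ ∈ I, ∃ r : Fin n → ℝ → ℝ, IsRootParam I n P r ∧
    (∀ i, ContinuousOn (r i) I) ∧ ∃ i j, m = vanishingOrder t₀ fun t => r i t - r j t}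

/-- Near `t₀`, `P` is a curve of monic hyperbolic polynomials of degree `n` with continuous
coefficients. -/
def IsHyperbolicCurveNear (t₀ : ℝ) (n : ℕ) (P : ℝ → ℝ[X]) : Prop :=
  (∀ᶠ t in 𝓝 t₀, (P t).Monic ∧ (P t).natDegree = n ∧ (P t).Splits) ∧
    ∀ k, ∀ᶠ t in 𝓝 t₀, ContinuousAt (fun s => (P s).coeff k) t

/-- The curve obtained from `P` by shifting the variable by `a₁(t)/n`; its coefficient `a₁`
vanishes and its roots are those of `P` minus their mean. -/
noncomputable def centeredCurve (n : ℕ) (P : ℝ → ℝ[X]) (t : ℝ) : ℝ[X] :=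
  (P t).comp (X + C (signedCoeff n (P t) 1 / n))

/-- `HasLocalGamma t₀ n P Γ γ`: the curve `P` of monic hyperbolic polynomials of degree `n` has at
`t₀` the well-defined integers `Γ = Γ_{t₀}(P)` and `γ = γ_{t₀}(P)`. The natural number subtractions
are never truncated, see `HasLocalGamma.le`. -/
inductive HasLocalGamma (t₀ : ℝ) : ℕ → (ℝ → ℝ[X]) → ℕ → ℕ → Prop
  /-- `P = P₁ P₂` near `t₀`, where `P₁(t₀)` and `P₂(t₀)` have no common root -/
  | split {n₁ n₂ : ℕ} {P P₁ P₂ : ℝ → ℝ[X]} {Γ₁ γ₁ Γ₂ γ₂ : ℕ}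
      (hP : IsHyperbolicCurveNear t₀ (n₁ + n₂) P)
      (hmul : ∀ᶠ t in 𝓝 t₀, P t = P₁ t * P₂ t)
      (hdisj : ∀ x : ℝ, ¬ ((P₁ t₀).IsRoot x ∧ (P₂ t₀).IsRoot x))
      (h₁ : HasLocalGamma t₀ n₁ P₁ Γ₁ γ₁) (h₂ : HasLocalGamma t₀ n₂ P₂ Γ₂ γ₂) :
      HasLocalGamma t₀ (n₁ + n₂) P (max Γ₁ Γ₂) (max Γ₁ Γ₂ - max (Γ₁ - γ₁) (Γ₂ - γ₂))
  /-- all roots of `P(t₀)` coincide and, after centering, `a₂` has finite multiplicity `2r`;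
  `R` is the curve with coefficients `a_k(t) / (t - t₀)^{kr}`, extended continuously to `t₀` -/
  | reduce {n r : ℕ} {P R : ℝ → ℝ[X]} {Γ γ : ℕ}
      (hP : IsHyperbolicCurveNear t₀ n P) (hn : 1 < n)
      (hroot : ∃ c : ℝ, P t₀ = (X - C c) ^ n)
      (hmult : multiplicityAt t₀ (fun t => signedCoeff n (centeredCurve n P t) 2) = (2 * r : ℕ))
      (hR : ∀ᶠ t in 𝓝 t₀, ∀ k ∈ Finset.Icc 1 n,
        signedCoeff n (centeredCurve n P t) k = (t - t₀) ^ (k * r) * signedCoeff n (R t) k)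
      (h : HasLocalGamma t₀ n R Γ γ) :
      HasLocalGamma t₀ n P (Γ + n * r) (γ + r)
  /-- all roots of `P(t₀)` coincide and, after centering, `a₂` has infinite multiplicity -/
  | flat {n : ℕ} {P : ℝ → ℝ[X]}
      (hP : IsHyperbolicCurveNear t₀ n P) (hn : 1 < n)
      (hroot : ∃ c : ℝ, P t₀ = (X - C c) ^ n)
      (hmult : multiplicityAt t₀ (fun t => signedCoeff n (centeredCurve n P t) 2) = ⊤) :
      HasLocalGamma t₀ n P 0 0
  /-- degree one -/
  | linear {P : ℝ → ℝ[X]} (hP : IsHyperbolicCurveNear t₀ 1 P) :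
      HasLocalGamma t₀ 1 P 0 0

theorem HasLocalGamma.le {t₀ : ℝ} {n : ℕ} {P : ℝ → ℝ[X]} {Γ γ : ℕ}
    (h : HasLocalGamma t₀ n P Γ γ) : γ ≤ Γ := by
  induction h with
  | split => omega
  | reduce _ hn _ _ _ _ ih => nlinarith
  | flat => exact le_rfl
  | linear => exact le_rfl

/-- `HasGamma I n P Γ γ`: the curve `P` has on `I` the well-defined integers
`Γ = Γ(P) = sup_{t ∈ I} Γ_t(P)` and `γ = γ(P) = Γ(P) - sup_{t ∈ I} (Γ_t(P) - γ_t(P))`. -/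
def HasGamma (I : Set ℝ) (n : ℕ) (P : ℝ → ℝ[X]) (Γ γ : ℕ) : Prop :=
  ∃ Γl γl : ℝ → ℕ, (∀ t ∈ I, HasLocalGamma t n P (Γl t) (γl t)) ∧
    IsLUB (Γl '' I) Γ ∧ ∃ D : ℕ, IsLUB ((fun t => Γl t - γl t) '' I) D ∧ γ = Γ - D

/-- The function `t ↦ t^{q+1}` for `t ≥ 0`, `t ↦ 0` for `t < 0`. -/
noncomputable def halfPower (q : ℕ) (t : ℝ) : ℝ := if 0 ≤ t then t ^ (q + 1) else 0

/-- The coefficients `a₁ = f_q`, `a₂ = 2 f_q - t²`, `a₃ = f_q` of the cubic curve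
`x³ - f_q(t) x² + (2 f_q(t) - t²) x - f_q(t)`, where `f_q = halfPower q`. -/
noncomputable def cubicCoeff (q : ℕ) (j : ℕ) (t : ℝ) : ℝ :=
  if j = 2 then 2 * halfPower q t - t ^ 2 else halfPower q t

/-! Near a point t₀ differentiable roots are built along the recursion, and Γ and γ record what this
costs in the coefficients and returns in the roots. Suppose all roots coincide at t₀. For the
centered roots yᵢ one has ∑ yᵢ² = -2a₂, so if a₂ is divisible by (t-t₀)^{2r}, every yᵢ is
O((t-t₀)^r). Passing to the reduced curve divides a_k by (t-t₀)^{kr}, which by Taylor's formula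
costs kr ≤ nr derivatives: this is the nr in Γ. The roots of P are the mean of the roots plus
(t-t₀)^r times the roots of the reduced curve. If not all roots coincide, P splits into coprime
factors, and the inverse function theorem gives them the regularity of P. In the flat case the
centered roots are O of every power.

Definability enters when multiplying back: if g is definable and C^m near t₀, then (t-t₀)^r g is
C^{m+r} (`Def.contDiffAt_sub_mul`, `DefGerm.contDiffAt_pow_mul`), and this gain is the r in γ. The
reason is that a continuous definable g has a continuous monotone derivative on a one-sided
neighbourhood of t₀. The mean value theorem then forces (t-t₀)g'(t) → 0, so the derivative g +
(t-t₀)g' of (t-t₀)g extends continuously. `HasLocalGamma.exists_contDiffAt_roots` combines these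
facts.

Globally, two definable continuous roots either agree near t or differ near t, except for finitely
many t. Away from this finite set continuous roots do not split, so any two continuous
parameterizations differ by a locally constant permutation. At each exceptional point the roots to
its right are permuted so that they follow the local differentiable ones (`exists_perm_glue`,
`OMinimalStructure.exists_contDiffAt_roots`).

Existence of the integers is an induction on the degree: a reduction has r at most the maximal
finite contact order m and uses nr ≤ nm derivatives, after which the curve splits into lower
degrees, and d(n) = d(n-1) + n (`exists_hasLocalGamma`). Finiteness of the suprema holds because Γ_t
= 0 where roots do not split. Uniqueness compares two splittings through their common refinement
(`HasLocalGamma.exists_factorGamma`). The bound follows from Γ ≤ nc for the contact order c of some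
pair of roots (`HasLocalGamma.exists_contact`).

For sharpness, the cubic is x(x²-t²) - f(x-1)². Its root that vanishes for t < 0 continues for t > 0
with modulus at least t^{q-1} if it stays small compared to t, which no C^{q-1} function vanishing
on the left can do. -/

namespace OMinimalStructure

variable {M : OMinimalStructure}

/-- The subset of `ℝᵏ` cut out by `p` is definable. -/
def DefSet (M : OMinimalStructure) (k : ℕ) (p : (Fin k → ℝ) → Prop) : Prop := {x | p x} ∈ M.sets k

/-- The graph of `f : ℝᵏ → ℝ` is definable. -/
def DefFun (M : OMinimalStructure) (k : ℕ) (f : (Fin k → ℝ) → ℝ) : Prop :=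
  M.DefSet (k + 1) fun x => x (Fin.last k) = f fun i => x i.castSucc

/-! ### First-order calculus of definable sets -/

section sets
variable {k m n : ℕ} {p q : (Fin k → ℝ) → Prop}

theorem DefSet.congr (hp : M.DefSet k p) (h : ∀ x, p x ↔ q x) : M.DefSet k q := by
  rwa [show q = p from funext fun x => propext (h x).symm]

theorem DefSet.not (hp : M.DefSet k p) : M.DefSet k fun x => ¬ p x := M.compl_mem hp

theorem DefSet.or (hp : M.DefSet k p) (hq : M.DefSet k q) : M.DefSet k fun x => p x ∨ q x :=
  M.union_mem hp hq

theorem DefSet.and (hp : M.DefSet k p) (hq : M.DefSet k q) : M.DefSet k fun x => p x ∧ q x :=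
  (hp.not.or hq.not).not.congr fun x => by tauto

theorem DefSet.imp (hp : M.DefSet k p) (hq : M.DefSet k q) : M.DefSet k fun x => p x → q x :=
  (hp.not.or hq).congr fun x => by tauto

theorem defSet_poly_eq_zero (f : MvPolynomial (Fin k) ℝ) :
    M.DefSet k fun x => MvPolynomial.eval x f = 0 :=
  DefSet.congr
    (p := fun x => MvPolynomial.eval x f = 0 ∧ ∀ g ∈ (∅ : Finset _), 0 < MvPolynomial.eval x g)
    (M.semialgebraic_mem f ∅) fun x => by simp

theorem defSet_poly_pos (f : MvPolynomial (Fin k) ℝ) :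
    M.DefSet k fun x => 0 < MvPolynomial.eval x f :=
  DefSet.congr
    (p := fun x => MvPolynomial.eval x 0 = 0 ∧ ∀ g ∈ ({f} : Finset _), 0 < MvPolynomial.eval x g)
    (M.semialgebraic_mem 0 {f}) fun x => by simp

theorem defSet_true : M.DefSet k fun _ => True :=
  (defSet_poly_eq_zero 0).congr fun x => by simp

theorem DefSet.forall_finite {ι : Type*} [Finite ι] {p : ι → (Fin k → ℝ) → Prop}
    (h : ∀ i, M.DefSet k (p i)) : M.DefSet k fun x => ∀ i, p i x := by
  classical
  have := Fintype.ofFinite ι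
  suffices H : ∀ s : Finset ι, M.DefSet k fun x => ∀ i ∈ s, p i x from
    (H Finset.univ).congr fun x => by simp
  intro s
  induction s using Finset.induction_on with
  | empty => exact defSet_true.congr fun x => by simp
  | insert a s ha ih => exact ((h a).and ih).congr fun x => by simp

theorem defSet_coord_eq (i j : Fin k) : M.DefSet k fun x => x i = x j :=
  (defSet_poly_eq_zero (MvPolynomial.X i - MvPolynomial.X j)).congr fun x => by
    simp [sub_eq_zero]

theorem DefSet.exists_tuple {p : (Fin (k + m) → ℝ) → Prop} (hp : M.DefSet (k + m) p) :
    M.DefSet k fun x => ∃ y : Fin m → ℝ, p (Fin.append x y) := by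
  have := M.proj_mem hp
  refine DefSet.congr this fun x => ⟨?_, ?_⟩
  · rintro ⟨z, hz, rfl⟩
    refine ⟨fun i => z (Fin.natAdd k i), ?_⟩
    rw [show Fin.append _ _ = z from Fin.append_castAdd_natAdd]
    exact hz
  · rintro ⟨y, hy⟩
    exact ⟨_, hy, by ext i; simp⟩

/-- Substituting coordinates, possibly repeated or permuted, is existential quantification: adjoin a
copy of the m coordinates, equate it with the chosen ones, and project it away. This turns products
and projections onto initial coordinates into a full first-order calculus. -/
theorem DefSet.reindex {p : (Fin m → ℝ) → Prop} (hp : M.DefSet m p) (σ : Fin m → Fin k) :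
    M.DefSet k fun x => p fun i => x (σ i) := by
  have h1 : M.DefSet (k + m) fun z => True ∧ p fun i => z (Fin.natAdd k i) :=
    M.prod_mem (defSet_true (M := M) (k := k)) hp
  have h2 : M.DefSet (k + m) fun z => ∀ i, z (Fin.natAdd k i) = z (Fin.castAdd m (σ i)) :=
    DefSet.forall_finite fun i => defSet_coord_eq _ _
  refine (h1.and h2).exists_tuple.congr fun x => ⟨?_, ?_⟩
  · rintro ⟨y, ⟨-, hy⟩, h⟩
    simp only [Fin.append_right, Fin.append_left] at hy h
    rwa [← funext h]
  · intro h
    exact ⟨fun i => x (σ i), by simpa using h⟩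

theorem DefSet.subst {p : (Fin m → ℝ) → Prop} (hp : M.DefSet m p)
    {f : Fin m → (Fin k → ℝ) → ℝ} (hf : ∀ i, M.DefFun k (f i)) :
    M.DefSet k fun x => p fun i => f i x := by
  have h1 : M.DefSet (k + m) fun z => p fun i => z (Fin.natAdd k i) := hp.reindex _
  have h2 : M.DefSet (k + m) fun z => ∀ i : Fin m, z (Fin.natAdd k i) =
      f i (fun j => z (Fin.castAdd m j)) := by
    refine DefSet.forall_finite fun i => ?_
    have := DefSet.reindex (hf i) (k := k + m)
      (Fin.lastCases (Fin.natAdd k i) fun j => Fin.castAdd m j)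
    simpa using this
  refine (h1.and h2).exists_tuple.congr fun x => ⟨?_, ?_⟩
  · rintro ⟨y, hy, h⟩
    simp only [Fin.append_right, Fin.append_left] at hy h
    rwa [← funext h]
  · intro h
    exact ⟨fun i => f i x, by simpa using h⟩

theorem DefSet.exists {p : (Fin k → ℝ) → ℝ → Prop}
    (hp : M.DefSet (k + 1) fun z => p (fun i => z i.castSucc) (z (Fin.last k))) :
    M.DefSet k fun x => ∃ y, p x y := by
  refine hp.exists_tuple.congr fun x => ⟨?_, ?_⟩
  · rintro ⟨y, hy⟩
    refine ⟨y 0, ?_⟩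
    convert hy
    · exact (Fin.append_left x y _).symm
    · exact (Fin.append_right x y 0).symm
  · rintro ⟨y, hy⟩
    refine ⟨fun _ => y, ?_⟩
    convert hy with i
    · exact (Fin.append_left x (fun _ : Fin 1 => y) _)
    · exact (Fin.append_right x (fun _ : Fin 1 => y) 0)

theorem DefSet.forall {p : (Fin k → ℝ) → ℝ → Prop}
    (hp : M.DefSet (k + 1) fun z => p (fun i => z i.castSucc) (z (Fin.last k))) :
    M.DefSet k fun x => ∀ y, p x y :=
  (DefSet.exists (p := fun x y => ¬ p x y) hp.not).not.congr fun x => by simp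

end sets

/-! ### Definable functions of several variables -/

section functions
variable {k m : ℕ} {f g : (Fin k → ℝ) → ℝ}

theorem defFun_poly (q : MvPolynomial (Fin k) ℝ) : M.DefFun k fun x => MvPolynomial.eval x q :=
  (defSet_poly_eq_zero
    (MvPolynomial.X (Fin.last k) - MvPolynomial.rename Fin.castSucc q)).congr fun x => by
      simp [sub_eq_zero, MvPolynomial.eval_rename, Function.comp_def]

theorem defFun_coord (i : Fin k) : M.DefFun k fun x => x i := by
  simpa using defFun_poly (M := M) (MvPolynomial.X i)

theorem defFun_const (c : ℝ) : M.DefFun k fun _ => c := by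
  simpa using defFun_poly (M := M) (k := k) (MvPolynomial.C c)

theorem DefFun.comp {g : (Fin m → ℝ) → ℝ} (hg : M.DefFun m g)
    {f : Fin m → (Fin k → ℝ) → ℝ} (hf : ∀ i, M.DefFun k (f i)) :
    M.DefFun k fun x => g fun i => f i x := by
  have hf' : ∀ i, M.DefFun (k + 1) fun x => f i fun j => x j.castSucc := fun i => by
    have := DefSet.reindex (hf i) (k := k + 1 + 1)
      (Fin.lastCases (Fin.last _) fun j => j.castSucc.castSucc)
    exact this.congr fun x => by simp
  have := DefSet.subst hg (k := k + 1)
    (f := Fin.lastCases (fun x => x (Fin.last k)) fun i => fun x => f i fun j => x j.castSucc)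
    (fun i => by
      induction i using Fin.lastCases with
      | last => simpa using defFun_coord _
      | cast i => simpa using hf' i)
  exact this.congr fun x => by simp

theorem DefFun.congr (hf : M.DefFun k f) (h : ∀ x, f x = g x) : M.DefFun k g := by
  rwa [show g = f from funext fun x => (h x).symm]

theorem DefFun.add (hf : M.DefFun k f) (hg : M.DefFun k g) : M.DefFun k fun x => f x + g x := by
  exact ((defFun_poly (M := M) (MvPolynomial.X 0 + MvPolynomial.X 1)).comp (f := ![f, g])
    (fun i => by fin_cases i <;> assumption)).congr fun x => by simp

theorem DefFun.mul (hf : M.DefFun k f) (hg : M.DefFun k g) : M.DefFun k fun x => f x * g x := by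
  exact ((defFun_poly (M := M) (MvPolynomial.X 0 * MvPolynomial.X 1)).comp (f := ![f, g])
    (fun i => by fin_cases i <;> assumption)).congr fun x => by simp

theorem DefFun.neg (hf : M.DefFun k f) : M.DefFun k fun x => - f x := by
  simpa using (defFun_const (M := M) (-1)).mul hf

theorem DefFun.sub (hf : M.DefFun k f) (hg : M.DefFun k g) : M.DefFun k fun x => f x - g x := by
  simpa [sub_eq_add_neg] using hf.add hg.neg

theorem DefFun.pow (hf : M.DefFun k f) (r : ℕ) : M.DefFun k fun x => f x ^ r := by
  induction r with
  | zero => simpa using defFun_const 1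
  | succ r ih => simpa [pow_succ] using ih.mul hf

theorem DefFun.eq (hf : M.DefFun k f) (hg : M.DefFun k g) : M.DefSet k fun x => f x = g x :=
  (DefSet.subst (defSet_coord_eq (0 : Fin 2) 1) (f := ![f, g])
    (fun i => by fin_cases i <;> assumption))

theorem DefFun.lt (hf : M.DefFun k f) (hg : M.DefFun k g) : M.DefSet k fun x => f x < g x :=
  (DefSet.subst (defSet_poly_pos (M := M) (k := 1) (MvPolynomial.X 0))
    (f := fun _ x => g x - f x) (fun _ => hg.sub hf)).congr fun x => by simp

theorem DefFun.le (hf : M.DefFun k f) (hg : M.DefFun k g) : M.DefSet k fun x => f x ≤ g x :=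
  (hg.lt hf).not.congr fun x => by simp

open Classical in
theorem DefFun.ite {p : (Fin k → ℝ) → Prop} (hp : M.DefSet k p) (hf : M.DefFun k f)
    (hg : M.DefFun k g) : M.DefFun k fun x => if p x then f x else g x := by
  have hp' : M.DefSet (k + 1) fun x => p fun i => x i.castSucc := hp.reindex _
  refine ((hp'.and hf).or (hp'.not.and hg)).congr fun x => ?_
  dsimp only
  split_ifs with h <;> simp [h]

end functions

/-- A function `ℝ → ℝ` with definable graph. -/
def Def (M : OMinimalStructure) (f : ℝ → ℝ) : Prop := M.DefFun 1 fun x => f (x 0)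

/-- A definable subset of `ℝ`. -/
def Def₁ (M : OMinimalStructure) (p : ℝ → Prop) : Prop := M.DefSet 1 fun x => p (x 0)

section oneVar
variable {k : ℕ} {f g : ℝ → ℝ} {p : ℝ → Prop}

theorem Def.comp (hf : M.Def f) {g : (Fin k → ℝ) → ℝ} (hg : M.DefFun k g) :
    M.DefFun k fun x => f (g x) := DefFun.comp hf (f := fun _ => g) fun _ => hg

theorem Def₁.comp (hp : M.Def₁ p) {g : (Fin k → ℝ) → ℝ} (hg : M.DefFun k g) :
    M.DefSet k fun x => p (g x) := DefSet.subst hp (f := fun _ => g) fun _ => hg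

open Classical in
theorem Def.ite (hp : M.Def₁ p) (hf : M.Def f) (hg : M.Def g) :
    M.Def fun t => if p t then f t else g t := DefFun.ite hp hf hg

theorem Def.definableOn (hf : M.Def f) {I : Set ℝ} (hI : M.Def₁ (· ∈ I)) : M.DefinableOn I f :=
  DefSet.and (hI.comp (k := 2) (defFun_coord 0)) ((defFun_coord 1).eq (hf.comp (defFun_coord 0)))

theorem def_const (c : ℝ) : M.Def fun _ => c := defFun_const c

theorem Def.congr (hf : M.Def f) (h : ∀ t, f t = g t) : M.Def g := DefFun.congr hf fun _ => h _

open Classical in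
theorem DefinableOn.indicator {I : Set ℝ} (hf : M.DefinableOn I f) (hI : M.Def₁ (· ∈ I)) :
    M.Def fun t => if t ∈ I then f t else 0 := by
  have h0 : M.DefSet 2 fun x => x 0 ∈ I := hI.comp (k := 2) (defFun_coord 0)
  refine DefSet.congr (DefSet.or hf (h0.not.and ((defFun_coord 1).eq (defFun_const 0)))) fun x => ?_
  have e : ((fun i : Fin 1 => x i.castSucc) 0) = x 0 := rfl
  have e' : x (Fin.last 1) = x 1 := rfl
  simp only [e, e']
  split_ifs with h <;> simp [h]

theorem def₁_iff {p : ℝ → Prop} : M.Def₁ p ↔ ∃ S : Set (Set ℝ), S.Finite ∧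
      (∀ s ∈ S, (IsOpen s ∧ s.OrdConnected) ∨ ∃ x : ℝ, s = {x}) ∧ ∀ x, p x ↔ ∃ s ∈ S, x ∈ s := by
  refine (M.mem_one_iff _).trans (exists_congr fun S => and_congr_right fun _ =>
    and_congr_right fun _ => ?_)
  constructor
  · intro h x
    have := Set.ext_iff.1 h fun _ => x
    simpa using this
  · intro h
    ext x
    simpa using h (x 0)

theorem def₁_of_isOpen {I : Set ℝ} (h : IsOpen I) (h' : I.OrdConnected) : M.Def₁ (· ∈ I) :=
  def₁_iff.2 ⟨{I}, Set.finite_singleton _, by simp [h, h'], by simp⟩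

end oneVar

end OMinimalStructure

/-! ### One-variable calculus of definable functions -/

theorem Set.OrdConnected.eventually_nhdsGT {s : Set ℝ} (hs : s.OrdConnected) (t : ℝ) :
    (∀ᶠ x in 𝓝[>] t, x ∈ s) ∨ ∀ᶠ x in 𝓝[>] t, x ∉ s := by
  by_cases h2 : ∃ᶠ x in 𝓝[>] t, x ∈ s
  swap
  · exact Or.inr (not_frequently.1 h2)
  left
  obtain ⟨b, hb, htb⟩ := (h2.and_eventually self_mem_nhdsWithin).exists
  filter_upwards [Ioo_mem_nhdsGT htb] with x hx
  obtain ⟨c, hc, hcx⟩ := (h2.and_eventually (Ioo_mem_nhdsGT hx.1)).exists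
  exact (hs.out hc hb ⟨hcx.2.le, hx.2.le⟩)

theorem Set.OrdConnected.finite_frontier {s : Set ℝ} (hs : s.OrdConnected) :
    (frontier s).Finite := by
  have h : frontier s ⊆ {t | IsLUB s t} ∪ {t | IsGLB s t} := by
    intro t ht
    by_cases h1 : ∀ x ∈ s, x ≤ t
    · exact Or.inl (isLUB_of_mem_closure h1 ht.1)
    by_cases h2 : ∀ x ∈ s, t ≤ x
    · exact Or.inr (isGLB_of_mem_closure h2 ht.1)
    push Not at h1 h2
    obtain ⟨b, hb, htb⟩ := h1
    obtain ⟨a, ha, hat⟩ := h2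
    exact (ht.2 (mem_interior_iff_mem_nhds.2
      (mem_of_superset (Icc_mem_nhds hat htb) (hs.out ha hb)))).elim
  refine Set.Finite.subset (Set.Finite.union ?_ ?_) h
  · exact Set.Subsingleton.finite fun x hx y hy => hx.unique hy
  · exact Set.Subsingleton.finite fun x hx y hy => hx.unique hy

theorem contDiffAt_zero_iff_eventually {f : ℝ → ℝ} {t₀ : ℝ} :
    ContDiffAt ℝ 0 f t₀ ↔ ∀ᶠ t in 𝓝 t₀, ContinuousAt f t := by
  rw [contDiffAt_zero]
  constructor
  · rintro ⟨u, hu, h⟩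
    filter_upwards [eventually_mem_nhds_iff.2 hu] with t ht using h.continuousAt ht
  · intro h
    exact ⟨_, h, fun t ht => (show ContinuousAt f t from ht).continuousWithinAt⟩

theorem contDiffAt_succ_of_hasDerivAt {f f' : ℝ → ℝ} {t₀ : ℝ} {m : ℕ}
    (h : ∀ᶠ t in 𝓝 t₀, HasDerivAt f (f' t) t) (h' : ContDiffAt ℝ m f' t₀) :
    ContDiffAt ℝ (m + 1 : ℕ) f t₀ := by
  rw [Nat.cast_add_one, contDiffAt_succ_iff_hasFDerivAt]
  refine ⟨fun t => ContinuousLinearMap.toSpanSingleton ℝ (f' t), ⟨_, h, fun t ht => ?_⟩, ?_⟩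
  · exact (show HasDerivAt f (f' t) t from ht).hasFDerivAt
  · exact ((ContinuousLinearMap.toSpanSingletonCLE (𝕜 := ℝ) (E := ℝ)).contDiff.contDiffAt).comp
      t₀ h'

theorem ContDiffAt.eventually_hasDerivAt {f : ℝ → ℝ} {t₀ : ℝ} {m : ℕ}
    (h : ContDiffAt ℝ (m + 1 : ℕ) f t₀) :
    (∀ᶠ t in 𝓝 t₀, HasDerivAt f (deriv f t) t) ∧ ContDiffAt ℝ m (deriv f) t₀ := by
  constructor
  · filter_upwards [h.eventually (by simp)] with t ht
    exact (ht.differentiableAt (by simp)).hasDerivAt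
  · rw [show _root_.deriv f = fun t => fderiv ℝ f t 1 from funext fun t => fderiv_apply_one_eq_deriv.symm]
    exact (h.fderiv_right (m := m) (by simp)).clm_apply contDiffAt_const

namespace OMinimalStructure

/-! ### Dichotomies for definable subsets of the line, and definability of derivatives -/

variable {M : OMinimalStructure}

section sets
variable {p : ℝ → Prop}

/-- Each of the finitely many convex pieces either contains or misses a right neighbourhood of t.
This dichotomy, together with the finiteness of the boundary, is how o-minimality is used below. -/
theorem Def₁.eventually_nhdsGT (hp : M.Def₁ p) (t : ℝ) :
    (∀ᶠ x in 𝓝[>] t, p x) ∨ ∀ᶠ x in 𝓝[>] t, ¬ p x := by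
  obtain ⟨S, hS, hS', h⟩ := def₁_iff.1 hp
  have hc : ∀ s ∈ S, s.OrdConnected := fun s hs => by
    rcases hS' s hs with h | ⟨x, rfl⟩
    · exact h.2
    · exact Set.ordConnected_singleton
  simp only [h]
  by_cases h1 : ∃ s ∈ S, ∀ᶠ x in 𝓝[>] t, x ∈ s
  · obtain ⟨s, hs, h1⟩ := h1
    exact Or.inl (h1.mono fun x hx => ⟨s, hs, hx⟩)
  · right
    have : ∀ᶠ x in 𝓝[>] t, ∀ s ∈ S, x ∉ s :=
      (Filter.eventually_all_finite hS).2 fun s hs =>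
        ((hc s hs).eventually_nhdsGT t).resolve_left (fun h => h1 ⟨s, hs, h⟩)
    filter_upwards [this] with x hx
    push Not
    exact hx

theorem Def₁.exists_finset (hp : M.Def₁ p) : ∃ F : Finset ℝ, ∀ t ∉ F,
    (∀ᶠ x in 𝓝 t, p x) ∨ ∀ᶠ x in 𝓝 t, ¬ p x := by
  obtain ⟨S, hS, hS', h⟩ := def₁_iff.1 hp
  have hc : ∀ s ∈ S, s.OrdConnected := fun s hs => by
    rcases hS' s hs with h | ⟨x, rfl⟩
    · exact h.2
    · exact Set.ordConnected_singleton
  refine ⟨(hS.biUnion fun s hs => (hc s hs).finite_frontier).toFinset, fun t ht => ?_⟩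
  simp only [Set.Finite.mem_toFinset, Set.mem_iUnion, not_exists] at ht
  simp only [h]
  by_cases h1 : ∃ s ∈ S, t ∈ interior s
  · obtain ⟨s, hs, h1⟩ := h1
    exact Or.inl (mem_of_superset (mem_interior_iff_mem_nhds.1 h1) fun x hx => ⟨s, hs, hx⟩)
  · push Not at h1
    right
    have : ∀ᶠ x in 𝓝 t, ∀ s ∈ S, x ∉ s :=
      (Filter.eventually_all_finite hS).2 fun s hs => by
        have : t ∉ closure s := fun hts => ht s hs ⟨hts, h1 s hs⟩
        simpa using isClosed_closure.isOpen_compl.eventually_mem this |>.mono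
          fun x hx hxs => hx (subset_closure hxs)
    filter_upwards [this] with x hx
    push Not
    exact hx

theorem Def₁.eventually_nhdsLT (hp : M.Def₁ p) (t : ℝ) :
    (∀ᶠ x in 𝓝[<] t, p x) ∨ ∀ᶠ x in 𝓝[<] t, ¬ p x := by
  have h : M.Def₁ fun x => p (-x) := hp.comp (defFun_coord 0).neg
  refine (h.eventually_nhdsGT (-t)).imp (fun h => ?_) fun h => ?_
  all_goals simpa using tendsto_neg_nhdsLT.eventually h

end sets

theorem DefFun.abs {k : ℕ} {f : (Fin k → ℝ) → ℝ} (hf : M.DefFun k f) :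
    M.DefFun k fun x => |f x| := by
  classical
  refine (DefFun.ite ((defFun_const 0).le hf) hf hf.neg).congr fun x => ?_
  split_ifs with h
  · rw [abs_of_nonneg h]
  · rw [abs_of_neg (not_le.1 h)]

section deriv
variable {g : ℝ → ℝ}

/-- The ε-δ definition of the derivative is a first-order formula in the graph of g. -/
theorem Def.defSet_hasDerivAt (hg : M.Def g) :
    M.DefSet 2 fun x => HasDerivAt g (x 1) (x 0) := by
  have : ∀ x : Fin 2 → ℝ, HasDerivAt g (x 1) (x 0) ↔ ∀ c, 0 < c → ∃ δ, 0 < δ ∧ ∀ y,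
      |y - x 0| < δ → |g y - g (x 0) - (y - x 0) * x 1| ≤ c * |y - x 0| := by
    intro x
    simp only [hasDerivAt_iff_isLittleO, isLittleO_iff, Metric.eventually_nhds_iff,
      Real.dist_eq, Real.norm_eq_abs, smul_eq_mul, gt_iff_lt]
  refine DefSet.congr ?_ fun x => (this x).symm
  refine DefSet.forall (DefSet.imp ((defFun_const 0).lt (defFun_coord 2)) (DefSet.exists
    (DefSet.and ((defFun_const 0).lt (defFun_coord 3)) (DefSet.forall (DefSet.imp
      (DefFun.lt (DefFun.abs ((defFun_coord 4).sub (defFun_coord 0))) (defFun_coord 3))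
      (DefFun.le (DefFun.abs (DefFun.sub (DefFun.sub (hg.comp (defFun_coord 4))
        (hg.comp (defFun_coord 0))) (DefFun.mul ((defFun_coord 4).sub (defFun_coord 0))
          (defFun_coord 1)))) (DefFun.mul (defFun_coord 2)
            (DefFun.abs ((defFun_coord 4).sub (defFun_coord 0))))))))))

theorem Def.differentiableAt (hg : M.Def g) : M.Def₁ fun t => DifferentiableAt ℝ g t := by
  refine DefSet.congr (DefSet.exists (k := 1) (p := fun x L => HasDerivAt g L (x 0))
    (hg.defSet_hasDerivAt)) fun x => ?_
  exact ⟨fun ⟨L, h⟩ => h.differentiableAt, fun h => ⟨_, h.hasDerivAt⟩⟩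

theorem Def.deriv (hg : M.Def g) : M.Def (deriv g) := by
  have h0 : M.DefSet 2 fun x => DifferentiableAt ℝ g (x 0) :=
    hg.differentiableAt.comp (defFun_coord 0)
  refine DefSet.congr (DefSet.or hg.defSet_hasDerivAt
    (h0.not.and ((defFun_coord 1).eq (defFun_const 0)))) fun x => ?_
  change _ ↔ x 1 = _root_.deriv g (x 0)
  constructor
  · rintro (h | ⟨h, h'⟩)
    · exact h.deriv.symm
    · rw [h', deriv_zero_of_not_differentiableAt h]
  · intro h
    by_cases hd : DifferentiableAt ℝ g (x 0)
    · exact Or.inl (h ▸ hd.hasDerivAt)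
    · exact Or.inr ⟨hd, by rw [h, deriv_zero_of_not_differentiableAt hd]⟩

theorem Def.neg (hg : M.Def g) : M.Def fun t => - g t := DefFun.neg hg

end deriv

end OMinimalStructure

/-! ### Eventual monotonicity, and the regularity gained by multiplication with t - t₀ -/

namespace OMinimalStructure

variable {M : OMinimalStructure} {g : ℝ → ℝ} {a b t₀ : ℝ}

/-- `g` has the intermediate value property on `(a, b)`. -/
def Darboux (g : ℝ → ℝ) (a b : ℝ) : Prop :=
  ∀ J ⊆ Set.Ioo a b, J.OrdConnected → (g '' J).OrdConnected

/-- If g x < g y with x < y, let s be the supremum of the z in [x, y] with g z ≤ g x. If g s ≤ g x,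
the hypothesis at s produces such points beyond s. If g s > g x, points with g ≤ g x accumulate at s
from the left, so by o-minimality g ≤ g x on a whole left neighbourhood of s; then g jumps over (g x
+ g s)/2, against the intermediate value property. Continuity is deliberately not assumed, since the
lemma is also applied to derivatives. -/
theorem Def.antitoneOn_of_darboux (hg : M.Def g) (hD : Darboux g a b)
    (h : ∀ t ∈ Set.Ioo a b, ∀ᶠ s in 𝓝[>] t, g s ≤ g t) : AntitoneOn g (Set.Ioo a b) := by
  intro x hx y hy hxy
  by_contra! hlt
  have hxy' : x < y := lt_of_le_of_ne hxy (by rintro rfl; exact lt_irrefl _ hlt)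
  set S := {z | z ∈ Set.Icc x y ∧ g z ≤ g x} with hS
  have hxS : x ∈ S := ⟨⟨le_rfl, hxy⟩, le_rfl⟩
  have hbd : BddAbove S := ⟨y, fun z hz => hz.1.2⟩
  set s := sSup S with hs
  have hxs : x ≤ s := le_csSup hbd hxS
  have hsy : s ≤ y := csSup_le ⟨x, hxS⟩ fun z hz => hz.1.2
  have hgt : ∀ z, s < z → z ≤ y → g x < g z := fun z hz hzy => by
    by_contra! hc
    exact hz.not_ge (le_csSup hbd ⟨⟨hxs.trans hz.le, hzy⟩, hc⟩)
  rcases le_or_gt (g s) (g x) with hc | hc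
  · have hsy' : s < y := lt_of_le_of_ne hsy fun h => (h ▸ hc).not_gt hlt
    obtain ⟨z, hz, hz'⟩ := ((h s ⟨hx.1.trans_le hxs, hsy.trans_lt hy.2⟩).and
      (Ioo_mem_nhdsGT hsy')).exists
    exact (hz.trans hc).not_gt (hgt z hz'.1 hz'.2.le)
  · have hxs' : x < s := lt_of_le_of_ne hxs fun h => (h ▸ hc).ne rfl
    have hp : M.Def₁ fun z => g z ≤ g x := DefFun.le hg (defFun_const _)
    have hev : ∀ᶠ z in 𝓝[<] s, g z ≤ g x := by
      refine (hp.eventually_nhdsLT s).resolve_right fun hn => ?_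
      obtain ⟨c, hcs, hc'⟩ := (mem_nhdsLT_iff_exists_Ioo_subset).1 hn
      obtain ⟨z, hz, hcz⟩ := exists_lt_of_lt_csSup ⟨x, hxS⟩ (show c < sSup S from hcs)
      have hzs : z < s := lt_of_le_of_ne (le_csSup hbd hz) fun h => (h ▸ hc).not_ge hz.2
      exact hc' ⟨hcz, hzs⟩ hz.2
    obtain ⟨c, hcs, hc'⟩ := (mem_nhdsLT_iff_exists_Ioo_subset).1 hev
    obtain ⟨z, hz1, hz2⟩ := exists_between (max_lt hcs hxs')
    rw [max_lt_iff] at hz1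
    have hsub : Set.Icc z s ⊆ Set.Ioo a b := fun w hw =>
      ⟨hx.1.trans (hz1.2.trans_le hw.1), (hw.2.trans hsy).trans_lt hy.2⟩
    have hgz : g z ≤ g x := hc' ⟨hz1.1, hz2⟩
    obtain ⟨w, hw, hw'⟩ := (hD _ hsub Set.ordConnected_Icc).out
      ⟨z, ⟨le_rfl, hz2.le⟩, rfl⟩ ⟨s, ⟨hz2.le, le_rfl⟩, rfl⟩
      (show (g x + g s) / 2 ∈ Set.Icc (g z) (g s) from ⟨by linarith, by linarith⟩)
    rcases hw.2.eq_or_lt with rfl | hws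
    · linarith
    · have : g w ≤ g x := hc' ⟨hz1.1.trans_le hw.1, hws⟩
      linarith

theorem Def.def₁_eventually_le (hg : M.Def g) : M.Def₁ fun t => ∀ᶠ s in 𝓝[>] t, g s ≤ g t := by
  have : ∀ x : Fin 1 → ℝ, (∃ u, x 0 < u ∧ ∀ s, x 0 < s → s < u → g s ≤ g (x 0)) ↔
      ∀ᶠ s in 𝓝[>] (x 0), g s ≤ g (x 0) := fun x =>
    ⟨fun ⟨u, hu, h⟩ => by filter_upwards [Ioo_mem_nhdsGT hu] with s hs using h s hs.1 hs.2,
      fun h => by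
        obtain ⟨u, hu, h⟩ := mem_nhdsGT_iff_exists_Ioo_subset.1 h
        exact ⟨u, hu, fun s h1 h2 => h ⟨h1, h2⟩⟩⟩
  refine DefSet.congr ?_ this
  exact DefSet.exists (DefSet.and (DefFun.lt (defFun_coord 0) (defFun_coord 1)) (DefSet.forall
    (DefSet.imp (DefFun.lt (defFun_coord 0) (defFun_coord 2)) (DefSet.imp
      (DefFun.lt (defFun_coord 2) (defFun_coord 1)) (DefFun.le (hg.comp (defFun_coord 2))
        (hg.comp (defFun_coord 0)))))))

theorem Darboux.neg (hD : Darboux g a b) : Darboux (fun t => - g t) a b := fun J hJ hJ' => by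
  have h := hD J hJ hJ'
  constructor
  rintro _ ⟨x, hx, rfl⟩ _ ⟨y, hy, rfl⟩ v hv
  obtain ⟨w, hw, hw'⟩ := h.out ⟨y, hy, rfl⟩ ⟨x, hx, rfl⟩
    (show -v ∈ Set.Icc (g y) (g x) from ⟨by linarith [hv.2], by linarith [hv.1]⟩)
  exact ⟨w, hw, by simp [hw']⟩

/-- The dichotomy is used twice: at each t it decides whether g s ≤ g t or g s > g t just to the
right of t, and at a it makes this decision uniform in t. In the second case the argument applies to
-g. -/
theorem Def.monotoneOn_or_antitoneOn (hg : M.Def g) (hab : a < b) (hD : Darboux g a b) :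
    ∃ c ∈ Set.Ioo a b, MonotoneOn g (Set.Ioo a c) ∨ AntitoneOn g (Set.Ioo a c) := by
  have key : ∀ {f : ℝ → ℝ}, M.Def f → Darboux f a b →
      (∀ᶠ t in 𝓝[>] a, ∀ᶠ s in 𝓝[>] t, f s ≤ f t) →
      ∃ c ∈ Set.Ioo a b, AntitoneOn f (Set.Ioo a c) := by
    intro f hf hfD h
    obtain ⟨u, hu, h⟩ := mem_nhdsGT_iff_exists_Ioo_subset.1 h
    obtain ⟨c, hac, hc⟩ := exists_between (lt_min hab hu)
    rw [lt_min_iff] at hc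
    refine ⟨c, ⟨hac, hc.1⟩, hf.antitoneOn_of_darboux (b := c)
      (fun J hJ => hfD J (hJ.trans (Set.Ioo_subset_Ioo_right hc.1.le)))
      fun t ht => h ⟨ht.1, ht.2.trans hc.2⟩⟩
  rcases hg.def₁_eventually_le.eventually_nhdsGT a with h | h
  · obtain ⟨c, hc, h⟩ := key hg hD h
    exact ⟨c, hc, Or.inr h⟩
  · obtain ⟨c, hc, h⟩ := key hg.neg hD.neg (h.mono fun t ht => by
      have hp : M.Def₁ fun s => g s ≤ g t := DefFun.le hg (defFun_const _)
      filter_upwards [(hp.eventually_nhdsGT t).resolve_left ht] with s hs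
      linarith)
    exact ⟨c, hc, Or.inl fun x hx y hy hxy => neg_le_neg_iff.1 (h hx hy hxy)⟩

/-- By the dichotomy, failure would mean nowhere differentiability on an interval, which Lebesgue's
theorem on monotone functions forbids. -/
theorem Def.eventually_differentiableAt (hg : M.Def g) (hab : a < b)
    (h : MonotoneOn g (Set.Ioo a b) ∨ AntitoneOn g (Set.Ioo a b)) :
    ∀ᶠ t in 𝓝[>] a, DifferentiableAt ℝ g t := by
  refine (hg.differentiableAt.eventually_nhdsGT a).resolve_right fun hn => ?_
  obtain ⟨u, hu, hn⟩ := mem_nhdsGT_iff_exists_Ioo_subset.1 hn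
  have hae : ∀ᵐ x, x ∈ Set.Ioo a b → DifferentiableWithinAt ℝ g (Set.Ioo a b) x := by
    rcases h with h | h
    · exact h.ae_differentiableWithinAt_of_mem
    · filter_upwards [h.neg.ae_differentiableWithinAt_of_mem] with x hx hx'
      simpa using (hx hx').neg
  have h0 : MeasureTheory.volume (Set.Ioo a (min u b)) = 0 := by
    refine MeasureTheory.measure_mono_null (fun x hx => ?_) hae
    simp only [Set.mem_Ioo, lt_min_iff] at hx
    simp only [Set.mem_compl_iff, Set.mem_ofPred_eq]
    intro h'
    exact hn ⟨hx.1, hx.2.1⟩ ((h' ⟨hx.1, hx.2.2⟩).differentiableAt (Ioo_mem_nhds hx.1 hx.2.2))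
  rw [Real.volume_Ioo, ENNReal.ofReal_eq_zero, sub_nonpos] at h0
  exact h0.not_gt (lt_min hu hab)

theorem darboux_of_continuousAt (h : ∀ t ∈ Set.Ioo a b, ContinuousAt g t) : Darboux g a b :=
  fun _ hJ hJ' => (hJ'.isPreconnected.image g fun t ht =>
    (h t (hJ ht)).continuousWithinAt).ordConnected

/-- A continuous definable function is, on a right neighbourhood of `t₀`, continuously
differentiable with monotone derivative. -/
theorem Def.eventually_nhdsGT_deriv (hg : M.Def g) (hc : ∀ᶠ t in 𝓝[>] t₀, ContinuousAt g t) :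
    ∃ c > t₀, (∀ t ∈ Set.Ioo t₀ c, DifferentiableAt ℝ g t ∧ ContinuousAt (_root_.deriv g) t) ∧
      (MonotoneOn (_root_.deriv g) (Set.Ioo t₀ c) ∨ AntitoneOn (_root_.deriv g) (Set.Ioo t₀ c)) := by
  obtain ⟨b, hb, hc⟩ := mem_nhdsGT_iff_exists_Ioo_subset.1 hc
  obtain ⟨c, hc, hmono⟩ := hg.monotoneOn_or_antitoneOn hb (darboux_of_continuousAt hc)
  obtain ⟨u, hu, hd⟩ := mem_nhdsGT_iff_exists_Ioo_subset.1
    (hg.eventually_differentiableAt hc.1 hmono)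
  -- Derivatives have the intermediate value property, so the monotonicity argument applies to g'
  -- before its continuity is known; eventual differentiability of g' then yields that continuity.
  have hD : Darboux (_root_.deriv g) t₀ u := fun J hJ hJ' =>
    hJ'.image_deriv fun x hx => hd (hJ hx)
  obtain ⟨v, hv, hmono'⟩ := hg.deriv.monotoneOn_or_antitoneOn hu hD
  obtain ⟨w, hw, hd'⟩ := mem_nhdsGT_iff_exists_Ioo_subset.1
    (hg.deriv.eventually_differentiableAt hv.1 hmono')
  refine ⟨min v w, lt_min hv.1 hw, fun t ht => ?_, ?_⟩
  · simp only [Set.mem_Ioo, lt_min_iff] at ht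
    exact ⟨hd ⟨ht.1, ht.2.1.trans hv.2⟩,
      (show DifferentiableAt ℝ _ t from hd' ⟨ht.1, ht.2.2⟩).continuousAt⟩
  · have hsub : Set.Ioo t₀ (min v w) ⊆ Set.Ioo t₀ v := Set.Ioo_subset_Ioo_right (min_le_left _ _)
    exact hmono'.imp (fun h => h.mono hsub) fun h => h.mono hsub

/-- For decreasing g', the mean value theorem on [t, 2t-t₀] and on [(t+t₀)/2, t] squeezes
(t-t₀)g'(t) between g(2t-t₀) - g(t) and 2(g(t) - g((t+t₀)/2)), both of which tend to 0 by continuity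
of g at t₀. -/
theorem tendsto_sub_mul_deriv {c : ℝ} (hc : t₀ < c) (hg : ContinuousAt g t₀)
    (hd : ∀ t ∈ Set.Ioo t₀ c, DifferentiableAt ℝ g t)
    (hm : AntitoneOn (deriv g) (Set.Ioo t₀ c)) :
    Tendsto (fun t => (t - t₀) * deriv g t) (𝓝[>] t₀) (𝓝 0) := by
  have mvt : ∀ x y, t₀ < x → x < y → y < c → ∃ ξ ∈ Set.Ioo x y,
      deriv g ξ * (y - x) = g y - g x := by
    intro x y hx hxy hy
    have hsub : Set.Icc x y ⊆ Set.Ioo t₀ c := fun z hz => ⟨hx.trans_le hz.1, hz.2.trans_lt hy⟩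
    obtain ⟨ξ, hξ, h⟩ := exists_deriv_eq_slope g hxy
      (fun z hz => (hd z (hsub hz)).continuousAt.continuousWithinAt)
      (fun z hz => (hd z (hsub (Set.Ioo_subset_Icc_self hz))).differentiableWithinAt)
    refine ⟨ξ, hξ, ?_⟩
    rw [h, div_mul_cancel₀ _ (sub_pos.2 hxy).ne']
  have h1 : Tendsto (fun t => g (2 * t - t₀) - g t) (𝓝[>] t₀) (𝓝 0) := by
    have e1 : Tendsto (fun t => g (2 * t - t₀)) (𝓝 t₀) (𝓝 (g t₀)) :=
      hg.tendsto.comp (Continuous.tendsto' (by fun_prop) _ _ (by ring))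
    simpa using (e1.sub hg.tendsto).mono_left nhdsWithin_le_nhds
  have h2 : Tendsto (fun t => 2 * (g t - g ((t + t₀) / 2))) (𝓝[>] t₀) (𝓝 0) := by
    have e1 : Tendsto (fun t => g ((t + t₀) / 2)) (𝓝 t₀) (𝓝 (g t₀)) :=
      hg.tendsto.comp (Continuous.tendsto' (by fun_prop) _ _ (by ring))
    simpa using ((hg.tendsto.sub e1).const_mul 2).mono_left nhdsWithin_le_nhds
  refine tendsto_of_tendsto_of_tendsto_of_le_of_le' h1 h2 ?_ ?_
  · filter_upwards [Ioo_mem_nhdsGT (show t₀ < (t₀ + c) / 2 by linarith)] with t ht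
    obtain ⟨ξ, hξ, h⟩ := mvt t (2 * t - t₀) ht.1 (by linarith [ht.1]) (by linarith [ht.2])
    rw [← h, show 2 * t - t₀ - t = t - t₀ by ring, mul_comm]
    exact mul_le_mul_of_nonneg_left (hm ⟨ht.1, by linarith [ht.2]⟩
      ⟨ht.1.trans hξ.1, by linarith [hξ.2, ht.2]⟩ hξ.1.le) (sub_nonneg.2 ht.1.le)
  · filter_upwards [Ioo_mem_nhdsGT hc] with t ht
    obtain ⟨ξ, hξ, h⟩ := mvt ((t + t₀) / 2) t (by linarith [ht.1]) (by linarith [ht.1]) ht.2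
    rw [← h, show 2 * (deriv g ξ * (t - (t + t₀) / 2)) = (t - t₀) * deriv g ξ by ring]
    exact mul_le_mul_of_nonneg_left (hm ⟨by linarith [hξ.1, ht.1], hξ.2.trans ht.2⟩
      ht hξ.2.le) (sub_nonneg.2 ht.1.le)

theorem Def.tendsto_nhdsGT (hg : M.Def g) (hc : ∀ᶠ t in 𝓝 t₀, ContinuousAt g t) :
    (∀ᶠ t in 𝓝[>] t₀, DifferentiableAt ℝ g t ∧ ContinuousAt (_root_.deriv g) t) ∧
      Tendsto (fun t => (t - t₀) * _root_.deriv g t) (𝓝[>] t₀) (𝓝 0) := by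
  obtain ⟨c, hct, hd, hm⟩ := hg.eventually_nhdsGT_deriv (hc.filter_mono nhdsWithin_le_nhds)
  refine ⟨?_, ?_⟩
  · filter_upwards [Ioo_mem_nhdsGT hct] with t ht using hd t ht
  · rcases hm with hm | hm
    · have hgc : ContinuousAt (fun t => - g t) t₀ := hc.self_of_nhds.neg
      have := tendsto_sub_mul_deriv hct hgc (fun t ht => (hd t ht).1.neg)
        (fun x hx y hy hxy => by simpa [deriv.fun_neg] using hm hx hy hxy)
      simpa [deriv.fun_neg] using this.neg
    · exact tendsto_sub_mul_deriv hct hc.self_of_nhds (fun t ht => (hd t ht).1) hm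

theorem Def.tendsto_nhdsLT (hg : M.Def g) (hc : ∀ᶠ t in 𝓝 t₀, ContinuousAt g t) :
    (∀ᶠ t in 𝓝[<] t₀, DifferentiableAt ℝ g t ∧ ContinuousAt (_root_.deriv g) t) ∧
      Tendsto (fun t => (t - t₀) * _root_.deriv g t) (𝓝[<] t₀) (𝓝 0) := by
  have hf : M.Def fun t => g (-t) := hg.comp (defFun_coord 0).neg
  have hfc : ∀ᶠ t in 𝓝 (-t₀), ContinuousAt (fun t => g (-t)) t := by
    have : Tendsto (fun t : ℝ => -t) (𝓝 (-t₀)) (𝓝 t₀) :=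
      Continuous.tendsto' continuous_neg _ _ (neg_neg _)
    filter_upwards [this.eventually hc] with t ht
    exact ContinuousAt.comp (f := fun t : ℝ => -t) ht continuous_neg.continuousAt
  obtain ⟨h1, h2⟩ := hf.tendsto_nhdsGT hfc
  have e : _root_.deriv (fun t => g (-t)) = fun t => - _root_.deriv g (-t) :=
    funext fun t => deriv_comp_neg g t
  rw [e] at h1 h2
  refine ⟨?_, ?_⟩
  · filter_upwards [tendsto_neg_nhdsLT.eventually h1] with t ht
    constructor
    · simpa [Function.comp_def] using ht.1.comp t differentiableAt_id.neg
    · have := (ContinuousAt.comp (f := fun t : ℝ => -t) ht.2 continuous_neg.continuousAt).neg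
      simpa [Function.comp_def, Pi.neg_def] using this
  · have := h2.comp tendsto_neg_nhdsLT
    refine this.congr fun t => ?_
    simp only [Function.comp, neg_neg]
    ring

/-- The one place where definability improves regularity. The derivative is g + (t-t₀)g'. For
continuous g the second term tends to 0 at t₀; for m > 0 the induction hypothesis applies to the
definable C^{m-1} function g'. -/
theorem Def.contDiffAt_sub_mul (hg : M.Def g) {m : ℕ} (h : ContDiffAt ℝ m g t₀) :
    ContDiffAt ℝ (m + 1 : ℕ) (fun t => (t - t₀) * g t) t₀ := by
  induction m generalizing g with
  | zero =>
    rw [Nat.cast_zero, contDiffAt_zero_iff_eventually] at h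
    obtain ⟨h1, h2⟩ := hg.tendsto_nhdsGT h
    obtain ⟨h3, h4⟩ := hg.tendsto_nhdsLT h
    have h5 : ∀ᶠ t in 𝓝[≠] t₀, DifferentiableAt ℝ g t ∧ ContinuousAt (_root_.deriv g) t := by
      rw [← nhdsLT_sup_nhdsGT, eventually_sup]
      exact ⟨h3, h1⟩
    have h6 : Tendsto (fun t => (t - t₀) * _root_.deriv g t) (𝓝[≠] t₀) (𝓝 0) := by
      rw [← nhdsLT_sup_nhdsGT, tendsto_sup]
      exact ⟨h4, h2⟩
    have h7 : ContinuousAt (fun t => (t - t₀) * _root_.deriv g t) t₀ := by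
      rw [continuousAt_iff_punctured_nhds]
      simpa using h6
    refine contDiffAt_succ_of_hasDerivAt (f' := fun t => g t + (t - t₀) * _root_.deriv g t) ?_ ?_
    · rw [eventually_nhdsWithin_iff] at h5
      filter_upwards [h5, h] with t ht htc
      rcases eq_or_ne t t₀ with rfl | hne
      · simp only [sub_self, zero_mul, add_zero]
        rw [hasDerivAt_iff_tendsto_slope]
        refine (htc.tendsto.mono_left nhdsWithin_le_nhds).congr' ?_
        filter_upwards [self_mem_nhdsWithin] with s hs
        have : s - t ≠ 0 := sub_ne_zero.2 hs
        simp [slope_def_field, this]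
      · have := ((hasDerivAt_id' t).sub_const t₀).fun_mul (ht hne).1.hasDerivAt
        simpa using this
    · rw [Nat.cast_zero, contDiffAt_zero_iff_eventually]
      rw [eventually_nhdsWithin_iff] at h5
      filter_upwards [h5, h] with t ht htc
      rcases eq_or_ne t t₀ with rfl | hne
      · exact htc.add h7
      · exact htc.add ((continuousAt_id.sub continuousAt_const).mul (ht hne).2)
  | succ m ih =>
    obtain ⟨h1, h2⟩ := h.eventually_hasDerivAt
    refine contDiffAt_succ_of_hasDerivAt (f' := fun t => g t + (t - t₀) * _root_.deriv g t) ?_ ?_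
    · filter_upwards [h1] with t ht
      simpa using ((hasDerivAt_id' t).sub_const t₀).fun_mul ht
    · exact h.add (ih hg.deriv h2)

/-- Near `t₀`, `g` coincides with a definable function. -/
def DefGerm (M : OMinimalStructure) (t₀ : ℝ) (g : ℝ → ℝ) : Prop := ∃ G, M.Def G ∧ g =ᶠ[𝓝 t₀] G

theorem DefGerm.contDiffAt_pow_mul (hg : M.DefGerm t₀ g) {m : ℕ} (h : ContDiffAt ℝ m g t₀)
    (r : ℕ) : ContDiffAt ℝ (m + r : ℕ) (fun t => (t - t₀) ^ r * g t) t₀ := by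
  obtain ⟨G, hG, hgG⟩ := hg
  replace h := h.congr_of_eventuallyEq hgG.symm
  refine ContDiffAt.congr_of_eventuallyEq (f := fun t => (t - t₀) ^ r * G t) ?_
    (hgG.mono fun t ht => by simp [ht])
  clear hgG
  induction r with
  | zero => simpa using h
  | succ r ih =>
    have hd : M.Def fun t => (t - t₀) ^ r * G t :=
      DefFun.mul (DefFun.pow (DefFun.sub (defFun_coord 0) (defFun_const _)) r) hG
    have := hd.contDiffAt_sub_mul ih
    rw [add_assoc] at this
    exact this.congr_of_eventuallyEq (.of_forall fun t => by simp only; ring)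

section germs
variable {f : ℝ → ℝ}

theorem DefGerm.congr (hf : M.DefGerm t₀ f) (h : f =ᶠ[𝓝 t₀] g) : M.DefGerm t₀ g :=
  let ⟨F, hF, h'⟩ := hf; ⟨F, hF, h.symm.trans h'⟩

theorem Def.defGerm (hf : M.Def f) (t₀ : ℝ) : M.DefGerm t₀ f := ⟨f, hf, .rfl⟩

theorem Def.add (hf : M.Def f) (hg : M.Def g) : M.Def fun t => f t + g t := DefFun.add hf hg

theorem Def.mul (hf : M.Def f) (hg : M.Def g) : M.Def fun t => f t * g t := DefFun.mul hf hg

theorem DefGerm.add (hf : M.DefGerm t₀ f) (hg : M.DefGerm t₀ g) :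
    M.DefGerm t₀ fun t => f t + g t :=
  let ⟨_, hF, hf⟩ := hf; let ⟨_, hG, hg⟩ := hg
  ⟨_, hF.add hG, hf.add hg⟩

theorem DefGerm.mul (hf : M.DefGerm t₀ f) (hg : M.DefGerm t₀ g) :
    M.DefGerm t₀ fun t => f t * g t :=
  let ⟨_, hF, hf⟩ := hf; let ⟨_, hG, hg⟩ := hg
  ⟨_, hF.mul hG, hf.mul hg⟩

end germs

end OMinimalStructure

/-! ### Division of differentiable functions by powers -/

/-- `ρ` is `Cᵐ` near `t₀` and vanishes at `t₀` together with its derivatives of order `≤ m`. -/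
def FlatAt (t₀ : ℝ) : ℕ → (ℝ → ℝ) → Prop
  | 0, ρ => (∀ᶠ t in 𝓝 t₀, ContinuousAt ρ t) ∧ ρ t₀ = 0
  | m + 1, ρ => ρ t₀ = 0 ∧ ∃ ρ', (∀ᶠ t in 𝓝 t₀, HasDerivAt ρ (ρ' t) t) ∧ FlatAt t₀ m ρ'

section flat
variable {t₀ : ℝ} {m : ℕ} {ρ σ f g : ℝ → ℝ}

theorem FlatAt.apply_eq_zero (h : FlatAt t₀ m ρ) : ρ t₀ = 0 := by
  cases m
  · exact h.2
  · exact h.1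

theorem FlatAt.contDiffAt (h : FlatAt t₀ m ρ) : ContDiffAt ℝ m ρ t₀ := by
  induction m generalizing ρ with
  | zero => exact contDiffAt_zero_iff_eventually.2 h.1
  | succ m ih =>
    obtain ⟨-, ρ', h1, h2⟩ := h
    exact contDiffAt_succ_of_hasDerivAt h1 (ih h2)

theorem FlatAt.of_succ (h : FlatAt t₀ (m + 1) ρ) : FlatAt t₀ m ρ := by
  induction m generalizing ρ with
  | zero => exact ⟨h.2.choose_spec.1.mono fun t ht => ht.continuousAt, h.1⟩
  | succ m ih =>
    obtain ⟨h0, ρ', h1, h2⟩ := h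
    exact ⟨h0, ρ', h1, ih h2⟩

theorem FlatAt.mono {k : ℕ} (h : FlatAt t₀ m ρ) (hk : k ≤ m) : FlatAt t₀ k ρ := by
  induction m, hk using Nat.le_induction with
  | base => exact h
  | succ m _ ih => exact ih h.of_succ

theorem FlatAt.sub (hρ : FlatAt t₀ m ρ) (hσ : FlatAt t₀ m σ) :
    FlatAt t₀ m fun t => ρ t - σ t := by
  induction m generalizing ρ σ with
  | zero => exact ⟨by filter_upwards [hρ.1, hσ.1] with t h1 h2 using h1.sub h2, by
      simp [hρ.2, hσ.2]⟩
  | succ m ih =>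
    obtain ⟨h0, ρ', h1, h2⟩ := hρ
    obtain ⟨k0, σ', k1, k2⟩ := hσ
    exact ⟨by simp [h0, k0], _, by filter_upwards [h1, k1] with t h1 h2 using h1.fun_sub h2,
      ih h2 k2⟩

theorem FlatAt.const_mul (hρ : FlatAt t₀ m ρ) (c : ℝ) : FlatAt t₀ m fun t => c * ρ t := by
  induction m generalizing ρ with
  | zero => exact ⟨by filter_upwards [hρ.1] with t h1 using continuousAt_const.mul h1, by
      simp [hρ.2]⟩
  | succ m ih =>
    obtain ⟨h0, ρ', h1, h2⟩ := hρ
    exact ⟨by simp [h0], _, by filter_upwards [h1] with t h1 using h1.const_mul c, ih h2⟩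

theorem FlatAt.isLittleO (h : FlatAt t₀ m ρ) : ρ =o[𝓝 t₀] fun t => (t - t₀) ^ m := by
  induction m generalizing ρ with
  | zero =>
    simp only [pow_zero, isLittleO_one_iff]
    simpa [ContinuousAt, h.2] using h.1.self_of_nhds
  | succ m ih =>
    obtain ⟨h0, ρ', h1, h2⟩ := h
    obtain ⟨ε, hε, h1⟩ := Metric.eventually_nhds_iff_ball.1 h1
    have := (convex_ball t₀ ε).isLittleO_pow_succ_real (Metric.mem_ball_self hε)
      (fun x hx => (h1 x hx).hasDerivWithinAt) ((ih h2).mono nhdsWithin_le_nhds)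
    simpa [h0, Metric.isOpen_ball.nhdsWithin_eq (Metric.mem_ball_self hε)] using this

theorem FlatAt.tendsto_div (h : FlatAt t₀ m ρ) :
    Tendsto (fun t => ρ t / (t - t₀) ^ m) (𝓝 t₀) (𝓝 0) :=
  h.isLittleO.tendsto_div_nhds_zero

/-- The derivative of the quotient is ρ'/(t-t₀)^j - jρ/(t-t₀)^{j+1}, where ρ' is flat of order m+j
and ρ of order m+(j+1), so the claim for m applies to both terms. As ρ(t₀) = 0, the quotient
evaluates to 0 at t₀, which is its limit; no case distinction is needed in its definition. -/
theorem FlatAt.div_pow {j : ℕ} (h : FlatAt t₀ (m + j) ρ) :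
    FlatAt t₀ m fun t => ρ t / (t - t₀) ^ j := by
  induction m generalizing ρ j with
  | zero =>
    rw [zero_add] at h
    have h1 : ∀ᶠ t in 𝓝 t₀, ContinuousAt ρ t := (h.mono (Nat.zero_le j)).1
    refine ⟨?_, by simp [h.apply_eq_zero]⟩
    filter_upwards [h1] with t ht
    rcases eq_or_ne t t₀ with rfl | hne
    · simpa [ContinuousAt, h.apply_eq_zero] using h.tendsto_div
    · exact ht.div (by fun_prop) (pow_ne_zero _ (sub_ne_zero.2 hne))
  | succ m ih =>
    have h' := h
    rw [show m + 1 + j = (m + j) + 1 by ring] at h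
    obtain ⟨h0, ρ', h1, h2⟩ := h
    have h3 : FlatAt t₀ (m + (j + 1)) ρ := by
      rwa [show m + (j + 1) = m + 1 + j by ring]
    refine ⟨by simp [h0], _, ?_, (ih h2).sub ((ih h3).const_mul j)⟩
    filter_upwards [h1] with t ht
    rcases eq_or_ne t t₀ with rfl | hne
    · have e : ρ' t / (t - t) ^ j - j * (ρ t / (t - t) ^ (j + 1)) = 0 := by
        simp [h0, h2.apply_eq_zero]
      rw [e, hasDerivAt_iff_tendsto_slope]
      refine (((h3.mono (by omega)).tendsto_div (m := j + 1)).mono_left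
        nhdsWithin_le_nhds).congr' ?_
      filter_upwards with s
      simp [slope_def_field, h0, pow_succ, div_div]
    · have hs : t - t₀ ≠ 0 := sub_ne_zero.2 hne
      have := ht.fun_div (((hasDerivAt_id' t).sub_const t₀).fun_pow j) (pow_ne_zero _ hs)
      refine this.congr_deriv ?_
      rcases j with _ | j
      · simp
      · simp only [Nat.add_sub_cancel]
        field_simp
        ring

theorem exists_polynomial_derivative_eq (Q : ℝ[X]) (c : ℝ) :
    ∃ R : ℝ[X], derivative R = Q ∧ R.eval 0 = c := by
  suffices h : ∃ R : ℝ[X], derivative R = Q by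
    obtain ⟨R, hR⟩ := h
    exact ⟨R + C (c - R.eval 0), by simp [hR], by simp⟩
  induction Q using Polynomial.induction_on' with
  | add p q hp hq =>
    obtain ⟨P, rfl⟩ := hp
    obtain ⟨Q, rfl⟩ := hq
    exact ⟨P + Q, by simp⟩
  | monomial n a =>
    refine ⟨monomial (n + 1) (a / (n + 1)), ?_⟩
    rw [derivative_monomial]
    have : (n : ℝ) + 1 ≠ 0 := by positivity
    simp [div_mul_cancel₀ _ this]

theorem ContDiffAt.exists_polynomial (h : ContDiffAt ℝ m f t₀) :
    ∃ Q : ℝ[X], FlatAt t₀ m fun t => f t - Q.eval (t - t₀) := by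
  induction m generalizing f with
  | zero =>
    refine ⟨C (f t₀), ?_, by simp⟩
    filter_upwards [contDiffAt_zero_iff_eventually.1 h] with t ht
    simpa using ht.fun_sub continuousAt_const
  | succ m ih =>
    obtain ⟨h1, h2⟩ := h.eventually_hasDerivAt
    obtain ⟨Q, hQ⟩ := ih h2
    obtain ⟨R, rfl, hR⟩ := exists_polynomial_derivative_eq Q (f t₀)
    refine ⟨R, by simp [hR], _, ?_, hQ⟩
    filter_upwards [h1] with t ht
    refine ht.fun_sub ?_
    simpa [Function.comp_def] using
      (R.hasDerivAt (t - t₀)).comp t ((hasDerivAt_id' t).sub_const t₀)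

theorem contDiffAt_eval_sub (Q : ℝ[X]) {N : WithTop ℕ∞} :
    ContDiffAt ℝ N (fun t => Q.eval (t - t₀)) t₀ :=
  ((Q.contDiff_aeval N).comp (contDiff_id.sub contDiff_const)).contDiffAt

/-- Either a `C^N` function is `o((t - t₀)^N)`, or it has a finite order of vanishing `k ≤ N`. -/
theorem ContDiffAt.isLittleO_or_exists {N : ℕ} (h : ContDiffAt ℝ N f t₀) :
    (f =o[𝓝 t₀] fun t => (t - t₀) ^ N) ∨ ∃ k ≤ N, ∃ g, ContDiffAt ℝ (N - k : ℕ) g t₀ ∧ g t₀ ≠ 0 ∧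
      ∀ᶠ t in 𝓝 t₀, f t = (t - t₀) ^ k * g t := by
  obtain ⟨Q, hQ⟩ := h.exists_polynomial
  -- Q is a Taylor polynomial: either it contributes nothing up to order N, or its lowest term gives
  -- the order of vanishing of f.
  by_cases hd : X ^ (N + 1) ∣ Q
  · left
    obtain ⟨R, rfl⟩ := hd
    have h1 : (fun t => (X ^ (N + 1) * R).eval (t - t₀)) =o[𝓝 t₀] fun t => (t - t₀) ^ N := by
      have : (fun t => R.eval (t - t₀) * (t - t₀)) =o[𝓝 t₀] fun _ => (1 : ℝ) := by
        rw [isLittleO_one_iff]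
        refine Continuous.tendsto' (by fun_prop) _ _ (by simp)
      refine ((isBigO_refl (fun t => (t - t₀) ^ N) (𝓝 t₀)).mul_isLittleO this).congr
        (fun t => ?_) fun t => by simp
      simp [pow_succ]; ring
    simpa using hQ.isLittleO.add h1
  · right
    have hQ0 : Q ≠ 0 := by rintro rfl; simp at hd
    obtain ⟨R, hR, hnd⟩ := Q.exists_eq_pow_rootMultiplicity_mul_and_not_dvd hQ0 0
    set k := Q.rootMultiplicity 0 with hk
    rw [C_0, sub_zero] at hR hnd
    have hkN : k ≤ N := by
      by_contra! hc
      exact hd ((pow_dvd_pow X hc).trans ⟨R, hR⟩)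
    have hQ' : FlatAt t₀ (N - k + k) fun t => f t - Q.eval (t - t₀) := by
      rwa [Nat.sub_add_cancel hkN]
    -- The flat remainder, divided by (t-t₀)^k, vanishes at t₀, so the value there is R(0), which is
    -- nonzero.
    refine ⟨k, hkN, fun t => R.eval (t - t₀) + (f t - Q.eval (t - t₀)) / (t - t₀) ^ k,
      (contDiffAt_eval_sub R).add hQ'.div_pow.contDiffAt, ?_, ?_⟩
    · have := hQ'.apply_eq_zero
      simp only [this, zero_div, add_zero]
      simpa [X_dvd_iff, coeff_zero_eq_eval_zero] using hnd
    · refine .of_forall fun t => ?_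
      rcases eq_or_ne t t₀ with rfl | hne
      · have := hQ'.apply_eq_zero
        rw [sub_eq_zero] at this
        simp only [this, sub_self, zero_div, add_zero]
        conv_lhs => rw [hR]
        simp
      · have hs : t - t₀ ≠ 0 := sub_ne_zero.2 hne
        rw [mul_add, mul_div_cancel₀ _ (pow_ne_zero _ hs)]
        conv_rhs => rw [hR]
        simp

theorem isBigO_pow_le_of_mul {k j : ℕ} (hg : ContinuousAt g t₀) (hg0 : g t₀ ≠ 0)
    (h : (fun t => (t - t₀) ^ k * g t) =O[𝓝 t₀] fun t => (t - t₀) ^ j) : j ≤ k := by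
  by_contra! hc
  have h1 : g =O[𝓝[≠] t₀] fun t => (t - t₀) ^ (j - k) := by
    obtain ⟨c, hc'⟩ := (h.mono nhdsWithin_le_nhds (l := 𝓝[≠] t₀)).bound
    refine IsBigO.of_bound c ?_
    filter_upwards [hc', self_mem_nhdsWithin] with t ht hne
    have hs : 0 < ‖(t - t₀) ^ k‖ := norm_pos_iff.2 (pow_ne_zero _ (sub_ne_zero.2 hne))
    rw [← Nat.sub_add_cancel hc.le, pow_add, norm_mul, norm_mul, mul_comm, ← mul_assoc] at ht
    exact le_of_mul_le_mul_right ht hs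
  have h2 : Tendsto (fun t : ℝ => (t - t₀) ^ (j - k)) (𝓝[≠] t₀) (𝓝 0) :=
    (Continuous.tendsto' (by fun_prop) _ _ (by
      simp [Nat.sub_ne_zero_of_lt hc])).mono_left nhdsWithin_le_nhds
  exact hg0 (tendsto_nhds_unique (hg.tendsto.mono_left nhdsWithin_le_nhds) (h1.trans_tendsto h2))

/-- The growth bound makes the Taylor polynomial divisible by X^j, and the flat remainder may be
divided by (t-t₀)^j at the cost of j derivatives. -/
theorem ContDiffAt.exists_eq_pow_mul {j : ℕ} (h : ContDiffAt ℝ (m + j : ℕ) f t₀)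
    (hO : f =O[𝓝 t₀] fun t => (t - t₀) ^ j) :
    ∃ g, ContDiffAt ℝ m g t₀ ∧ ∀ᶠ t in 𝓝 t₀, f t = (t - t₀) ^ j * g t := by
  obtain ⟨Q, hQ⟩ := h.exists_polynomial
  have hQO : (fun t => Q.eval (t - t₀)) =O[𝓝 t₀] fun t => (t - t₀) ^ j := by
    have := hO.sub (hQ.mono (Nat.le_add_left j m)).isLittleO.isBigO
    simpa using this
  have hd : X ^ j ∣ Q := by
    rcases eq_or_ne Q 0 with rfl | hQ0
    · simp
    obtain ⟨R, hR, hnd⟩ := Q.exists_eq_pow_rootMultiplicity_mul_and_not_dvd hQ0 0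
    rw [C_0, sub_zero] at hR hnd
    have hk : j ≤ Q.rootMultiplicity 0 := by
      refine isBigO_pow_le_of_mul (g := fun t => R.eval (t - t₀)) (t₀ := t₀) (by fun_prop) ?_ ?_
      · simpa [X_dvd_iff, coeff_zero_eq_eval_zero] using hnd
      · rw [hR] at hQO
        simpa using hQO
    exact (pow_dvd_pow X hk).trans ⟨R, hR⟩
  obtain ⟨R, rfl⟩ := hd
  refine ⟨_, (contDiffAt_eval_sub R).add hQ.div_pow.contDiffAt, .of_forall fun t => ?_⟩
  rcases eq_or_ne t t₀ with rfl | hne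
  · have := (hQ.mono (Nat.le_add_left j m)).apply_eq_zero
    rw [sub_eq_zero] at this
    simp only [this, sub_self, zero_div, add_zero]
    simp
  · have hs : t - t₀ ≠ 0 := sub_ne_zero.2 hne
    rw [mul_add, mul_div_cancel₀ _ (pow_ne_zero _ hs)]
    simp

theorem eventuallyEq_of_pow_mul {j : ℕ} (hf : ContinuousAt f t₀) (hg : ContinuousAt g t₀)
    (h : ∀ᶠ t in 𝓝 t₀, (t - t₀) ^ j * f t = (t - t₀) ^ j * g t) : f =ᶠ[𝓝 t₀] g := by
  have h1 : f =ᶠ[𝓝[≠] t₀] g := by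
    filter_upwards [h.filter_mono nhdsWithin_le_nhds, self_mem_nhdsWithin] with t ht hne
    exact mul_left_cancel₀ (pow_ne_zero _ (sub_ne_zero.2 hne)) ht
  exact (hf.eventuallyEq_nhds_iff_eventuallyEq_nhdsNE hg).1 h1

theorem ContDiffAt.of_pow_mul {j : ℕ} (h : ContDiffAt ℝ (m + j : ℕ) f t₀) (hg : ContinuousAt g t₀)
    (he : ∀ᶠ t in 𝓝 t₀, f t = (t - t₀) ^ j * g t) : ContDiffAt ℝ m g t₀ := by
  have hO : f =O[𝓝 t₀] fun t => (t - t₀) ^ j := by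
    have := (isBigO_refl (fun t => (t - t₀) ^ j) (𝓝 t₀)).mul (hg.isBigO_one ℝ)
    exact (this.congr_left (f₁ := fun t => (t - t₀) ^ j * g t) (fun t => rfl)).congr'
      (he.mono fun t ht => ht.symm) (.of_forall fun t => by simp)
  obtain ⟨k, hk, hk'⟩ := h.exists_eq_pow_mul hO
  refine hk.congr_of_eventuallyEq (eventuallyEq_of_pow_mul hg hk.continuousAt ?_ (j := j))
  filter_upwards [he, hk'] with t h1 h2
  rw [← h1, h2]

end flat

/-! ### Smooth dependence of coprime factors -/

/-- The polynomial `∑_{i < n} u_i Xⁱ`. -/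
noncomputable def lowPoly (n : ℕ) (u : Fin n → ℝ) : ℝ[X] := ∑ i, C (u i) * X ^ (i : ℕ)

section factor
variable {n n₁ n₂ : ℕ}

theorem lowPoly_coeff (u : Fin n → ℝ) (k : ℕ) :
    (lowPoly n u).coeff k = ∑ i, u i * if k = i then 1 else 0 := by
  simp [lowPoly, coeff_X_pow]

theorem lowPoly_coeff_fin (u : Fin n → ℝ) (i : Fin n) : (lowPoly n u).coeff i = u i := by
  simp [lowPoly_coeff, ← Fin.ext_iff]

theorem degree_lowPoly_lt (u : Fin n → ℝ) : (lowPoly n u).degree < n := by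
  refine (degree_sum_le _ _).trans_lt ((Finset.sup_lt_iff (WithBot.bot_lt_coe n)).2 fun i _ => ?_)
  exact (degree_C_mul_X_pow_le _ _).trans_lt (WithBot.coe_lt_coe.2 i.2)

theorem lowPoly_eq_zero {u : Fin n → ℝ} (h : lowPoly n u = 0) : u = 0 := by
  ext i
  rw [← lowPoly_coeff_fin u i, h]; simp

theorem lowPoly_add_smul (u v : Fin n → ℝ) (s : ℝ) :
    lowPoly n (u + s • v) = lowPoly n u + C s * lowPoly n v := by
  simp only [lowPoly, Finset.mul_sum, ← Finset.sum_add_distrib]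
  exact Finset.sum_congr rfl fun i _ => by simp; ring

theorem X_pow_add_lowPoly {Q : ℝ[X]} (hQ : Q.Monic) (hn : Q.natDegree = n) :
    X ^ n + lowPoly n (fun i => Q.coeff i) = Q := by
  subst hn
  conv_rhs => rw [hQ.as_sum]
  rw [lowPoly, Finset.sum_range]

theorem monic_X_pow_add_lowPoly (u : Fin n → ℝ) : (X ^ n + lowPoly n u).Monic :=
  monic_X_pow_add (degree_lowPoly_lt u)

theorem degree_X_pow_add_lowPoly (u : Fin n → ℝ) : (X ^ n + lowPoly n u : ℝ[X]).degree = (n : WithBot ℕ) := by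
  rw [degree_add_eq_left_of_degree_lt (by simpa using degree_lowPoly_lt u), degree_X_pow]

/-- Multiplication of monic polynomials, in terms of the coefficients. -/
noncomputable def mulCoeffs (n₁ n₂ : ℕ) (w : (Fin n₁ → ℝ) × (Fin n₂ → ℝ)) (k : Fin (n₁ + n₂)) : ℝ :=
  ((X ^ n₁ + lowPoly n₁ w.1) * (X ^ n₂ + lowPoly n₂ w.2)).coeff k

theorem contDiff_mulCoeffs {N : WithTop ℕ∞} : ContDiff ℝ N (mulCoeffs n₁ n₂) := by
  refine contDiff_pi.2 fun k => ?_
  simp only [mulCoeffs, coeff_mul, coeff_add, lowPoly_coeff]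
  fun_prop

theorem hasDerivAt_mulCoeffs (w h : (Fin n₁ → ℝ) × (Fin n₂ → ℝ)) (k : Fin (n₁ + n₂)) :
    HasDerivAt (fun s : ℝ => mulCoeffs n₁ n₂ (w + s • h) k)
      ((lowPoly n₁ h.1 * (X ^ n₂ + lowPoly n₂ w.2) +
        (X ^ n₁ + lowPoly n₁ w.1) * lowPoly n₂ h.2).coeff k) 0 := by
  set A := X ^ n₁ + lowPoly n₁ w.1
  set B := X ^ n₂ + lowPoly n₂ w.2
  have e : ∀ s : ℝ, mulCoeffs n₁ n₂ (w + s • h) k = (A * B).coeff k +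
      s * (lowPoly n₁ h.1 * B + A * lowPoly n₂ h.2).coeff k +
      s ^ 2 * (lowPoly n₁ h.1 * lowPoly n₂ h.2).coeff k := by
    intro s
    rw [← coeff_C_mul, ← coeff_C_mul, ← coeff_add, ← coeff_add, mulCoeffs]
    simp only [Prod.fst_add, Prod.snd_add, Prod.smul_fst, Prod.smul_snd, lowPoly_add_smul]
    congr 1
    simp only [A, B, C_pow]
    ring
  simp only [e]
  set a := (A * B).coeff k
  set b := (lowPoly n₁ h.1 * B + A * lowPoly n₂ h.2).coeff k
  set c := (lowPoly n₁ h.1 * lowPoly n₂ h.2).coeff k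
  have := (((hasDerivAt_id' (0 : ℝ)).mul_const b).const_add a).fun_add
    (((hasDerivAt_id' (0 : ℝ)).fun_pow 2).mul_const c)
  exact this.congr_deriv (by simp)

theorem lowPoly_eq_zero_of_dvd {A : ℝ[X]} (hA : A.Monic) (hn : A.natDegree = n) {u : Fin n → ℝ}
    (h : A ∣ lowPoly n u) : u = 0 := by
  refine lowPoly_eq_zero (eq_zero_of_dvd_of_degree_lt h ?_)
  rw [degree_eq_natDegree hA.ne_zero, hn]
  exact degree_lowPoly_lt u

/-- The derivative of (A, B) ↦ AB is (h₁, h₂) ↦ h₁B + Ah₂ with deg h₁ < deg A and deg h₂ < deg B. If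
this is zero, coprimality gives A ∣ h₁ and B ∣ h₂, and the degrees force both to vanish. -/
theorem fderiv_mulCoeffs_injective (w : (Fin n₁ → ℝ) × (Fin n₂ → ℝ))
    (hco : IsCoprime (X ^ n₁ + lowPoly n₁ w.1) (X ^ n₂ + lowPoly n₂ w.2)) :
    Function.Injective (fderiv ℝ (mulCoeffs n₁ n₂) w) := by
  rw [injective_iff_map_eq_zero]
  intro h hh
  set A := X ^ n₁ + lowPoly n₁ w.1 with hA
  set B := X ^ n₂ + lowPoly n₂ w.2 with hB
  have mA : A.Monic := monic_X_pow_add_lowPoly _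
  have mB : B.Monic := monic_X_pow_add_lowPoly _
  have dA : A.degree = n₁ := degree_X_pow_add_lowPoly _
  have dB : B.degree = n₂ := degree_X_pow_add_lowPoly _
  have hline : HasDerivAt (fun s : ℝ => w + s • h) h 0 := by
    simpa using ((hasDerivAt_id' (0 : ℝ)).smul_const h).const_add w
  have hd : HasFDerivAt (mulCoeffs n₁ n₂) (fderiv ℝ (mulCoeffs n₁ n₂) w) (w + (0 : ℝ) • h) := by
    simpa using (contDiff_mulCoeffs (N := 1)).contDiffAt.differentiableAt (by simp) |>.hasFDerivAt
  have hcomp := hd.comp_hasDerivAt (0 : ℝ) hline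
  rw [hh, hasDerivAt_pi] at hcomp
  -- The derivative is identified along lines; coefficients of index n₁ + n₂ and higher vanish for
  -- degree reasons.
  have h0 : lowPoly n₁ h.1 * B + A * lowPoly n₂ h.2 = 0 := by
    ext k
    by_cases hk : k < n₁ + n₂
    · exact (hasDerivAt_mulCoeffs w h ⟨k, hk⟩).unique (hcomp ⟨k, hk⟩)
    · rw [coeff_zero]
      refine coeff_eq_zero_of_degree_lt (lt_of_lt_of_le ?_
        (show ((n₁ + n₂ : ℕ) : WithBot ℕ) ≤ k by exact_mod_cast not_lt.1 hk))
      have hb : ∀ k : ℕ, (⊥ : WithBot ℕ) < k := fun k => WithBot.bot_lt_coe k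
      refine (degree_add_le _ _).trans_lt (max_lt ?_ ?_)
      · rw [degree_mul, dB, Nat.cast_add]
        exact WithBot.add_lt_add_right (hb _).ne' (degree_lowPoly_lt h.1)
      · rw [degree_mul, dA, Nat.cast_add]
        exact WithBot.add_lt_add_left (hb _).ne' (degree_lowPoly_lt h.2)
  have h1 : A ∣ lowPoly n₁ h.1 := by
    refine hco.dvd_of_dvd_mul_right ?_
    rw [eq_neg_of_add_eq_zero_left h0]
    exact (dvd_mul_right _ _).neg_right
  have h2 : B ∣ lowPoly n₂ h.2 := by
    refine hco.symm.dvd_of_dvd_mul_left ?_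
    rw [eq_neg_of_add_eq_zero_right h0]
    exact (dvd_mul_left _ _).neg_right
  exact Prod.ext (lowPoly_eq_zero_of_dvd mA (natDegree_eq_of_degree_eq_some dA) h1)
    (lowPoly_eq_zero_of_dvd mB (natDegree_eq_of_degree_eq_some dB) h2)

/-- Source and target of the multiplication map have the same dimension, so its injective derivative
is invertible. Near t₀ the coefficients of the factors are then the local inverse applied to those
of P. One derivative is needed for the inverse function theorem, hence N ≠ 0. -/
theorem contDiffAt_coeff_factor {t₀ : ℝ} {N : ℕ} (hN : N ≠ 0) {P P₁ P₂ : ℝ → ℝ[X]}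
    (h₁ : ∀ᶠ t in 𝓝 t₀, (P₁ t).Monic ∧ (P₁ t).natDegree = n₁)
    (h₂ : ∀ᶠ t in 𝓝 t₀, (P₂ t).Monic ∧ (P₂ t).natDegree = n₂)
    (hc₁ : ∀ k, ContinuousAt (fun t => (P₁ t).coeff k) t₀)
    (hc₂ : ∀ k, ContinuousAt (fun t => (P₂ t).coeff k) t₀)
    (hmul : ∀ᶠ t in 𝓝 t₀, P t = P₁ t * P₂ t) (hco : IsCoprime (P₁ t₀) (P₂ t₀))
    (hP : ∀ k, ContDiffAt ℝ N (fun t => (P t).coeff k) t₀) (k : ℕ) :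
    ContDiffAt ℝ N (fun t => (P₁ t).coeff k) t₀ ∧ ContDiffAt ℝ N (fun t => (P₂ t).coeff k) t₀ := by
  have hN' : (N : WithTop ℕ∞) ≠ 0 := by exact_mod_cast hN
  set w : ℝ → (Fin n₁ → ℝ) × (Fin n₂ → ℝ) := fun t =>
    (fun i => (P₁ t).coeff i, fun i => (P₂ t).coeff i) with hw
  have e₁ : ∀ᶠ t in 𝓝 t₀, X ^ n₁ + lowPoly n₁ (w t).1 = P₁ t :=
    h₁.mono fun t ht => X_pow_add_lowPoly ht.1 ht.2
  have e₂ : ∀ᶠ t in 𝓝 t₀, X ^ n₂ + lowPoly n₂ (w t).2 = P₂ t :=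
    h₂.mono fun t ht => X_pow_add_lowPoly ht.1 ht.2
  have hinj := fderiv_mulCoeffs_injective (w t₀)
    (by rw [e₁.self_of_nhds, e₂.self_of_nhds]; exact hco)
  let L : ((Fin n₁ → ℝ) × (Fin n₂ → ℝ)) ≃L[ℝ] (Fin (n₁ + n₂) → ℝ) :=
    (LinearEquiv.ofInjectiveOfFinrankEq
      (fderiv ℝ (mulCoeffs n₁ n₂) (w t₀)).toLinearMap hinj (by simp)).toContinuousLinearEquiv
  have hd : HasFDerivAt (mulCoeffs n₁ n₂) (L : _ →L[ℝ] _) (w t₀) := by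
    have := (contDiff_mulCoeffs (n₁ := n₁) (n₂ := n₂) (N := 1)).contDiffAt.differentiableAt
      (x := w t₀) (by simp) |>.hasFDerivAt
    have hL : (L : _ →L[ℝ] _) = fderiv ℝ (mulCoeffs n₁ n₂) (w t₀) := rfl
    rwa [hL]
  have hcd : ContDiffAt ℝ N (mulCoeffs n₁ n₂) (w t₀) := contDiff_mulCoeffs.contDiffAt
  have hwc : ContinuousAt w t₀ :=
    (continuousAt_pi.2 fun i : Fin n₁ => hc₁ i).prodMk (continuousAt_pi.2 fun i : Fin n₂ => hc₂ i)
  have hinv := (hcd.hasStrictFDerivAt' hd hN').eventually_left_inverse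
  have hΦ : ∀ᶠ t in 𝓝 t₀, mulCoeffs n₁ n₂ (w t) = fun k : Fin (n₁ + n₂) => (P t).coeff k := by
    filter_upwards [e₁, e₂, hmul] with t h1 h2 h3
    ext k
    rw [mulCoeffs, h1, h2, h3]
  have hPc : ContDiffAt ℝ N (fun t => fun k : Fin (n₁ + n₂) => (P t).coeff k) t₀ :=
    contDiffAt_pi.2 fun k => hP k
  have hwd : ContDiffAt ℝ N w t₀ := by
    have h1 := hcd.to_localInverse hd hN'
    rw [hΦ.self_of_nhds] at h1
    refine (h1.comp t₀ hPc).congr_of_eventuallyEq ?_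
    filter_upwards [hwc.eventually hinv, hΦ] with t h2 h3
    simp only [Function.comp]
    rw [← h3]
    exact h2.symm
  constructor
  · by_cases hk : k < n₁
    · exact contDiffAt_pi.1 hwd.fst ⟨k, hk⟩
    · refine (contDiffAt_const (c := if k = n₁ then (1 : ℝ) else 0)).congr_of_eventuallyEq ?_
      filter_upwards [h₁] with t ht
      split_ifs with h
      · rw [h, ← ht.2]; exact ht.1
      · exact coeff_eq_zero_of_natDegree_lt (by omega)
  · by_cases hk : k < n₂
    · exact contDiffAt_pi.1 hwd.snd ⟨k, hk⟩
    · refine (contDiffAt_const (c := if k = n₂ then (1 : ℝ) else 0)).congr_of_eventuallyEq ?_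
      filter_upwards [h₂] with t ht
      split_ifs with h
      · rw [h, ← ht.2]; exact ht.1
      · exact coeff_eq_zero_of_natDegree_lt (by omega)

end factor

/-! ### Roots of monic real-rooted polynomials -/

/-- The monic polynomial with roots `y i`. -/
noncomputable def rootPoly {ι : Type*} [Fintype ι] (y : ι → ℝ) : ℝ[X] := ∏ i, (X - C (y i))

section rootPoly
variable {ι κ : Type*} [Fintype ι] [Fintype κ] {n : ℕ}

theorem rootPoly_monic (y : ι → ℝ) : (rootPoly y).Monic := monic_prod_X_sub_C _ _

theorem rootPoly_natDegree (y : ι → ℝ) : (rootPoly y).natDegree = Fintype.card ι := by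
  rw [rootPoly, natDegree_finsetProd_X_sub_C_eq_card]; rfl

theorem rootPoly_splits (y : ι → ℝ) : (rootPoly y).Splits :=
  Splits.prod fun _ _ => Splits.X_sub_C _

theorem rootPoly_isRoot {y : ι → ℝ} {x : ℝ} : (rootPoly y).IsRoot x ↔ ∃ i, y i = x := by
  simp [rootPoly, IsRoot, eval_prod, Finset.prod_eq_zero_iff, sub_eq_zero, eq_comm (a := x)]

theorem rootPoly_roots (y : ι → ℝ) : (rootPoly y).roots = Finset.univ.val.map y := by
  have : rootPoly y = ((Finset.univ.val.map y).map fun a => X - C a).prod := by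
    rw [Multiset.map_map]; rfl
  rw [this, roots_multiset_prod_X_sub_C]

theorem rootPoly_comp_equiv (e : κ ≃ ι) (y : ι → ℝ) : rootPoly (fun k => y (e k)) = rootPoly y :=
  Fintype.prod_equiv e _ _ fun _ => rfl

theorem rootPoly_append {m : ℕ} (y : Fin n → ℝ) (z : Fin m → ℝ) :
    rootPoly (Fin.append y z) = rootPoly y * rootPoly z := by
  simp [rootPoly, Fin.prod_univ_add]

theorem exists_rootPoly_eq {Q : ℝ[X]} (hm : Q.Monic) (hs : Q.Splits) (hn : Q.natDegree = n) :
    ∃ y : Fin n → ℝ, Monotone y ∧ Q = rootPoly y := by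
  obtain ⟨l, hl⟩ : ∃ l : List ℝ, Q.roots = l := ⟨Q.roots.toList, by simp⟩
  have hlen : l.length = n := by
    rw [← hn, hs.natDegree_eq_card_roots, hl]; rfl
  subst hlen
  have hQ : Q = rootPoly l.get := by
    conv_lhs => rw [hs.eq_prod_roots_of_monic hm, hl]
    have : (l : Multiset ℝ) = Finset.univ.val.map l.get := by
      rw [Fin.univ_val_map, List.ofFn_get]
    rw [this, Multiset.map_map]; rfl
  exact ⟨_, Tuple.monotone_sort l.get, hQ.trans (rootPoly_comp_equiv _ _).symm⟩

theorem eq_of_rootPoly_eq_of_monotone {y z : Fin n → ℝ} (hy : Monotone y) (hz : Monotone z)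
    (h : rootPoly y = rootPoly z) : y = z := by
  have h1 := congrArg roots h
  rw [rootPoly_roots, rootPoly_roots, Fin.univ_val_map, Fin.univ_val_map, Multiset.coe_eq_coe] at h1
  exact List.ofFn_injective (h1.eq_of_sortedLE hy.sortedLE_ofFn hz.sortedLE_ofFn)

theorem exists_perm_of_rootPoly_eq {y z : Fin n → ℝ} (h : rootPoly y = rootPoly z) :
    ∃ σ : Equiv.Perm (Fin n), ∀ i, y i = z (σ i) := by
  have := eq_of_rootPoly_eq_of_monotone (Tuple.monotone_sort y) (Tuple.monotone_sort z)
    ((rootPoly_comp_equiv _ _).trans (h.trans (rootPoly_comp_equiv _ _).symm))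
  refine ⟨(Tuple.sort y).symm.trans (Tuple.sort z), fun i => ?_⟩
  have := congrFun this ((Tuple.sort y).symm i)
  simpa using this

omit [Fintype ι] in
-- The coefficients are polynomial expressions in the roots. Stating this for an arbitrary class p
-- serves continuity, definable functions and definable germs at once.
theorem coeff_rootPoly_induction {α : Type*} {p : (α → ℝ) → Prop} (hc : ∀ c : ℝ, p fun _ => c)
    (hadd : ∀ f g, p f → p g → p fun a => f a + g a)
    (hmul : ∀ f g, p f → p g → p fun a => f a * g a) (s : Finset ι) {y : ι → α → ℝ}
    (hy : ∀ i ∈ s, p (y i)) (k : ℕ) : p fun a => (∏ i ∈ s, (X - C (y i a))).coeff k := by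
  classical
  induction s using Finset.induction_on generalizing k with
  | empty => simpa using hc ((1 : ℝ[X]).coeff k)
  | insert a s ha ih =>
    replace ih := ih fun i hi => hy i (Finset.mem_insert_of_mem hi)
    have hya := hmul _ _ (hc (-1)) (hy a (Finset.mem_insert_self a s))
    simp only [Finset.prod_insert ha, sub_mul]
    cases k with
    | zero => simpa using hmul _ _ hya (ih 0)
    | succ k => simpa [sub_eq_add_neg] using hadd _ _ (ih k) (hmul _ _ hya (ih (k + 1)))

theorem isRoot_abs_le {Q : ℝ[X]} (hm : Q.Monic) {n : ℕ} (hn : Q.natDegree = n) {x : ℝ}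
    (hx : Q.IsRoot x) : |x| ≤ ∑ k ∈ Finset.range n, |Q.coeff k| + 1 := by
  have h : |x| ≤ cauchyBound Q := NNReal.coe_le_coe.2 (hx.norm_lt_cauchyBound hm.ne_zero).le
  refine h.trans ?_
  rw [cauchyBound, hm.leadingCoeff, hn]
  simp only [nnnorm_one, div_one, NNReal.coe_add, NNReal.coe_one]
  gcongr
  have : (Finset.range n).sup (fun k => ‖Q.coeff k‖₊) ≤ ∑ k ∈ Finset.range n, ‖Q.coeff k‖₊ :=
    Finset.sup_le fun k hk => Finset.single_le_sum (f := fun k => ‖Q.coeff k‖₊)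
      (fun _ _ => zero_le) hk
  have h2 := NNReal.coe_le_coe.2 this
  simpa using h2

theorem continuous_coeff_rootPoly (k : ℕ) :
    Continuous fun w : Fin n → ℝ => (rootPoly w).coeff k := by
  have := coeff_rootPoly_induction (α := Fin n → ℝ) (p := fun f => Continuous f)
    (fun c => continuous_const) (fun f g hf hg => hf.add hg) (fun f g hf hg => hf.mul hg)
    Finset.univ (y := fun i w => w i) (fun i _ => continuous_apply i) k
  exact this

/-- Limits of monotone root tuples, along a filter. -/
theorem exists_tendsto_roots {α : Type*} {l : Filter α} [l.NeBot] {Q : ℝ[X]} {P : α → ℝ[X]}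
    {y : α → Fin n → ℝ} (hy : ∀ᶠ a in l, Monotone (y a) ∧ P a = rootPoly (y a))
    (hP : ∀ k, Tendsto (fun a => (P a).coeff k) l (𝓝 (Q.coeff k))) :
    ∃ z, Monotone z ∧ Q = rootPoly z ∧ Tendsto y l (𝓝 z) := by
  -- Cauchy's bound confines the roots to a fixed box, so every ultrafilter finer than l has a limit
  -- tuple. All limits agree, because the increasingly ordered roots of Q are unique.
  have hbound : ∀ᶠ a in l, y a ∈ Set.pi Set.univ fun _ : Fin n =>
      Set.Icc (-(∑ k ∈ Finset.range n, |Q.coeff k| + 2)) (∑ k ∈ Finset.range n, |Q.coeff k| + 2) := by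
    have h1 : Tendsto (fun a => ∑ k ∈ Finset.range n, |(P a).coeff k| + 1) l
        (𝓝 (∑ k ∈ Finset.range n, |Q.coeff k| + 1)) :=
      (tendsto_finsetSum _ fun k _ => (hP k).abs).add_const 1
    filter_upwards [hy, h1.eventually (Iio_mem_nhds (lt_add_one _))] with a ha hb i _
    have hr : (P a).IsRoot (y a i) := by
      rw [ha.2, rootPoly_isRoot]; exact ⟨i, rfl⟩
    have := isRoot_abs_le (by rw [ha.2]; exact rootPoly_monic _)
      (by rw [ha.2, rootPoly_natDegree, Fintype.card_fin]) hr
    rw [Set.mem_Icc, ← abs_le]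
    have hb : _ < _ := hb
    linarith
  have key : ∀ u : Ultrafilter α, (u : Filter α) ≤ l →
      ∃ z, Monotone z ∧ Q = rootPoly z ∧ Tendsto y u (𝓝 z) := by
    intro u hu
    obtain ⟨z, -, hz⟩ := (isCompact_univ_pi fun _ : Fin n => isCompact_Icc).ultrafilter_le_nhds
      (u.map y) (le_principal_iff.2 (hu hbound))
    have hz : Tendsto y u (𝓝 z) := hz
    have hzi : ∀ i, Tendsto (fun a => y a i) u (𝓝 (z i)) := tendsto_pi_nhds.1 hz
    refine ⟨z, fun i j hij => ?_, ?_, hz⟩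
    · exact le_of_tendsto_of_tendsto (hzi i) (hzi j) (hu (hy.mono fun a ha => ha.1 hij))
    · ext k
      have h2 : Tendsto (fun a => (rootPoly (y a)).coeff k) u (𝓝 ((rootPoly z).coeff k)) := by
        exact ((continuous_coeff_rootPoly k).tendsto z).comp hz
      exact tendsto_nhds_unique ((hP k).mono_left hu)
        (h2.congr' (hu (hy.mono fun a ha => by simp only [ha.2])))
  obtain ⟨z, hz, hQ, -⟩ := key (Ultrafilter.of l) (Ultrafilter.of_le l)
  refine ⟨z, hz, hQ, (tendsto_iff_ultrafilter _ _ _).2 fun u hu => ?_⟩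
  obtain ⟨w, hw, hQ', h⟩ := key u hu
  rwa [eq_of_rootPoly_eq_of_monotone hz hw (hQ.symm.trans hQ')]

end rootPoly

/-! ### Elementary symmetric functions of the roots -/

section signedCoeff
variable {n : ℕ}

theorem signedCoeff_rootPoly (y : Fin n → ℝ) {k : ℕ} (hk : k ≤ n) :
    signedCoeff n (rootPoly y) k = (Finset.univ.val.map y).esymm k := by
  have e : rootPoly y = ((Finset.univ.val.map y).map fun a => X - C a).prod := by
    rw [Multiset.map_map]; rfl
  have hc : Multiset.card (Finset.univ.val.map y) = n := by simp
  rw [signedCoeff, e, Multiset.prod_X_sub_C_coeff _ (by rw [hc]; omega), hc, Nat.sub_sub_self hk,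
    ← mul_assoc, ← mul_pow]
  simp

theorem signedCoeff_rootPoly_one (hn : 1 ≤ n) (y : Fin n → ℝ) :
    signedCoeff n (rootPoly y) 1 = ∑ i, y i := by
  rw [signedCoeff_rootPoly y hn, Multiset.esymm, Multiset.powersetCard_one, Multiset.map_map]
  simp only [Function.comp_def, Multiset.prod_singleton, Multiset.map_id']
  rfl

theorem Multiset.sum_sq_eq (s : Multiset ℝ) :
    (s.map (· ^ 2)).sum = s.sum ^ 2 - 2 * s.esymm 2 := by
  induction s using Multiset.induction_on with
  | empty => simp [Multiset.esymm, Multiset.powersetCard_zero_right]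
  | cons a s ih =>
    have h : (a ::ₘ s).esymm 2 = s.esymm 2 + a * s.sum := by
      rw [Multiset.esymm, Multiset.powersetCard_cons, Multiset.map_add, Multiset.sum_add,
        Multiset.powersetCard_one]
      simp only [Multiset.esymm, Multiset.map_map, Function.comp_def, Multiset.prod_cons,
        Multiset.prod_singleton]
      have : (s.map fun x => a * x).sum = a * s.sum := by
        simpa using Multiset.sum_map_mul_left (s := s) (f := id) (a := a)
      rw [this]
    rw [h, Multiset.map_cons, Multiset.sum_cons, Multiset.sum_cons, ih]
    ring

/-- For centered roots the first term vanishes, so a₂ alone controls the size of all roots. -/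
theorem sum_sq_eq (hn : 2 ≤ n) (y : Fin n → ℝ) :
    ∑ i, y i ^ 2 = (∑ i, y i) ^ 2 - 2 * signedCoeff n (rootPoly y) 2 := by
  rw [signedCoeff_rootPoly y hn]
  have := Multiset.sum_sq_eq (Finset.univ.val.map y)
  rw [Multiset.map_map] at this
  exact this

theorem signedCoeff_scale (y : Fin n → ℝ) (c : ℝ) {k : ℕ} (hk : k ≤ n) :
    signedCoeff n (rootPoly fun i => c * y i) k = c ^ k * signedCoeff n (rootPoly y) k := by
  rw [signedCoeff_rootPoly _ hk, signedCoeff_rootPoly _ hk]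
  have : (Finset.univ.val.map fun i => c * y i) = (Finset.univ.val.map y).map (c * ·) := by
    rw [Multiset.map_map]; rfl
  rw [this, Multiset.esymm, Multiset.powersetCard_map, Multiset.map_map, Multiset.esymm,
    ← Multiset.sum_map_mul_left]
  congr 1
  refine Multiset.map_congr rfl fun s hs => ?_
  rw [Multiset.mem_powersetCard] at hs
  have : (s.map fun x => c * x).prod = (s.map fun _ => c).prod * (s.map fun x => x).prod :=
    Multiset.prod_map_mul
  simpa [hs.2] using this

theorem signedCoeff_zero {Q : ℝ[X]} (hm : Q.Monic) (hn : Q.natDegree = n) :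
    signedCoeff n Q 0 = 1 := by
  subst hn; simpa [signedCoeff] using hm.leadingCoeff

theorem coeff_eq_signedCoeff (Q : ℝ[X]) {k : ℕ} (hk : k ≤ n) :
    Q.coeff k = (-1) ^ (n - k) * signedCoeff n Q (n - k) := by
  rw [signedCoeff, Nat.sub_sub_self hk, ← mul_assoc, ← mul_pow]; simp

theorem eq_of_signedCoeff_eq {Q R : ℝ[X]} (hQ : Q.Monic) (hQn : Q.natDegree = n) (hR : R.Monic)
    (hRn : R.natDegree = n) (h : ∀ k ∈ Finset.Icc 1 n, signedCoeff n Q k = signedCoeff n R k) :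
    Q = R := by
  ext k
  rcases le_or_gt k n with hk | hk
  · rw [coeff_eq_signedCoeff Q hk, coeff_eq_signedCoeff R hk]
    congr 1
    rcases hk.eq_or_lt with rfl | hk
    · simp [signedCoeff_zero hQ hQn, signedCoeff_zero hR hRn]
    · exact h _ (Finset.mem_Icc.2 ⟨by omega, by omega⟩)
  · rw [coeff_eq_zero_of_natDegree_lt (by omega), coeff_eq_zero_of_natDegree_lt (by omega)]

theorem rootPoly_comp_X_add_C (y : Fin n → ℝ) (c : ℝ) :
    (rootPoly y).comp (X + C c) = rootPoly fun i => y i - c := by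
  simp only [rootPoly, Polynomial.prod_comp, sub_comp, X_comp, C_comp, C_sub]
  exact Finset.prod_congr rfl fun i _ => by ring

theorem rootPoly_const (c : ℝ) : rootPoly (fun _ : Fin n => c) = (X - C c) ^ n := by
  simp [rootPoly]

end signedCoeff

/-! ### Continuous and definable parameterizations of the roots near a point -/

section ordRoot
variable {n : ℕ}

open Classical in
/-- The increasingly ordered roots of a monic real-rooted polynomial of degree `n`. -/
noncomputable def ordRoot (n : ℕ) (Q : ℝ[X]) : Fin n → ℝ :=
  if h : ∃ y : Fin n → ℝ, Monotone y ∧ Q = rootPoly y then h.choose else 0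

theorem ordRoot_spec {Q : ℝ[X]} (h : Q.Monic ∧ Q.natDegree = n ∧ Q.Splits) :
    Monotone (ordRoot n Q) ∧ Q = rootPoly (ordRoot n Q) := by
  have h := exists_rootPoly_eq h.1 h.2.2 h.2.1
  rw [ordRoot, dif_pos h]
  exact h.choose_spec

theorem ordRoot_rootPoly {y : Fin n → ℝ} (hy : Monotone y) : ordRoot n (rootPoly y) = y := by
  have h := ordRoot_spec (n := n) (Q := rootPoly y)
    ⟨rootPoly_monic y, by simp [rootPoly_natDegree], rootPoly_splits y⟩
  exact eq_of_rootPoly_eq_of_monotone h.1 hy h.2.symm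

theorem continuousAt_ordRoot {t : ℝ} {P : ℝ → ℝ[X]}
    (h : ∀ᶠ s in 𝓝 t, (P s).Monic ∧ (P s).natDegree = n ∧ (P s).Splits)
    (hc : ∀ k, ContinuousAt (fun s => (P s).coeff k) t) :
    ContinuousAt (fun s => ordRoot n (P s)) t := by
  obtain ⟨z, hz, hP, ht⟩ := exists_tendsto_roots (h.mono fun s hs => ordRoot_spec hs) hc
  rw [ContinuousAt]
  convert ht
  rw [hP, ordRoot_rootPoly hz]

theorem IsHyperbolicCurveNear.eventually_continuousAt {t₀ : ℝ} {P : ℝ → ℝ[X]}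
    (h : IsHyperbolicCurveNear t₀ n P) :
    ∀ᶠ t in 𝓝 t₀, ∀ k, ContinuousAt (fun s => (P s).coeff k) t := by
  have h1 : ∀ᶠ t in 𝓝 t₀, ∀ k ∈ Finset.range (n + 1), ContinuousAt (fun s => (P s).coeff k) t :=
    (Filter.eventually_all_finset _).2 fun k _ => h.2 k
  filter_upwards [h1, h.1.eventually_nhds] with t ht ht' k
  by_cases hk : k < n + 1
  · exact ht k (Finset.mem_range.2 hk)
  · refine (continuousAt_const (y := (0 : ℝ))).congr ?_
    filter_upwards [ht'] with s hs
    exact (coeff_eq_zero_of_natDegree_lt (by omega)).symm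

/-- The functions `y i` are continuous near `t₀` and parameterize the roots of `P`. -/
def IsLocalParam (t₀ : ℝ) (n : ℕ) (P : ℝ → ℝ[X]) (y : Fin n → ℝ → ℝ) : Prop :=
  (∀ i, ∀ᶠ t in 𝓝 t₀, ContinuousAt (y i) t) ∧ ∀ᶠ t in 𝓝 t₀, P t = rootPoly fun i => y i t

variable {t₀ : ℝ} {P Q R P₁ P₂ : ℝ → ℝ[X]} {y : Fin n → ℝ → ℝ}

theorem IsHyperbolicCurveNear.isLocalParam_ordRoot (h : IsHyperbolicCurveNear t₀ n P) :
    IsLocalParam t₀ n P fun i t => ordRoot n (P t) i := by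
  refine ⟨fun i => ?_, h.1.mono fun t ht => (ordRoot_spec ht).2⟩
  filter_upwards [h.1.eventually_nhds, h.eventually_continuousAt] with t h1 h2
  exact continuousAt_pi.1 (continuousAt_ordRoot h1 h2) i

theorem IsLocalParam.eventually_continuousAt (h : IsLocalParam t₀ n P y) :
    ∀ᶠ t in 𝓝 t₀, ∀ i, ContinuousAt (y i) t := eventually_all.2 h.1

theorem IsLocalParam.isHyperbolicCurveNear (h : IsLocalParam t₀ n P y) :
    IsHyperbolicCurveNear t₀ n P := by
  refine ⟨?_, fun k => ?_⟩
  · filter_upwards [h.2] with t ht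
    rw [ht]
    exact ⟨rootPoly_monic _, by simp [rootPoly_natDegree], rootPoly_splits _⟩
  · filter_upwards [h.eventually_continuousAt, h.2.eventually_nhds] with t h1 h2
    have : ContinuousAt (fun s => (rootPoly fun i => y i s).coeff k) t :=
      (continuous_coeff_rootPoly k).continuousAt.comp (f := fun s i => y i s)
        (continuousAt_pi.2 h1)
    refine this.congr ?_
    filter_upwards [h2] with s hs
    rw [hs]

theorem IsHyperbolicCurveNear.congr (h : IsHyperbolicCurveNear t₀ n P) (he : P =ᶠ[𝓝 t₀] Q) :
    IsHyperbolicCurveNear t₀ n Q := by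
  refine ⟨?_, fun k => ?_⟩
  · filter_upwards [h.1, he] with t h1 h2
    rwa [← h2]
  · filter_upwards [h.2 k, he.eventually_nhds] with t h1 h2
    exact h1.congr (h2.mono fun s hs => by simp only [hs])

theorem IsLocalParam.append {n₁ n₂ : ℕ} {y₁ : Fin n₁ → ℝ → ℝ} {y₂ : Fin n₂ → ℝ → ℝ}
    (h₁ : IsLocalParam t₀ n₁ P₁ y₁) (h₂ : IsLocalParam t₀ n₂ P₂ y₂)
    (he : ∀ᶠ t in 𝓝 t₀, P t = P₁ t * P₂ t) :
    IsLocalParam t₀ (n₁ + n₂) P (Fin.append y₁ y₂) := by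
  refine ⟨fun i => ?_, ?_⟩
  · induction i using Fin.addCases with
    | left i => simpa using h₁.1 i
    | right i => simpa using h₂.1 i
  · filter_upwards [h₁.2, h₂.2, he] with t h1 h2 h3
    rw [h3, h1, h2, ← rootPoly_append]
    congr 1
    ext i
    induction i using Fin.addCases with
    | left i => simp
    | right i => simp

/-- A limit of real-rooted polynomials is real-rooted. -/
theorem isHyperbolicCurveNear_of_punctured
    (h : ∀ᶠ t in 𝓝[≠] t₀, (R t).Monic ∧ (R t).natDegree = n ∧ (R t).Splits)
    (hc : ∀ k, ∀ᶠ t in 𝓝 t₀, ContinuousAt (fun s => (R s).coeff k) t) :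
    IsHyperbolicCurveNear t₀ n R := by
  refine ⟨?_, hc⟩
  obtain ⟨z, hz, hR, -⟩ := exists_tendsto_roots (Q := R t₀) (h.mono fun s hs => ordRoot_spec hs)
    fun k => (hc k).self_of_nhds.tendsto.mono_left nhdsWithin_le_nhds
  rw [eventually_nhdsWithin_iff] at h
  filter_upwards [h] with t ht
  rcases eq_or_ne t t₀ with rfl | hne
  · rw [hR]
    exact ⟨rootPoly_monic _, by simp [rootPoly_natDegree], rootPoly_splits _⟩
  · exact ht hne

theorem IsHyperbolicCurveNear.continuousAt_eval (h : IsHyperbolicCurveNear t₀ n P) {f : ℝ → ℝ}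
    (hf : ContinuousAt f t₀) : ContinuousAt (fun t => (P t).eval (f t)) t₀ := by
  have : ContinuousAt (fun t => ∑ k ∈ Finset.range (n + 1), (P t).coeff k * f t ^ k) t₀ :=
    tendsto_finsetSum _ fun k _ => ((h.2 k).self_of_nhds.mul (hf.pow k))
  refine this.congr ?_
  filter_upwards [h.1] with t ht
  rw [eval_eq_sum_range' (n := n + 1) (by omega)]

open Classical in
/-- Near `t₀`, a factor of a hyperbolic curve which is coprime to the cofactor at `t₀` has as roots
those roots of the curve which at `t₀` are roots of the factor. -/
theorem IsLocalParam.factor {n₁ n₂ : ℕ} (h : IsLocalParam t₀ n P y)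
    (h₁ : IsHyperbolicCurveNear t₀ n₁ P₁) (h₂ : IsHyperbolicCurveNear t₀ n₂ P₂)
    (he : ∀ᶠ t in 𝓝 t₀, P t = P₁ t * P₂ t)
    (hdisj : ∀ x : ℝ, ¬ ((P₁ t₀).IsRoot x ∧ (P₂ t₀).IsRoot x)) :
    ∀ᶠ t in 𝓝 t₀, P₁ t = ∏ i with (P₁ t₀).IsRoot (y i t₀), (X - C (y i t)) := by
  have hP₂ : ∀ i, (P₁ t₀).IsRoot (y i t₀) → ∀ᶠ t in 𝓝 t₀, ¬ (P₂ t).IsRoot (y i t) := fun i hi =>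
    (h₂.continuousAt_eval (h.1 i).self_of_nhds).eventually_ne fun h0 => hdisj _ ⟨hi, h0⟩
  have hP₁ : ∀ i, ¬ (P₁ t₀).IsRoot (y i t₀) → ∀ᶠ t in 𝓝 t₀, ¬ (P₁ t).IsRoot (y i t) := fun i hi =>
    (h₁.continuousAt_eval (h.1 i).self_of_nhds).eventually_ne hi
  have k₁ : ∀ᶠ t in 𝓝 t₀, ∀ i, (P₁ t₀).IsRoot (y i t₀) → ¬ (P₂ t).IsRoot (y i t) :=
    eventually_all.2 fun i => eventually_imp_distrib_left.2 (hP₂ i)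
  have k₂ : ∀ᶠ t in 𝓝 t₀, ∀ i, ¬ (P₁ t₀).IsRoot (y i t₀) → ¬ (P₁ t).IsRoot (y i t) :=
    eventually_all.2 fun i => eventually_imp_distrib_left.2 (hP₁ i)
  filter_upwards [k₁, k₂, h.2, he, h₁.1, h₂.1] with t h1 h2 h3 h4 h5 h6
  have hroots : (P₁ t).roots + (P₂ t).roots = Finset.univ.val.map fun i => y i t := by
    rw [← roots_mul (mul_ne_zero h5.1.ne_zero h6.1.ne_zero), ← h4, h3, rootPoly_roots]
  have hmem : ∀ x, (P₁ t).IsRoot x → ¬ (P₂ t).IsRoot x := by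
    intro x hx
    have : (P t).IsRoot x := by rw [h4, IsRoot, eval_mul, hx.eq_zero, zero_mul]
    rw [h3, rootPoly_isRoot] at this
    obtain ⟨i, rfl⟩ := this
    by_cases hi : (P₁ t₀).IsRoot (y i t₀)
    · exact h1 i hi
    · exact (h2 i hi hx).elim
  have hiff : ∀ i, ¬ (P₂ t).IsRoot (y i t) ↔ (P₁ t₀).IsRoot (y i t₀) := by
    intro i
    refine ⟨fun hi => ?_, h1 i⟩
    by_contra hc
    have : (P t).IsRoot (y i t) := by rw [h3, rootPoly_isRoot]; exact ⟨i, rfl⟩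
    rw [h4, root_mul] at this
    exact this.elim (h2 i hc) hi
  -- Discarding the roots of P₂(t) leaves exactly the roots of P₁(t) on one side, and the indices
  -- selected at t₀ on the other.
  have hf := congrArg (Multiset.filter fun x => ¬ (P₂ t).IsRoot x) hroots
  rw [Multiset.filter_add, Multiset.filter_eq_self.2 fun x hx =>
    hmem x ((mem_roots h5.1.ne_zero).1 hx), Multiset.filter_eq_nil.2 fun x hx => by
      simpa using (isRoot_of_mem_roots hx), add_zero, Multiset.filter_map] at hf
  conv_lhs => rw [h5.2.2.eq_prod_roots_of_monic h5.1, hf]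
  rw [Multiset.map_map]
  simp only [Function.comp_def, hiff]
  rfl

theorem IsLocalParam.exists_of_prod (h : IsLocalParam t₀ n P y) {m : ℕ} {S : Finset (Fin n)}
    (hS : ∀ᶠ t in 𝓝 t₀, P₁ t = ∏ i ∈ S, (X - C (y i t))) (hm : S.card = m) :
    ∃ e : Fin m → Fin n, IsLocalParam t₀ m P₁ fun j => y (e j) := by
  let e := S.equivFinOfCardEq hm
  refine ⟨fun j => e.symm j, fun j => h.1 _, ?_⟩
  filter_upwards [hS] with t ht
  rw [ht, ← Finset.prod_coe_sort, rootPoly]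
  exact Fintype.prod_equiv e _ _ fun i => by simp

end ordRoot

namespace OMinimalStructure
variable {M : OMinimalStructure} {n : ℕ} {P : ℝ → ℝ[X]}

open Classical in
theorem def_ordRoot {U : ℝ → Prop} (hU : M.Def₁ U) {c : ℕ → ℝ → ℝ}
    (hc : ∀ k, k < n → M.Def (c k))
    (hP : ∀ t, U t → ((P t).Monic ∧ (P t).natDegree = n ∧ (P t).Splits) ∧
      ∀ k, k < n → (P t).coeff k = c k t) (i : Fin n) :
    M.Def fun t => if U t then ordRoot n (P t) i else 0 := by
  have h0 : M.DefSet 2 fun x => U (x 0) := hU.comp (defFun_coord 0)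
  -- Coordinates 0 and 1 are the point (t, x) of the graph; the other n are a candidate for the
  -- increasing tuple of roots, expressed through the coefficients and then quantified away.
  have h1 : M.DefSet (2 + n) fun z => (∀ ij : {p : Fin n × Fin n // p.1 ≤ p.2},
      z (Fin.natAdd 2 ij.1.1) ≤ z (Fin.natAdd 2 ij.1.2)) ∧
      (∀ k : Fin n, (∏ j, (X - C (z (Fin.natAdd 2 j)))).coeff k = c k (z (Fin.castAdd n 0))) ∧
      z (Fin.natAdd 2 i) = z (Fin.castAdd n 1) := by
    refine DefSet.and (DefSet.forall_finite fun ij => (defFun_coord _).le (defFun_coord _))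
      (DefSet.and (DefSet.forall_finite fun k => DefFun.eq ?_ ((hc k k.2).comp (defFun_coord _)))
        (defSet_coord_eq _ _))
    exact coeff_rootPoly_induction (p := fun f => M.DefFun (2 + n) f) (fun c => defFun_const c)
      (fun f g hf hg => hf.add hg) (fun f g hf hg => hf.mul hg) Finset.univ
      (y := fun j z => z (Fin.natAdd 2 j)) (fun j _ => defFun_coord _) k
  refine DefSet.congr ((h0.and h1.exists_tuple).or (h0.not.and
    ((defFun_coord 1).eq (defFun_const 0)))) fun x => ?_
  change _ ↔ x 1 = if U (x 0) then ordRoot n (P (x 0)) i else 0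
  by_cases hx : U (x 0)
  · simp only [hx, true_and, not_true, false_and, or_false, if_true, Fin.append_right,
      Fin.append_left]
    obtain ⟨hm, hk⟩ := hP _ hx
    have hs := ordRoot_spec hm
    constructor
    · rintro ⟨w, hw1, hw2, hw3⟩
      have hwm : Monotone w := fun a b hab => hw1 ⟨(a, b), hab⟩
      have hPw : P (x 0) = rootPoly w := by
        have hd : (rootPoly w).natDegree = n := by simp [rootPoly_natDegree]
        ext k
        rcases lt_trichotomy k n with h | rfl | h
        · rw [hk k h]; exact (hw2 ⟨k, h⟩).symm
        · have e1 := hm.1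
          have e2 := rootPoly_monic w
          rw [Monic, leadingCoeff, hm.2.1] at e1
          rw [Monic, leadingCoeff, hd] at e2
          rw [e1, e2]
        · rw [coeff_eq_zero_of_natDegree_lt (by omega), coeff_eq_zero_of_natDegree_lt (by omega)]
      rw [← hw3, hPw, ordRoot_rootPoly hwm]
    · intro h
      refine ⟨ordRoot n (P (x 0)), fun ij => hs.1 ij.2, fun k => ?_, h.symm⟩
      rw [← hk k k.2]
      conv_rhs => rw [hs.2]
      rfl
  · simp [hx]

theorem defGerm_ordRoot {t₀ : ℝ} (h : IsHyperbolicCurveNear t₀ n P)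
    (hc : ∀ k, M.DefGerm t₀ fun t => (P t).coeff k) (i : Fin n) :
    M.DefGerm t₀ fun t => ordRoot n (P t) i := by
  classical
  choose c hc hPc using hc
  have h1 : ∀ᶠ t in 𝓝 t₀, ∀ k ∈ Finset.range n, (P t).coeff k = c k t :=
    (Filter.eventually_all_finset _).2 fun k _ => hPc k
  obtain ⟨ε, hε, hball⟩ := Metric.eventually_nhds_iff_ball.1 (h.1.and h1)
  have hU : M.Def₁ fun t => t ∈ Metric.ball t₀ ε :=
    def₁_of_isOpen Metric.isOpen_ball (convex_ball _ _).ordConnected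
  refine ⟨_, def_ordRoot (P := P) hU (fun k _ => hc k) (fun t ht => ⟨(hball t ht).1, fun k hk =>
    (hball t ht).2 k (Finset.mem_range.2 hk)⟩) i, ?_⟩
  filter_upwards [Metric.ball_mem_nhds t₀ hε] with t ht
  rw [if_pos ht]

end OMinimalStructure

/-! ### Multiplicities and orders of vanishing -/

theorem le_iSup_nat_iff {S : ℕ → Prop} (h0 : S 0) (hd : ∀ p, S (p + 1) → S p) {p : ℕ} :
    (p : ℕ∞) ≤ ⨆ (q : ℕ) (_ : S q), (q : ℕ∞) ↔ S p := by
  have hmono : ∀ q p, p ≤ q → S q → S p := fun q p h => by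
    induction q, h using Nat.le_induction with
    | base => exact id
    | succ q _ ih => exact fun hq => ih (hd q hq)
  refine ⟨fun h => ?_, fun h => le_iSup₂ (f := fun (q : ℕ) (_ : S q) => (q : ℕ∞)) p h⟩
  by_contra hc
  obtain _ | p := p
  · exact hc h0
  have : ⨆ (q : ℕ) (_ : S q), (q : ℕ∞) ≤ p := iSup₂_le fun q hq => by
    by_contra! h'
    exact hc (hmono q _ (by exact_mod_cast h') hq)
  have h2 : ((p + 1 : ℕ) : ℕ∞) ≤ p := h.trans this
  norm_cast at h2
  omega

section orders
variable {t₀ : ℝ} {f g : ℝ → ℝ} {k p : ℕ}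

theorem le_multiplicityAt_iff (hf : ∀ᶠ t in 𝓝 t₀, ContinuousAt f t) :
    (p : ℕ∞) ≤ multiplicityAt t₀ f ↔
      ∃ g : ℝ → ℝ, ∀ᶠ t in 𝓝 t₀, ContinuousAt g t ∧ f t = (t - t₀) ^ p * g t := by
  refine le_iSup_nat_iff ⟨f, hf.mono fun t ht => ⟨ht, by simp⟩⟩ fun p ⟨g, hg⟩ =>
    ⟨fun t => (t - t₀) * g t, hg.mono fun t ht => ⟨?_, ?_⟩⟩
  · exact (continuousAt_id.sub continuousAt_const).mul ht.1
  · rw [ht.2]; ring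

theorem multiplicityAt_congr (h : f =ᶠ[𝓝 t₀] g) : multiplicityAt t₀ f = multiplicityAt t₀ g := by
  unfold multiplicityAt
  have : ∀ p : ℕ, (∃ u : ℝ → ℝ, ∀ᶠ t in 𝓝 t₀, ContinuousAt u t ∧ f t = (t - t₀) ^ p * u t) ↔
      ∃ u : ℝ → ℝ, ∀ᶠ t in 𝓝 t₀, ContinuousAt u t ∧ g t = (t - t₀) ^ p * u t := fun p =>
    exists_congr fun u => eventually_congr (h.mono fun t ht => by rw [ht])
  simp only [this]

theorem continuousAt_pow_mul_of (hg : ContinuousAt g t₀) :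
    ContinuousAt (fun t => (t - t₀) ^ k * g t) t₀ :=
  ((continuousAt_id.sub continuousAt_const).pow k).mul hg

theorem multiplicityAt_pow_mul (hg : ∀ᶠ t in 𝓝 t₀, ContinuousAt g t) (hg0 : g t₀ ≠ 0)
    (h : ∀ᶠ t in 𝓝 t₀, f t = (t - t₀) ^ k * g t) : multiplicityAt t₀ f = k := by
  have hf : ∀ᶠ t in 𝓝 t₀, ContinuousAt f t := by
    filter_upwards [hg, h.eventually_nhds] with t h1 h2
    exact ContinuousAt.congr (((continuousAt_id.sub continuousAt_const).pow k).mul h1)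
      (h2.mono fun s hs => hs.symm)
  refine le_antisymm ?_ ((le_multiplicityAt_iff hf).2
    ⟨g, by filter_upwards [hg, h] with t h1 h2 using ⟨h1, h2⟩⟩)
  by_contra! hc
  have hc := Order.add_one_le_of_lt hc
  obtain ⟨u, hu⟩ := (le_multiplicityAt_iff (p := k + 1) hf).1 (by exact_mod_cast hc)
  have hu0 : ContinuousAt u t₀ := hu.self_of_nhds.1
  have := eventuallyEq_of_pow_mul (j := k) (g := fun t => (t - t₀) * u t) hg.self_of_nhds
    ((continuousAt_id.sub continuousAt_const).mul hu0) (by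
      filter_upwards [hu, h] with t h1 h2
      rw [← h2, h1.2]; simp [pow_succ, mul_assoc])
  exact hg0 (by simpa using this.self_of_nhds)

/-- One power is given up so that the quotient tends to 0 and extends continuously. This loss is
harmless for infinite orders, where growth bounds and continuous divisibility become equivalent. -/
theorem exists_eq_pow_mul_of_isBigO (hf : ∀ᶠ t in 𝓝 t₀, ContinuousAt f t)
    (h : f =O[𝓝 t₀] fun t => (t - t₀) ^ (p + 1)) :
    ∃ g : ℝ → ℝ, g t₀ = 0 ∧ ∀ᶠ t in 𝓝 t₀, ContinuousAt g t ∧ f t = (t - t₀) ^ p * g t := by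
  classical
  have hf0 : f t₀ = 0 := by
    obtain ⟨c, hc⟩ := h.bound
    simpa using hc.self_of_nhds
  have hlim : Tendsto (fun t => f t / (t - t₀) ^ p) (𝓝[≠] t₀) (𝓝 0) := by
    have h1 : (fun t => f t / (t - t₀) ^ p) =O[𝓝[≠] t₀] fun t => t - t₀ := by
      obtain ⟨c, hc⟩ := (h.mono (nhdsWithin_le_nhds (s := {t₀}ᶜ))).bound
      refine IsBigO.of_bound c ?_
      filter_upwards [hc, self_mem_nhdsWithin] with t ht hne
      have hs : 0 < ‖(t - t₀) ^ p‖ := norm_pos_iff.2 (pow_ne_zero _ (sub_ne_zero.2 hne))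
      rw [norm_div, div_le_iff₀ hs, mul_assoc, ← norm_mul, mul_comm (t - t₀), ← pow_succ]
      exact ht
    refine h1.trans_tendsto ?_
    exact (Continuous.tendsto' (by fun_prop) _ _ (by simp)).mono_left nhdsWithin_le_nhds
  refine ⟨fun t => if t = t₀ then 0 else f t / (t - t₀) ^ p, by simp, ?_⟩
  filter_upwards [hf] with t ht
  rcases eq_or_ne t t₀ with rfl | hne
  · refine ⟨?_, by simp [hf0]⟩
    rw [continuousAt_iff_punctured_nhds]
    simp only [if_true]
    exact hlim.congr' (by filter_upwards [self_mem_nhdsWithin] with s hs using (if_neg hs).symm)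
  · refine ⟨?_, ?_⟩
    · have hs : (t - t₀) ^ p ≠ 0 := pow_ne_zero _ (sub_ne_zero.2 hne)
      refine (ht.div ((continuousAt_id.sub continuousAt_const).pow p) hs).congr ?_
      filter_upwards [isOpen_ne.mem_nhds hne] with s hs using (if_neg hs).symm
    · simp only [if_neg hne]
      rw [mul_div_cancel₀ _ (pow_ne_zero _ (sub_ne_zero.2 hne))]

theorem isBigO_of_eq_pow_mul (hg : ContinuousAt g t₀)
    (h : ∀ᶠ t in 𝓝 t₀, f t = (t - t₀) ^ p * g t) : f =O[𝓝 t₀] fun t => (t - t₀) ^ p := by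
  have := (isBigO_refl (fun t => (t - t₀) ^ p) (𝓝 t₀)).mul (hg.isBigO_one ℝ)
  exact (this.congr_left (f₁ := fun t => (t - t₀) ^ p * g t) fun t => rfl).congr'
    (h.mono fun t ht => ht.symm) (.of_forall fun t => by simp)

theorem multiplicityAt_eq_top_iff (hf : ∀ᶠ t in 𝓝 t₀, ContinuousAt f t) :
    multiplicityAt t₀ f = ⊤ ↔ ∀ p : ℕ, f =O[𝓝 t₀] fun t => (t - t₀) ^ p := by
  rw [ENat.eq_top_iff_forall_ge]
  refine ⟨fun h p => ?_, fun h p => (le_multiplicityAt_iff hf).2 ?_⟩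
  · obtain ⟨g, hg⟩ := (le_multiplicityAt_iff hf).1 (h p)
    exact isBigO_of_eq_pow_mul hg.self_of_nhds.1 (hg.mono fun t ht => ht.2)
  · obtain ⟨g, -, hg⟩ := exists_eq_pow_mul_of_isBigO hf (h (p + 1))
    exact ⟨g, hg⟩

theorem IsBigO.of_pow_succ (h : f =O[𝓝 t₀] fun t => (t - t₀) ^ (p + 1)) :
    f =O[𝓝 t₀] fun t => (t - t₀) ^ p :=
  h.trans (isBigO_of_eq_pow_mul (g := fun t => t - t₀) (by fun_prop)
    (.of_forall fun t => pow_succ _ _))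

theorem le_vanishingOrder_iff (hf : ContinuousAt f t₀) :
    (p : ℕ∞) ≤ vanishingOrder t₀ f ↔ f =O[𝓝 t₀] fun t => (t - t₀) ^ p :=
  le_iSup_nat_iff (by simpa using hf.isBigO_one ℝ) fun _ => IsBigO.of_pow_succ

theorem vanishingOrder_eq_top_iff (hf : ContinuousAt f t₀) :
    vanishingOrder t₀ f = ⊤ ↔ ∀ p : ℕ, f =O[𝓝 t₀] fun t => (t - t₀) ^ p := by
  rw [ENat.eq_top_iff_forall_ge]
  exact forall_congr' fun p => le_vanishingOrder_iff hf

theorem vanishingOrder_pow_mul (hg : ContinuousAt g t₀) (hg0 : g t₀ ≠ 0)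
    (h : ∀ᶠ t in 𝓝 t₀, f t = (t - t₀) ^ k * g t) : vanishingOrder t₀ f = k := by
  have hf : ContinuousAt f t₀ :=
    (continuousAt_pow_mul_of hg).congr (h.mono fun t ht => ht.symm)
  refine le_antisymm ?_ ((le_vanishingOrder_iff hf).2 (isBigO_of_eq_pow_mul hg h))
  by_contra! hc
  have hc := Order.add_one_le_of_lt hc
  have h1 := (le_vanishingOrder_iff (p := k + 1) hf).1 (by exact_mod_cast hc)
  have := isBigO_pow_le_of_mul hg hg0 (h1.congr' h .rfl)
  omega

theorem vanishingOrder_congr (h : f =ᶠ[𝓝 t₀] g) : vanishingOrder t₀ f = vanishingOrder t₀ g := by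
  unfold vanishingOrder
  have : ∀ p : ℕ, (f =O[𝓝 t₀] fun t => (t - t₀) ^ p) ↔ g =O[𝓝 t₀] fun t => (t - t₀) ^ p :=
    fun p => isBigO_congr h .rfl
  simp only [this]

end orders

/-! ### Centered curves and the reduction step -/

section centered
variable {n : ℕ} {t₀ : ℝ} {P Q R : ℝ → ℝ[X]}

theorem signedCoeff_congr {t : ℝ} (h : P =ᶠ[𝓝 t] Q) (k : ℕ) :
    (fun s => signedCoeff n (P s) k) =ᶠ[𝓝 t] fun s => signedCoeff n (Q s) k :=
  h.mono fun s hs => by simp only [hs]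

theorem centeredCurve_congr (h : P =ᶠ[𝓝 t₀] Q) : centeredCurve n P =ᶠ[𝓝 t₀] centeredCurve n Q :=
  h.mono fun t ht => by simp only [centeredCurve, ht]

theorem centeredCurve_of_rootPoly (hn : 1 ≤ n) {t : ℝ} {y : Fin n → ℝ} (h : P t = rootPoly y) :
    centeredCurve n P t = rootPoly fun i => y i - (∑ j, y j) / n := by
  rw [centeredCurve, h, signedCoeff_rootPoly_one hn, rootPoly_comp_X_add_C]

theorem centeredCurve_comp (t : ℝ) :
    P t = (centeredCurve n P t).comp (X + C (-(signedCoeff n (P t) 1 / n))) := by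
  rw [centeredCurve, comp_assoc]
  simp

theorem centeredCurve_of_signedCoeff_one {t : ℝ} (h : signedCoeff n (P t) 1 = 0) :
    centeredCurve n P t = P t := by
  simp [centeredCurve, h]

theorem IsHyperbolicCurveNear.continuousAt_signedCoeff (h : IsHyperbolicCurveNear t₀ n P) (k : ℕ) :
    ∀ᶠ t in 𝓝 t₀, ContinuousAt (fun s => signedCoeff n (P s) k) t :=
  (h.2 (n - k)).mono fun _ ht => continuousAt_const.mul ht

theorem IsLocalParam.centered (hn : 1 ≤ n) {y : Fin n → ℝ → ℝ} (h : IsLocalParam t₀ n P y) :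
    IsLocalParam t₀ n (centeredCurve n P) fun i t => y i t - (∑ j, y j t) / n := by
  refine ⟨fun i => ?_, h.2.mono fun t ht => centeredCurve_of_rootPoly hn ht⟩
  filter_upwards [h.eventually_continuousAt] with t ht
  exact (ht i).sub ((tendsto_finsetSum _ fun j _ => ht j).div_const _)

theorem IsHyperbolicCurveNear.centered (hn : 1 ≤ n) (h : IsHyperbolicCurveNear t₀ n P) :
    IsHyperbolicCurveNear t₀ n (centeredCurve n P) :=
  (h.isLocalParam_ordRoot.centered hn).isHyperbolicCurveNear

theorem IsHyperbolicCurveNear.signedCoeff_centered_one (hn : 1 ≤ n)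
    (h : IsHyperbolicCurveNear t₀ n P) :
    ∀ᶠ t in 𝓝 t₀, signedCoeff n (centeredCurve n P t) 1 = 0 := by
  filter_upwards [h.1] with t ht
  rw [centeredCurve_of_rootPoly hn (ordRoot_spec ht).2, signedCoeff_rootPoly_one hn]
  have : (n : ℝ) ≠ 0 := by positivity
  simp [mul_div_cancel₀ _ this]

theorem centeredCurve_eq_of_coincident (hn : 1 ≤ n) {c : ℝ} (h : P t₀ = (X - C c) ^ n) :
    centeredCurve n P t₀ = X ^ n := by
  rw [← rootPoly_const] at h
  rw [centeredCurve_of_rootPoly hn h]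
  have : (n : ℝ) ≠ 0 := by positivity
  simp [mul_div_cancel_left₀ _ this, rootPoly]

/-- The relation between a curve and the curve obtained from it by dividing the roots of the
centered curve by `(t - t₀) ^ r`. -/
def IsReduction (t₀ : ℝ) (n r : ℕ) (P R : ℝ → ℝ[X]) : Prop :=
  ∀ᶠ t in 𝓝 t₀, ∀ k ∈ Finset.Icc 1 n,
    signedCoeff n (centeredCurve n P t) k = (t - t₀) ^ (k * r) * signedCoeff n (R t) k

/-- The k-th elementary symmetric function is homogeneous of degree k, so dividing a_k by
(t-t₀)^{kr} amounts to dividing the centered roots by (t-t₀)^r; undoing the centering adds the mean.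
-/
theorem IsReduction.isLocalParam {r : ℕ} (h : IsReduction t₀ n r P R) (hn : 1 ≤ n)
    (hP : IsHyperbolicCurveNear t₀ n P) {y : Fin n → ℝ → ℝ} (hy : IsLocalParam t₀ n R y) :
    IsLocalParam t₀ n P fun i t => signedCoeff n (P t) 1 / n + (t - t₀) ^ r * y i t := by
  refine ⟨fun i => ?_, ?_⟩
  · filter_upwards [hy.1 i, hP.continuousAt_signedCoeff 1] with t h1 h2
    exact (h2.div_const _).add (((continuousAt_id.sub continuousAt_const).pow r).mul h1)
  · filter_upwards [h, hy.2, (hP.centered hn).1] with t h1 h2 h3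
    have : centeredCurve n P t = rootPoly fun i => (t - t₀) ^ r * y i t := by
      refine eq_of_signedCoeff_eq h3.1 h3.2.1 (rootPoly_monic _) (by simp [rootPoly_natDegree])
        fun k hk => ?_
      rw [signedCoeff_scale _ _ (Finset.mem_Icc.1 hk).2, h1 k hk, h2, ← pow_mul, mul_comm r]
    conv_lhs => rw [centeredCurve_comp (n := n) (P := P) t, this, rootPoly_comp_X_add_C]
    congr 1
    ext i
    ring

theorem IsReduction.signedCoeff_one {r : ℕ} (h : IsReduction t₀ n r P R) (hn : 1 ≤ n)
    (hP : IsHyperbolicCurveNear t₀ n P) (hR : IsHyperbolicCurveNear t₀ n R) :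
    ∀ᶠ t in 𝓝 t₀, signedCoeff n (R t) 1 = 0 := by
  refine eventuallyEq_of_pow_mul (g := fun _ => 0) (j := 1 * r)
    (hR.continuousAt_signedCoeff 1).self_of_nhds continuousAt_const ?_
  filter_upwards [h, hP.signedCoeff_centered_one hn] with t h1 h2
  rw [← h1 1 (Finset.mem_Icc.2 ⟨le_rfl, hn⟩), h2, mul_zero]

end centered

/-! ### Basic properties of the local integers -/

namespace HasLocalGamma
variable {n : ℕ} {t₀ : ℝ} {P Q R P₁ P₂ : ℝ → ℝ[X]} {Γ γ : ℕ}

theorem isHyperbolicCurveNear (h : HasLocalGamma t₀ n P Γ γ) : IsHyperbolicCurveNear t₀ n P := by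
  cases h <;> assumption

theorem pos (h : HasLocalGamma t₀ n P Γ γ) : 1 ≤ n := by
  induction h <;> omega

theorem congr (h : HasLocalGamma t₀ n P Γ γ) (he : P =ᶠ[𝓝 t₀] Q) : HasLocalGamma t₀ n Q Γ γ := by
  cases h with
  | split hP hmul hdisj h₁ h₂ =>
    exact .split (hP.congr he) (by filter_upwards [hmul, he] with t h1 h2; rw [← h2, h1]) hdisj h₁ h₂
  | reduce hP hn hroot hmult hR h =>
    refine .reduce (hP.congr he) hn (he.self_of_nhds ▸ hroot) ?_ ?_ h
    · rw [← hmult]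
      exact (multiplicityAt_congr (signedCoeff_congr (centeredCurve_congr he) 2)).symm
    · filter_upwards [hR, centeredCurve_congr (n := n) he] with t h1 h2
      rwa [← h2]
  | flat hP hn hroot hmult =>
    refine .flat (hP.congr he) hn (he.self_of_nhds ▸ hroot) ?_
    rw [← hmult]
    exact (multiplicityAt_congr (signedCoeff_congr (centeredCurve_congr he) 2)).symm
  | linear hP => exact .linear (hP.congr he)

end HasLocalGamma

theorem exists_isRoot_of_splits {n : ℕ} (hn : 1 ≤ n) {Q : ℝ[X]}
    (h : Q.Monic ∧ Q.natDegree = n ∧ Q.Splits) : ∃ x, Q.IsRoot x := by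
  rw [(ordRoot_spec h).2]
  exact ⟨_, rootPoly_isRoot.2 ⟨⟨0, hn⟩, rfl⟩⟩

theorem false_of_coincident_of_split {n n₁ n₂ : ℕ} {t₀ c : ℝ} {P P₁ P₂ : ℝ → ℝ[X]}
    (hn₁ : 1 ≤ n₁) (hn₂ : 1 ≤ n₂)
    (h₁ : IsHyperbolicCurveNear t₀ n₁ P₁) (h₂ : IsHyperbolicCurveNear t₀ n₂ P₂)
    (hmul : ∀ᶠ t in 𝓝 t₀, P t = P₁ t * P₂ t)
    (hdisj : ∀ x : ℝ, ¬ ((P₁ t₀).IsRoot x ∧ (P₂ t₀).IsRoot x)) (hc : P t₀ = (X - C c) ^ n) :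
    False := by
  obtain ⟨x, hx⟩ := exists_isRoot_of_splits hn₁ h₁.1.self_of_nhds
  obtain ⟨z, hz⟩ := exists_isRoot_of_splits hn₂ h₂.1.self_of_nhds
  have hroot : ∀ w, (P t₀).IsRoot w → w = c := fun w hw => by
    rw [hc, IsRoot, eval_pow] at hw
    have := eq_zero_of_pow_eq_zero hw
    simpa [sub_eq_zero] using this
  have hm := hmul.self_of_nhds
  have h1 : x = c := hroot x (by rw [hm, root_mul]; exact Or.inl hx)
  have h2 : z = c := hroot z (by rw [hm, root_mul]; exact Or.inr hz)
  exact hdisj c ⟨h1 ▸ hx, h2 ▸ hz⟩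

/-! ### Uniqueness of the local integers -/

/-- `Γ` and `D = Γ - γ` are the local integers of `P`, where degree zero is allowed. -/
def FactorGamma (t₀ : ℝ) (n : ℕ) (P : ℝ → ℝ[X]) (Γ D : ℕ) : Prop :=
  (n = 0 ∧ Γ = 0 ∧ D = 0) ∨ ∃ γ, HasLocalGamma t₀ n P Γ γ ∧ D = Γ - γ

section uniqueness
variable {n n₁ n₂ : ℕ} {t₀ : ℝ} {P P₁ P₂ : ℝ → ℝ[X]} {Γ γ Γ₁ D₁ Γ₂ D₂ : ℕ}

theorem IsHyperbolicCurveNear.eq_one (h : IsHyperbolicCurveNear t₀ 0 P) :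
    ∀ᶠ t in 𝓝 t₀, P t = 1 :=
  h.1.mono fun _ ht => ht.1.natDegree_eq_zero.1 ht.2.1

/-- Recording Γ - γ instead of γ makes both entries combine by maxima. Degree zero is admitted
because a block of a common refinement may be empty, in which case that factor is identically 1 near
t₀. -/
theorem FactorGamma.mul (h₁ : FactorGamma t₀ n₁ P₁ Γ₁ D₁) (h₂ : FactorGamma t₀ n₂ P₂ Γ₂ D₂)
    (k₁ : IsHyperbolicCurveNear t₀ n₁ P₁) (k₂ : IsHyperbolicCurveNear t₀ n₂ P₂)
    (hP : IsHyperbolicCurveNear t₀ (n₁ + n₂) P) (hmul : ∀ᶠ t in 𝓝 t₀, P t = P₁ t * P₂ t)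
    (hdisj : ∀ x : ℝ, ¬ ((P₁ t₀).IsRoot x ∧ (P₂ t₀).IsRoot x)) :
    FactorGamma t₀ (n₁ + n₂) P (max Γ₁ Γ₂) (max D₁ D₂) := by
  rcases h₁ with ⟨rfl, rfl, rfl⟩ | ⟨γ₁, h₁, rfl⟩
  · have he : P₂ =ᶠ[𝓝 t₀] P := by
      filter_upwards [k₁.eq_one, hmul] with t h1 h2
      rw [h2, h1, one_mul]
    rw [zero_add, Nat.zero_max, Nat.zero_max]
    rcases h₂ with h₂ | ⟨γ₂, h₂, rfl⟩
    · exact Or.inl h₂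
    · exact Or.inr ⟨γ₂, h₂.congr he, rfl⟩
  rcases h₂ with ⟨rfl, rfl, rfl⟩ | ⟨γ₂, h₂, rfl⟩
  · have he : P₁ =ᶠ[𝓝 t₀] P := by
      filter_upwards [k₂.eq_one, hmul] with t h1 h2
      rw [h2, h1, mul_one]
    rw [add_zero, Nat.max_zero, Nat.max_zero]
    exact Or.inr ⟨γ₁, h₁.congr he, rfl⟩
  · exact Or.inr ⟨_, .split hP hmul hdisj h₁ h₂, by omega⟩

/-- The polynomial curve with the roots `y i`, `i ∈ S`. -/
noncomputable def subProd (y : Fin n → ℝ → ℝ) (S : Finset (Fin n)) (t : ℝ) : ℝ[X] :=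
  ∏ i ∈ S, (X - C (y i t))

theorem IsLocalParam.subProd {y : Fin n → ℝ → ℝ} (h : IsLocalParam t₀ n P y)
    (S : Finset (Fin n)) : IsHyperbolicCurveNear t₀ S.card (subProd y S) := by
  obtain ⟨e, he⟩ := h.exists_of_prod (P₁ := _root_.subProd y S) (S := S)
    (.of_forall fun t => rfl) rfl
  exact he.isHyperbolicCurveNear

theorem subProd_isRoot {y : Fin n → ℝ → ℝ} {S : Finset (Fin n)} {t x : ℝ} :
    (subProd y S t).IsRoot x ↔ ∃ i ∈ S, y i t = x := by
  simp [subProd, IsRoot, eval_prod, Finset.prod_eq_zero_iff, sub_eq_zero, eq_comm (a := x)]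

/-- Any coprime splitting can be read off from a derivation of the integers. In the split case the
two factorizations have a common refinement into four blocks; the induction hypotheses give integers
for the blocks, which regroup into the prescribed factors because maxima are associative and
commutative. In the coincident and linear cases one factor must have degree zero. -/
theorem HasLocalGamma.exists_factorGamma (h : HasLocalGamma t₀ n P Γ γ)
    (k₁ : IsHyperbolicCurveNear t₀ n₁ P₁) (k₂ : IsHyperbolicCurveNear t₀ n₂ P₂)
    (hn : n₁ + n₂ = n) (hmul : ∀ᶠ t in 𝓝 t₀, P t = P₁ t * P₂ t)
    (hdisj : ∀ x : ℝ, ¬ ((P₁ t₀).IsRoot x ∧ (P₂ t₀).IsRoot x)) :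
    ∃ Γ₁ D₁ Γ₂ D₂, FactorGamma t₀ n₁ P₁ Γ₁ D₁ ∧ FactorGamma t₀ n₂ P₂ Γ₂ D₂ ∧
      Γ = max Γ₁ Γ₂ ∧ Γ - γ = max D₁ D₂ := by
  classical
  induction h generalizing n₁ n₂ P₁ P₂ with
  | @split m₁ m₂ P Q₁ Q₂ Γa γa Γb γb hP hmul' hdisj' ha hb iha ihb =>
    set y : Fin (m₁ + m₂) → ℝ → ℝ := fun i t => ordRoot (m₁ + m₂) (P t) i with hy
    have hyP : IsLocalParam t₀ (m₁ + m₂) P y := hP.isLocalParam_ordRoot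
    set p : Fin (m₁ + m₂) → Prop := fun i => (Q₁ t₀).IsRoot (y i t₀) with hp
    set q : Fin (m₁ + m₂) → Prop := fun i => (P₁ t₀).IsRoot (y i t₀) with hq
    have hor : ∀ i, (P t₀).IsRoot (y i t₀) := fun i => by
      rw [hyP.2.self_of_nhds, rootPoly_isRoot]; exact ⟨i, rfl⟩
    have hp' : ∀ i, (Q₂ t₀).IsRoot (y i t₀) ↔ ¬ p i := fun i => by
      refine ⟨fun h h' => hdisj' _ ⟨h', h⟩, fun h => ?_⟩
      have := hor i
      rw [hmul'.self_of_nhds, root_mul] at this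
      exact this.resolve_left h
    have hq' : ∀ i, (P₂ t₀).IsRoot (y i t₀) ↔ ¬ q i := fun i => by
      refine ⟨fun h h' => hdisj _ ⟨h', h⟩, fun h => ?_⟩
      have := hor i
      rw [hmul.self_of_nhds, root_mul] at this
      exact this.resolve_left h
    have hmul'₂ : ∀ᶠ t in 𝓝 t₀, P t = Q₂ t * Q₁ t := by simpa only [mul_comm] using hmul'
    have hmul₂ : ∀ᶠ t in 𝓝 t₀, P t = P₂ t * P₁ t := by simpa only [mul_comm] using hmul
    have eQ₁ := hyP.factor ha.isHyperbolicCurveNear hb.isHyperbolicCurveNear hmul' hdisj'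
    have eQ₂ := hyP.factor hb.isHyperbolicCurveNear ha.isHyperbolicCurveNear hmul'₂
      fun x hx => hdisj' x hx.symm
    have eP₁ := hyP.factor k₁ k₂ hmul hdisj
    have eP₂ := hyP.factor k₂ k₁ hmul₂ fun x hx => hdisj x hx.symm
    simp only [hp'] at eQ₂
    simp only [hq'] at eP₂
    -- A r s carries the roots whose indices satisfy r and s. With p and q recording membership in
    -- Q₁ and P₁ at t₀, the four blocks are obtained from p, q and their negations.
    set A := fun (r s : Fin (m₁ + m₂) → Prop) => subProd y (Finset.univ.filter fun i => r i ∧ s i)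
    have hA : ∀ r s, IsHyperbolicCurveNear t₀ _ (A r s) := fun r s => hyP.subProd _
    have hsplit : ∀ (r s : Fin (m₁ + m₂) → Prop) (t : ℝ),
        ∏ i with r i, (X - C (y i t)) = A r s t * A r (fun i => ¬ s i) t := fun r s t => by
      rw [← Finset.prod_filter_mul_prod_filter_not _ s, Finset.filter_filter, Finset.filter_filter]
      simp only [A, subProd]
    have hsplit' : ∀ (r s : Fin (m₁ + m₂) → Prop) (t : ℝ),
        ∏ i with s i, (X - C (y i t)) = A r s t * A (fun i => ¬ r i) s t := fun r s t => by
      rw [← Finset.prod_filter_mul_prod_filter_not _ r, Finset.filter_filter, Finset.filter_filter]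
      simp only [and_comm (a := s _), A, subProd]
    have hdq : ∀ r r' x, ¬ ((A r q t₀).IsRoot x ∧ (A r' (fun i => ¬ q i) t₀).IsRoot x) := by
      rintro r r' x ⟨h1, h2⟩
      simp only [A, subProd_isRoot, Finset.mem_filter, Finset.mem_univ, true_and] at h1 h2
      obtain ⟨i, hi, rfl⟩ := h1
      obtain ⟨j, hj, hji⟩ := h2
      refine hj.2 ?_
      simp only [q, hji]
      exact hi.2
    have hdp : ∀ s s' x, ¬ ((A p s t₀).IsRoot x ∧ (A (fun i => ¬ p i) s' t₀).IsRoot x) := by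
      rintro s s' x ⟨h1, h2⟩
      simp only [A, subProd_isRoot, Finset.mem_filter, Finset.mem_univ, true_and] at h1 h2
      obtain ⟨i, hi, rfl⟩ := h1
      obtain ⟨j, hj, hji⟩ := h2
      refine hj.1 ?_
      simp only [p, hji]
      exact hi.1
    have hdeg : ∀ {m : ℕ} {Q A₁ A₂ : ℝ → ℝ[X]} {a b : ℕ}, IsHyperbolicCurveNear t₀ m Q →
        IsHyperbolicCurveNear t₀ a A₁ → IsHyperbolicCurveNear t₀ b A₂ →
        (∀ᶠ t in 𝓝 t₀, Q t = A₁ t * A₂ t) → a + b = m := by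
      intro m Q A₁ A₂ a b h1 h2 h3 h4
      obtain ⟨t, ⟨h1, h2⟩, h3, h4⟩ := ((h1.1.and h2.1).and (h3.1.and h4)).exists
      rw [← h1.2.1, h4, h2.1.natDegree_mul h3.1, h2.2.1, h3.2.1]
    have mQ₁ : ∀ᶠ t in 𝓝 t₀, Q₁ t = A p q t * A p (fun i => ¬ q i) t :=
      eQ₁.mono fun t ht => ht.trans (.trans (by congr!) (hsplit p q t))
    have mQ₂ : ∀ᶠ t in 𝓝 t₀, Q₂ t = A (fun i => ¬ p i) q t * A (fun i => ¬ p i) (fun i => ¬ q i) t :=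
      eQ₂.mono fun t ht => ht.trans (.trans (by congr!) (hsplit (fun i => ¬ p i) q t))
    have mP₁ : ∀ᶠ t in 𝓝 t₀, P₁ t = A p q t * A (fun i => ¬ p i) q t :=
      eP₁.mono fun t ht => ht.trans (.trans (by congr!) (hsplit' p q t))
    have mP₂ : ∀ᶠ t in 𝓝 t₀, P₂ t = A p (fun i => ¬ q i) t * A (fun i => ¬ p i) (fun i => ¬ q i) t :=
      eP₂.mono fun t ht => ht.trans (.trans (by congr!) (hsplit' p (fun i => ¬ q i) t))
    obtain ⟨G11, D11, G12, D12, f11, f12, hG1, hD1⟩ := iha (hA _ _) (hA _ _)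
      (hdeg ha.isHyperbolicCurveNear (hA _ _) (hA _ _) mQ₁) mQ₁ (hdq _ _)
    obtain ⟨G21, D21, G22, D22, f21, f22, hG2, hD2⟩ := ihb (hA _ _) (hA _ _)
      (hdeg hb.isHyperbolicCurveNear (hA _ _) (hA _ _) mQ₂) mQ₂ (hdq _ _)
    have d₁ := hdeg k₁ (hA _ _) (hA _ _) mP₁
    have d₂ := hdeg k₂ (hA _ _) (hA _ _) mP₂
    have g₁ := f11.mul f21 (hA _ _) (hA _ _) (d₁.symm ▸ k₁) mP₁ (hdp _ _)
    have g₂ := f12.mul f22 (hA _ _) (hA _ _) (d₂.symm ▸ k₂) mP₂ (hdp _ _)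
    rw [d₁] at g₁
    rw [d₂] at g₂
    exact ⟨_, _, _, _, g₁, g₂, by omega, by omega⟩
  | @reduce n r P R Γ γ hP hn' hroot hmult hR h _ =>
    have h' := HasLocalGamma.reduce hP hn' hroot hmult hR h
    rcases Nat.eq_zero_or_pos n₁ with rfl | h1
    · have he : P =ᶠ[𝓝 t₀] P₂ := by
        filter_upwards [k₁.eq_one, hmul] with t h1 h2
        rw [h2, h1, one_mul]
      rw [zero_add] at hn
      subst hn
      exact ⟨0, 0, _, _, Or.inl ⟨rfl, rfl, rfl⟩, Or.inr ⟨_, h'.congr he, rfl⟩, by simp, by simp⟩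
    rcases Nat.eq_zero_or_pos n₂ with rfl | h2
    · have he : P =ᶠ[𝓝 t₀] P₁ := by
        filter_upwards [k₂.eq_one, hmul] with t h1 h2
        rw [h2, h1, mul_one]
      rw [add_zero] at hn
      subst hn
      exact ⟨_, _, 0, 0, Or.inr ⟨_, h'.congr he, rfl⟩, Or.inl ⟨rfl, rfl, rfl⟩, by simp, by simp⟩
    obtain ⟨c, hc⟩ := hroot
    exact (false_of_coincident_of_split h1 h2 k₁ k₂ hmul hdisj hc).elim
  | @flat n P hP hn' hroot hmult =>
    have h' := HasLocalGamma.flat hP hn' hroot hmult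
    rcases Nat.eq_zero_or_pos n₁ with rfl | h1
    · have he : P =ᶠ[𝓝 t₀] P₂ := by
        filter_upwards [k₁.eq_one, hmul] with t h1 h2
        rw [h2, h1, one_mul]
      rw [zero_add] at hn
      subst hn
      exact ⟨0, 0, _, _, Or.inl ⟨rfl, rfl, rfl⟩, Or.inr ⟨_, h'.congr he, rfl⟩, by simp, by simp⟩
    rcases Nat.eq_zero_or_pos n₂ with rfl | h2
    · have he : P =ᶠ[𝓝 t₀] P₁ := by
        filter_upwards [k₂.eq_one, hmul] with t h1 h2
        rw [h2, h1, mul_one]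
      rw [add_zero] at hn
      subst hn
      exact ⟨_, _, 0, 0, Or.inr ⟨_, h'.congr he, rfl⟩, Or.inl ⟨rfl, rfl, rfl⟩, by simp, by simp⟩
    obtain ⟨c, hc⟩ := hroot
    exact (false_of_coincident_of_split h1 h2 k₁ k₂ hmul hdisj hc).elim
  | @linear P hP =>
    have h' := HasLocalGamma.linear hP
    rcases Nat.eq_zero_or_pos n₁ with rfl | h1
    · have he : P =ᶠ[𝓝 t₀] P₂ := by
        filter_upwards [k₁.eq_one, hmul] with t h1 h2
        rw [h2, h1, one_mul]
      rw [zero_add] at hn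
      subst hn
      exact ⟨0, 0, _, _, Or.inl ⟨rfl, rfl, rfl⟩, Or.inr ⟨_, h'.congr he, rfl⟩, by simp, by simp⟩
    · obtain rfl : n₂ = 0 := by omega
      have he : P =ᶠ[𝓝 t₀] P₁ := by
        filter_upwards [k₂.eq_one, hmul] with t h1 h2
        rw [h2, h1, mul_one]
      rw [add_zero] at hn
      subst hn
      exact ⟨_, _, 0, 0, Or.inr ⟨_, h'.congr he, rfl⟩, Or.inl ⟨rfl, rfl, rfl⟩, by simp, by simp⟩

/-- Only splitting involves a choice, and it is absorbed by `HasLocalGamma.exists_factorGamma`. In a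
reduction r is determined by the multiplicity, and the reduced curve by continuity at t₀; the other
rules exclude one another. -/
theorem HasLocalGamma.unique {Γ' γ' : ℕ} (h : HasLocalGamma t₀ n P Γ γ)
    (h' : HasLocalGamma t₀ n P Γ' γ') : Γ' = Γ ∧ γ' = γ := by
  induction h generalizing Γ' γ' with
  | @split m₁ m₂ P Q₁ Q₂ Γa γa Γb γb hP hmul hdisj ha hb iha ihb =>
    obtain ⟨Γ₁, D₁, Γ₂, D₂, f₁, f₂, hΓ, hD⟩ := h'.exists_factorGamma ha.isHyperbolicCurveNear
      hb.isHyperbolicCurveNear rfl hmul hdisj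
    have p₁ := ha.pos
    have p₂ := hb.pos
    obtain ⟨γ₁, g₁, rfl⟩ := f₁.resolve_left (by omega)
    obtain ⟨γ₂, g₂, rfl⟩ := f₂.resolve_left (by omega)
    obtain ⟨rfl, rfl⟩ := iha g₁
    obtain ⟨rfl, rfl⟩ := ihb g₂
    have := h'.le
    exact ⟨hΓ, by omega⟩
  | @reduce n r P R Γ γ hP hn hroot hmult hR h ih =>
    cases h' with
    | split hP' hmul hdisj h₁ h₂ =>
      obtain ⟨c, hc⟩ := hroot
      exact (false_of_coincident_of_split h₁.pos h₂.pos h₁.isHyperbolicCurveNear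
        h₂.isHyperbolicCurveNear hmul hdisj hc).elim
    | @reduce _ r' _ R' Γ' γ' hP' hn' hroot' hmult' hR' h' =>
      rw [hmult] at hmult'
      obtain rfl : r = r' := by
        have : 2 * r = 2 * r' := by exact_mod_cast hmult'
        omega
      have he : R' =ᶠ[𝓝 t₀] R := by
        have k1 := h.isHyperbolicCurveNear
        have k2 := h'.isHyperbolicCurveNear
        have hk : ∀ k ∈ Finset.Icc 1 n, ∀ᶠ t in 𝓝 t₀,
            signedCoeff n (R' t) k = signedCoeff n (R t) k := fun k hk => by
          refine eventuallyEq_of_pow_mul (j := k * r) (k2.continuousAt_signedCoeff k).self_of_nhds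
            (k1.continuousAt_signedCoeff k).self_of_nhds ?_
          filter_upwards [hR, hR'] with t h1 h2
          rw [← h1 k hk, ← h2 k hk]
        filter_upwards [(Filter.eventually_all_finset _).2 hk, k1.1, k2.1] with t h1 h2 h3
        exact eq_of_signedCoeff_eq h3.1 h3.2.1 h2.1 h2.2.1 h1
      obtain ⟨rfl, rfl⟩ := ih (h'.congr he)
      exact ⟨rfl, rfl⟩
    | flat hP' hn' hroot' hmult' =>
      rw [hmult] at hmult'
      exact absurd hmult' (ENat.natCast_ne_top _)
    | linear => omega
  | @flat n P hP hn hroot hmult =>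
    cases h' with
    | split hP' hmul hdisj h₁ h₂ =>
      obtain ⟨c, hc⟩ := hroot
      exact (false_of_coincident_of_split h₁.pos h₂.pos h₁.isHyperbolicCurveNear
        h₂.isHyperbolicCurveNear hmul hdisj hc).elim
    | reduce hP' hn' hroot' hmult' hR' h' =>
      rw [hmult] at hmult'
      exact absurd hmult'.symm (ENat.natCast_ne_top _)
    | flat => exact ⟨rfl, rfl⟩
    | linear => omega
  | @linear P hP =>
    generalize hn : (1 : ℕ) = n at h'
    cases h' with
    | split hP' hmul hdisj h₁ h₂ =>
      have := h₁.pos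
      have := h₂.pos
      omega
    | reduce hP' hn' hroot' hmult' hR' h' => omega
    | flat hP' hn' => omega
    | linear => exact ⟨rfl, rfl⟩

/-! ### The bound by the order of contact -/

/-- A continuous a₂ vanishing at t₀ may have multiplicity 0, as in x² - |t|. The rule with r = 0
would then reproduce the centered curve, so the recursion could not end; a finite derivation
excludes this. -/
theorem HasLocalGamma.multiplicityAt_ne_zero (h : HasLocalGamma t₀ n P Γ γ) (hn : 1 < n)
    (hroot : ∃ c : ℝ, P t₀ = (X - C c) ^ n) :
    multiplicityAt t₀ (fun t => signedCoeff n (centeredCurve n P t) 2) ≠ 0 := by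
  induction h with
  | split hP hmul hdisj h₁ h₂ =>
    obtain ⟨c, hc⟩ := hroot
    exact (false_of_coincident_of_split h₁.pos h₂.pos h₁.isHyperbolicCurveNear
      h₂.isHyperbolicCurveNear hmul hdisj hc).elim
  | @reduce n r P R Γ γ hP _ _ hmult hR h ih =>
    intro h0
    obtain rfl : r = 0 := by
      rw [hmult] at h0
      have : 2 * r = 0 := by exact_mod_cast h0
      omega
    have he : centeredCurve n P =ᶠ[𝓝 t₀] R := by
      filter_upwards [hR, (hP.centered hn.le).1, h.isHyperbolicCurveNear.1] with t h1 h2 h3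
      exact eq_of_signedCoeff_eq h2.1 h2.2.1 h3.1 h3.2.1 fun k hk => by simpa using h1 k hk
    obtain ⟨c, hc⟩ := hroot
    refine ih hn ⟨0, ?_⟩ ?_
    · rw [← he.self_of_nhds, centeredCurve_eq_of_coincident hn.le hc]; simp
    · rw [← h0]
      refine multiplicityAt_congr (signedCoeff_congr ?_ 2)
      have h1 := IsReduction.signedCoeff_one hR hn.le hP h.isHyperbolicCurveNear
      filter_upwards [h1, he] with t h1 h2
      rw [centeredCurve_of_signedCoeff_one h1, h2]
  | flat _ _ _ hmult => simp [hmult]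
  | linear => omega

/-- After a reduction, the roots do not all coincide any more. -/
theorem HasLocalGamma.not_coincident_of_reduce {r : ℕ} {R : ℝ → ℝ[X]}
    (hP : IsHyperbolicCurveNear t₀ n P) (hn : 1 < n)
    (hmult : multiplicityAt t₀ (fun t => signedCoeff n (centeredCurve n P t) 2) = (2 * r : ℕ))
    (hR : IsReduction t₀ n r P R) (h : HasLocalGamma t₀ n R Γ γ) (c : ℝ) :
    R t₀ ≠ (X - C c) ^ n := by
  intro hc
  have h0 := h.multiplicityAt_ne_zero hn ⟨c, hc⟩
  have hRh := h.isHyperbolicCurveNear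
  have hcont := (hRh.centered hn.le).continuousAt_signedCoeff 2
  -- If the roots of R still coincided, its a₂ would contain a factor t - t₀, which would raise the
  -- multiplicity of the a₂ of P beyond 2r.
  have h1 : ((1 : ℕ) : ℕ∞) ≤ multiplicityAt t₀ (fun t => signedCoeff n (centeredCurve n R t) 2) := by
    rw [Nat.cast_one]
    exact Order.one_le_iff_pos.2 (pos_iff_ne_zero.2 h0)
  obtain ⟨g, hg⟩ := (le_multiplicityAt_iff hcont).1 h1
  have h2 : ((2 * r + 1 : ℕ) : ℕ∞) ≤
      multiplicityAt t₀ (fun t => signedCoeff n (centeredCurve n P t) 2) := by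
    refine (le_multiplicityAt_iff ((hP.centered hn.le).continuousAt_signedCoeff 2)).2 ⟨g, ?_⟩
    filter_upwards [hg, hR, hR.signedCoeff_one hn.le hP hRh] with t h3 h4 h5
    refine ⟨h3.1, ?_⟩
    rw [h4 2 (Finset.mem_Icc.2 ⟨by omega, hn⟩), ← centeredCurve_of_signedCoeff_one h5, h3.2]
    ring
  rw [hmult] at h2
  norm_cast at h2
  omega

/-- If `Γ` is positive, it is bounded in terms of the order of contact of two roots. -/
theorem HasLocalGamma.exists_contact (h : HasLocalGamma t₀ n P Γ γ) : Γ = 0 ∨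
    ∃ y, IsLocalParam t₀ n P y ∧ ∃ i j c, 1 ≤ c ∧ Γ ≤ n * c ∧ ∃ u : ℝ → ℝ, ContinuousAt u t₀ ∧
      u t₀ ≠ 0 ∧ ∀ᶠ t in 𝓝 t₀, y i t - y j t = (t - t₀) ^ c * u t := by
  induction h with
  | @split n₁ n₂ P P₁ P₂ Γ₁ γ₁ Γ₂ γ₂ hP hmul hdisj h₁ h₂ ih₁ ih₂ =>
    rcases Nat.eq_zero_or_pos (max Γ₁ Γ₂) with h0 | hpos
    · exact Or.inl h0
    right
    rcases le_total Γ₂ Γ₁ with hle | hle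
    · rw [max_eq_left hle] at hpos ⊢
      obtain ⟨y, hy, i, j, c, hc, hΓ, u, hu⟩ := ih₁.resolve_left (by omega)
      refine ⟨_, hy.append h₂.isHyperbolicCurveNear.isLocalParam_ordRoot hmul,
        Fin.castAdd n₂ i, Fin.castAdd n₂ j, c, hc, ?_, u, by simpa using hu⟩
      nlinarith
    · rw [max_eq_right hle] at hpos ⊢
      obtain ⟨y, hy, i, j, c, hc, hΓ, u, hu⟩ := ih₂.resolve_left (by omega)
      refine ⟨_, h₁.isHyperbolicCurveNear.isLocalParam_ordRoot.append hy hmul,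
        Fin.natAdd n₁ i, Fin.natAdd n₁ j, c, hc, ?_, u, by simpa using hu⟩
      nlinarith
  | @reduce n r P R Γ γ hP hn hroot hmult hR h ih =>
    rcases Nat.eq_zero_or_pos (Γ + n * r) with h0 | hpos
    · exact Or.inl h0
    right
    rcases ih with rfl | ⟨y, hy, i, j, c, hc, hΓ, u, hu, hu0, hij⟩
    · have hy := h.isHyperbolicCurveNear.isLocalParam_ordRoot
      set y : Fin n → ℝ → ℝ := fun i t => ordRoot n (R t) i
      -- Two roots of R that differ at t₀ acquire contact order exactly r after multiplication by
      -- (t-t₀)^r.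
      have hne : ∃ i j, y i t₀ ≠ y j t₀ := by
        by_contra! hc
        refine HasLocalGamma.not_coincident_of_reduce hP hn hmult hR h (y ⟨0, by omega⟩ t₀) ?_
        rw [hy.2.self_of_nhds, ← rootPoly_const]
        congr 1
        ext i
        exact hc _ _
      obtain ⟨i, j, hij⟩ := hne
      refine ⟨_, IsReduction.isLocalParam hR hn.le hP hy, i, j, r, ?_, by simp,
        fun t => y i t - y j t, (hy.1 i).self_of_nhds.sub (hy.1 j).self_of_nhds,
        sub_ne_zero.2 hij, .of_forall fun t => by ring⟩
      rw [zero_add] at hpos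
      exact Nat.pos_of_mul_pos_left hpos
    -- The contact order grows by r while Γ grows by nr, so Γ ≤ nc persists.
    · refine ⟨_, IsReduction.isLocalParam hR hn.le hP hy, i, j, c + r, by omega,
        by rw [mul_add]; omega, u, hu, hu0, ?_⟩
      filter_upwards [hij] with t ht
      rw [pow_add, mul_assoc, mul_left_comm, ← ht]
      ring
  | flat => exact Or.inl rfl
  | linear => exact Or.inl rfl

end uniqueness

/-! ### Coefficients of factors, centered curves and reductions -/

theorem isCoprime_of_disjoint_roots {Q₁ Q₂ : ℝ[X]} {n : ℕ}
    (h₁ : Q₁.Monic ∧ Q₁.natDegree = n ∧ Q₁.Splits)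
    (hdisj : ∀ x : ℝ, ¬ (Q₁.IsRoot x ∧ Q₂.IsRoot x)) : IsCoprime Q₁ Q₂ := by
  have h := (ordRoot_spec h₁).2
  rw [h]
  refine IsCoprime.prod_left fun i _ => ?_
  refine ((irreducible_X_sub_C _).coprime_iff_not_dvd).2 fun hd => ?_
  refine hdisj (ordRoot n Q₁ i) ⟨?_, dvd_iff_isRoot.1 hd⟩
  conv_lhs => rw [h]
  exact rootPoly_isRoot.2 ⟨i, rfl⟩

section coefficients
variable {n n₁ n₂ : ℕ} {t₀ : ℝ} {P P₁ P₂ R : ℝ → ℝ[X]}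

theorem IsHyperbolicCurveNear.mul (k₁ : IsHyperbolicCurveNear t₀ n₁ P₁)
    (k₂ : IsHyperbolicCurveNear t₀ n₂ P₂) (hmul : ∀ᶠ t in 𝓝 t₀, P t = P₁ t * P₂ t) :
    IsHyperbolicCurveNear t₀ (n₁ + n₂) P :=
  (k₁.isLocalParam_ordRoot.append k₂.isLocalParam_ordRoot hmul).isHyperbolicCurveNear

theorem IsHyperbolicCurveNear.contDiffAt_coeff_factor (k₁ : IsHyperbolicCurveNear t₀ n₁ P₁)
    (k₂ : IsHyperbolicCurveNear t₀ n₂ P₂) (hmul : ∀ᶠ t in 𝓝 t₀, P t = P₁ t * P₂ t)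
    (hdisj : ∀ x : ℝ, ¬ ((P₁ t₀).IsRoot x ∧ (P₂ t₀).IsRoot x)) {N : ℕ} (hN : N ≠ 0)
    (hP : ∀ k, ContDiffAt ℝ N (fun t => (P t).coeff k) t₀) (k : ℕ) :
    ContDiffAt ℝ N (fun t => (P₁ t).coeff k) t₀ ∧ ContDiffAt ℝ N (fun t => (P₂ t).coeff k) t₀ :=
  _root_.contDiffAt_coeff_factor hN (k₁.1.mono fun _ ht => ⟨ht.1, ht.2.1⟩)
    (k₂.1.mono fun _ ht => ⟨ht.1, ht.2.1⟩) (fun k => (k₁.2 k).self_of_nhds)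
    (fun k => (k₂.2 k).self_of_nhds) hmul
    (isCoprime_of_disjoint_roots k₁.1.self_of_nhds hdisj) hP k

/-- The coefficients of the centered curve belong to every local algebra containing those of the
curve. -/
theorem coeff_centered_induction {p : (ℝ → ℝ) → Prop} (hc : ∀ c : ℝ, p fun _ => c)
    (hadd : ∀ f g, p f → p g → p fun a => f a + g a)
    (hmul : ∀ f g, p f → p g → p fun a => f a * g a)
    (hcongr : ∀ f g, f =ᶠ[𝓝 t₀] g → p f → p g)
    (hP : IsHyperbolicCurveNear t₀ n P) (h : ∀ k, p fun t => (P t).coeff k) (k : ℕ) :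
    p fun t => (centeredCurve n P t).coeff k := by
  have hpow : ∀ f (j : ℕ), p f → p fun t => f t ^ j := fun f j hf => by
    induction j with
    | zero => simpa using hc 1
    | succ j ih => simpa [pow_succ] using hmul _ _ ih hf
  have hsum : ∀ (F : ℕ → ℝ → ℝ) (m : ℕ), (∀ i, p (F i)) →
      p fun t => ∑ i ∈ Finset.range m, F i t := fun F m hF => by
    induction m with
    | zero => simpa using hc 0
    | succ m ih => simpa [Finset.sum_range_succ] using hadd _ _ ih (hF m)
  have hs : p fun t => signedCoeff n (P t) 1 / n := by
    simpa [signedCoeff, div_eq_inv_mul, ← mul_assoc] using hmul _ _ (hc (-(n : ℝ)⁻¹)) (h (n - 1))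
  refine hcongr (fun t => ∑ i ∈ Finset.range (n + 1), (P t).coeff i *
    ((signedCoeff n (P t) 1 / n) ^ (i - k) * (i.choose k : ℝ))) _ ?_
    (hsum _ _ fun i => hmul _ _ (h i) (hmul _ _ (hpow _ _ hs) (hc _)))
  filter_upwards [hP.1] with t ht
  rw [centeredCurve, comp, eval₂_eq_sum_range' _ (n := n + 1) (by omega), finsetSum_coeff]
  refine Finset.sum_congr rfl fun i _ => ?_
  rw [coeff_C_mul, coeff_X_add_C_pow]

theorem IsHyperbolicCurveNear.contDiffAt_centered {N : WithTop ℕ∞}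
    (hP : IsHyperbolicCurveNear t₀ n P)
    (h : ∀ k, ContDiffAt ℝ N (fun t => (P t).coeff k) t₀) (k : ℕ) :
    ContDiffAt ℝ N (fun t => (centeredCurve n P t).coeff k) t₀ :=
  coeff_centered_induction (p := fun f => ContDiffAt ℝ N f t₀) (fun _ => contDiffAt_const)
    (fun _ _ hf hg => hf.add hg) (fun _ _ hf hg => hf.mul hg)
    (fun _ _ he hf => hf.congr_of_eventuallyEq he.symm) hP h k

/-- The coefficients of a monic curve belong to every class of germs containing the constants and
stable under negation to which its `signedCoeff`s belong. -/
theorem coeff_of_signedCoeff {p : (ℝ → ℝ) → Prop} (hc : ∀ c : ℝ, p fun _ => c)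
    (hmul : ∀ f (c : ℝ), p f → p fun a => c * f a) (hcongr : ∀ f g, f =ᶠ[𝓝 t₀] g → p f → p g)
    (hR : IsHyperbolicCurveNear t₀ n R)
    (h : ∀ k ∈ Finset.Icc 1 n, p fun t => signedCoeff n (R t) k) (k : ℕ) :
    p fun t => (R t).coeff k := by
  rcases lt_trichotomy k n with hk | rfl | hk
  · refine hcongr _ _ (.of_forall fun t => ?_)
      (hmul _ ((-1) ^ (n - k)) (h (n - k) (Finset.mem_Icc.2 ⟨by omega, by omega⟩)))
    exact (coeff_eq_signedCoeff _ hk.le).symm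
  · refine hcongr _ _ ?_ (hc 1)
    filter_upwards [hR.1] with t ht
    have := ht.1.leadingCoeff
    rw [leadingCoeff, ht.2.1] at this
    exact this.symm
  · refine hcongr _ _ ?_ (hc 0)
    filter_upwards [hR.1] with t ht
    rw [coeff_eq_zero_of_natDegree_lt (by omega)]

/-- Dividing a_k by (t-t₀)^{kr} costs kr derivatives, at most nr; this is the summand nr of Γ. -/
theorem IsReduction.contDiffAt {r m : ℕ} (h : IsReduction t₀ n r P R)
    (hP : IsHyperbolicCurveNear t₀ n P) (hR : IsHyperbolicCurveNear t₀ n R)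
    (hC : ∀ k, ContDiffAt ℝ (m + n * r : ℕ) (fun t => (P t).coeff k) t₀) (k : ℕ) :
    ContDiffAt ℝ m (fun t => (R t).coeff k) t₀ := by
  refine coeff_of_signedCoeff (p := fun f => ContDiffAt ℝ m f t₀) (fun _ => contDiffAt_const)
    (fun _ _ hf => contDiffAt_const.mul hf)
    (fun _ _ he hf => hf.congr_of_eventuallyEq he.symm) hR (fun k hk => ?_) k
  have h1 : ContDiffAt ℝ (m + k * r : ℕ) (fun t => signedCoeff n (centeredCurve n P t) k) t₀ := by
    refine contDiffAt_const.mul ((hP.contDiffAt_centered hC (n - k)).of_le ?_)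
    exact_mod_cast Nat.add_le_add_left (Nat.mul_le_mul_right r (Finset.mem_Icc.1 hk).2) m
  exact h1.of_pow_mul (hR.continuousAt_signedCoeff k).self_of_nhds
    (h.mono fun t ht => ht k hk)

theorem IsLocalParam.sq_isBigO (hn : 2 ≤ n) {y : Fin n → ℝ → ℝ}
    (hP : IsHyperbolicCurveNear t₀ n P) (hy : IsLocalParam t₀ n (centeredCurve n P) y) (i : Fin n) :
    (fun t => y i t ^ 2) =O[𝓝 t₀] fun t => signedCoeff n (centeredCurve n P t) 2 := by
  refine IsBigO.of_bound 2 ?_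
  filter_upwards [hy.2, hP.signedCoeff_centered_one (by omega)] with t h1 h2
  rw [h1, signedCoeff_rootPoly_one (by omega)] at h2
  have h3 := sum_sq_eq hn fun i => y i t
  have h4 : y i t ^ 2 ≤ ∑ j, y j t ^ 2 :=
    Finset.single_le_sum (f := fun j => y j t ^ 2) (fun j _ => sq_nonneg _) (Finset.mem_univ i)
  rw [h2] at h3
  rw [h1, Real.norm_eq_abs, Real.norm_eq_abs, abs_of_nonneg (sq_nonneg _)]
  linarith [neg_abs_le (signedCoeff n (rootPoly fun i => y i t) 2)]

theorem IsLocalParam.isBigO_of_sq (hn : 2 ≤ n) {y : Fin n → ℝ → ℝ} {m : ℕ}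
    (hP : IsHyperbolicCurveNear t₀ n P) (hy : IsLocalParam t₀ n (centeredCurve n P) y)
    (h : (fun t => signedCoeff n (centeredCurve n P t) 2) =O[𝓝 t₀] fun t => (t - t₀) ^ (2 * m))
    (i : Fin n) : y i =O[𝓝 t₀] fun t => (t - t₀) ^ m := by
  refine IsBigO.of_pow (n := 2) two_ne_zero ?_
  refine ((hy.sq_isBigO hn hP i).trans h).congr (fun t => rfl) fun t => ?_
  rw [Pi.pow_apply, ← pow_mul, mul_comm]

end coefficients

/-! ### Differentiable roots near a point -/

namespace OMinimalStructure
variable {M : OMinimalStructure} {n n₁ n₂ : ℕ} {t₀ : ℝ} {P P₁ P₂ R : ℝ → ℝ[X]} {f g : ℝ → ℝ}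

theorem defGerm_const (c : ℝ) : M.DefGerm t₀ fun _ => c := (def_const c).defGerm t₀

theorem DefGerm.of_pow_mul {j : ℕ} (hf : M.DefGerm t₀ f)
    (h : ∀ᶠ t in 𝓝 t₀, f t = (t - t₀) ^ j * g t) : M.DefGerm t₀ g := by
  obtain ⟨F, hF, hfF⟩ := hf
  -- The value at t₀ is not determined by F and is inserted by hand; one point does not affect
  -- definability.
  refine ⟨fun t => if t = t₀ then g t₀ else F t / (t - t₀) ^ j, ?_, ?_⟩
  · have h0 : M.DefSet 2 fun x => x 0 = t₀ := (defFun_coord 0).eq (defFun_const _)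
    have h1 : M.DefSet 2 fun x => (x 0 - t₀) ^ j * x 1 = F (x 0) :=
      ((((defFun_coord 0).sub (defFun_const _)).pow j).mul (defFun_coord 1)).eq
        (hF.comp (defFun_coord 0))
    refine DefSet.congr ((h0.and ((defFun_coord 1).eq (defFun_const (g t₀)))).or
      (h0.not.and h1)) fun x => ?_
    change _ ↔ x 1 = if x 0 = t₀ then g t₀ else F (x 0) / (x 0 - t₀) ^ j
    split_ifs with hx
    · simp [hx]
    · rw [eq_div_iff (pow_ne_zero _ (sub_ne_zero.2 hx)), mul_comm]
      simp [hx]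
  · filter_upwards [h, hfF] with t h1 h2
    split_ifs with ht
    · rw [ht]
    · rw [← h2, h1, mul_div_cancel_left₀ _ (pow_ne_zero _ (sub_ne_zero.2 ht))]

theorem defGerm_coeff_factor (k₁ : IsHyperbolicCurveNear t₀ n₁ P₁)
    (k₂ : IsHyperbolicCurveNear t₀ n₂ P₂) (hmul : ∀ᶠ t in 𝓝 t₀, P t = P₁ t * P₂ t)
    (hdisj : ∀ x : ℝ, ¬ ((P₁ t₀).IsRoot x ∧ (P₂ t₀).IsRoot x))
    (hD : ∀ k, M.DefGerm t₀ fun t => (P t).coeff k) (k : ℕ) :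
    M.DefGerm t₀ fun t => (P₁ t).coeff k := by
  classical
  have hP := k₁.mul k₂ hmul
  have h := coeff_rootPoly_induction (p := fun f => M.DefGerm t₀ f) defGerm_const
    (fun _ _ hf hg => hf.add hg) (fun _ _ hf hg => hf.mul hg)
    (Finset.univ.filter fun i => (P₁ t₀).IsRoot (ordRoot (n₁ + n₂) (P t₀) i))
    (y := fun i t => ordRoot (n₁ + n₂) (P t) i) (fun i _ => defGerm_ordRoot hP hD i) k
  refine h.congr ?_
  filter_upwards [hP.isLocalParam_ordRoot.factor k₁ k₂ hmul hdisj] with t ht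
  rw [ht]

theorem defGerm_coeff_centered (hP : IsHyperbolicCurveNear t₀ n P)
    (hD : ∀ k, M.DefGerm t₀ fun t => (P t).coeff k) (k : ℕ) :
    M.DefGerm t₀ fun t => (centeredCurve n P t).coeff k :=
  coeff_centered_induction (p := fun f => M.DefGerm t₀ f) defGerm_const
    (fun _ _ hf hg => hf.add hg) (fun _ _ hf hg => hf.mul hg)
    (fun _ _ he hf => hf.congr he) hP hD k

theorem defGerm_coeff_reduction {r : ℕ} (h : IsReduction t₀ n r P R)
    (hP : IsHyperbolicCurveNear t₀ n P) (hR : IsHyperbolicCurveNear t₀ n R)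
    (hD : ∀ k, M.DefGerm t₀ fun t => (P t).coeff k) (k : ℕ) :
    M.DefGerm t₀ fun t => (R t).coeff k := by
  refine coeff_of_signedCoeff (p := fun f => M.DefGerm t₀ f) defGerm_const
    (fun _ c hf => (defGerm_const c).mul hf) (fun _ _ he hf => hf.congr he) hR (fun k hk => ?_) k
  exact ((defGerm_const _).mul (defGerm_coeff_centered hP hD (n - k))).of_pow_mul
    (h.mono fun t ht => ht k hk)

/-- Differentiable definable roots near a point. -/
theorem _root_.HasLocalGamma.exists_contDiffAt_roots {Γ γ p : ℕ} (h : HasLocalGamma t₀ n P Γ γ)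
    (hp : 0 < p) (hD : ∀ k, M.DefGerm t₀ fun t => (P t).coeff k)
    (hC : ∀ k, ContDiffAt ℝ (p + Γ : ℕ) (fun t => (P t).coeff k) t₀) :
    ∃ r : Fin n → ℝ → ℝ, (∀ i, M.DefGerm t₀ (r i) ∧ ContDiffAt ℝ (p + γ : ℕ) (r i) t₀) ∧
      ∀ᶠ t in 𝓝 t₀, P t = rootPoly fun i => r i t := by
  induction h generalizing p with
  | @split n₁ n₂ P P₁ P₂ Γ₁ γ₁ Γ₂ γ₂ hP hmul hdisj h₁ h₂ ih₁ ih₂ =>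
    have k₁ := h₁.isHyperbolicCurveNear
    have k₂ := h₂.isHyperbolicCurveNear
    have hC' := k₁.contDiffAt_coeff_factor k₂ hmul hdisj (by omega) hC
    have hmul₂ : ∀ᶠ t in 𝓝 t₀, P t = P₂ t * P₁ t := by simpa only [mul_comm] using hmul
    have l₁ := h₁.le
    have l₂ := h₂.le
    -- The factor receives all of the regularity p + max Γ₁ Γ₂. Its roots are then of class p + max
    -- Γ₁ Γ₂ - (Γ₁ - γ₁), which is at least p + γ by the definition of γ as Γ minus the larger
    -- deficit.
    obtain ⟨r₁, hr₁, e₁⟩ := ih₁ (p := p + (max Γ₁ Γ₂ - Γ₁)) (by omega)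
      (defGerm_coeff_factor k₁ k₂ hmul hdisj hD) fun k => (hC' k).1.of_le (by
        exact_mod_cast (by omega))
    obtain ⟨r₂, hr₂, e₂⟩ := ih₂ (p := p + (max Γ₁ Γ₂ - Γ₂)) (by omega)
      (defGerm_coeff_factor k₂ k₁ hmul₂ (fun x hx => hdisj x hx.symm) hD) fun k =>
        (hC' k).2.of_le (by exact_mod_cast (by omega))
    refine ⟨Fin.append r₁ r₂, fun i => ?_, ?_⟩
    · induction i using Fin.addCases with
      | left i =>
        rw [Fin.append_left]
        exact ⟨(hr₁ i).1, (hr₁ i).2.of_le (by exact_mod_cast (by omega))⟩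
      | right i =>
        rw [Fin.append_right]
        exact ⟨(hr₂ i).1, (hr₂ i).2.of_le (by exact_mod_cast (by omega))⟩
    · filter_upwards [hmul, e₁, e₂] with t h1 h2 h3
      rw [h1, h2, h3, ← rootPoly_append]
      congr 1
      ext i
      induction i using Fin.addCases <;> simp
  | @reduce n r P R Γ γ hP hn hroot hmult hR h ih =>
    have hR' : IsReduction t₀ n r P R := hR
    have kR := h.isHyperbolicCurveNear
    have hl := h.le
    obtain ⟨y, hy, e⟩ := ih hp (defGerm_coeff_reduction hR' hP kR hD)
      (hR'.contDiffAt hP kR fun k => by simpa only [add_assoc] using hC k)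
    have hy' : IsLocalParam t₀ n R y :=
      ⟨fun i => contDiffAt_zero_iff_eventually.1 ((hy i).2.of_le (by simp)), e⟩
    refine ⟨_, fun i => ⟨?_, ?_⟩, (hR'.isLocalParam hn.le hP hy').2⟩
    · refine DefGerm.add (f := fun t => signedCoeff n (P t) 1 / n) ?_ (DefGerm.mul ?_ (hy i).1)
      · refine ((defGerm_const ((n : ℝ)⁻¹ * (-1) ^ 1)).mul (hD (n - 1))).congr
          (.of_forall fun t => ?_)
        simp only [signedCoeff]
        ring
      · have h1 : M.Def fun t => (t - t₀) ^ r := ((defFun_coord 0).sub (defFun_const t₀)).pow r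
        exact h1.defGerm t₀
    · refine ContDiffAt.add ((contDiffAt_const.mul ((hC (n - 1)).of_le ?_)).div_const _) ?_
      · have : γ + r ≤ Γ + n * r := by nlinarith
        exact_mod_cast (by omega)
      · rw [← add_assoc]
        exact (hy i).1.contDiffAt_pow_mul (hy i).2 r
  | @flat n P hP hn hroot hmult =>
    have hy := (hP.centered hn.le).isLocalParam_ordRoot
    have hgerm := fun i => defGerm_ordRoot (hP.centered hn.le) (defGerm_coeff_centered hP hD) i
    have hO := (multiplicityAt_eq_top_iff ((hP.centered hn.le).continuousAt_signedCoeff 2)).1 hmult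
    refine ⟨fun i t => signedCoeff n (P t) 1 / n + ordRoot n (centeredCurve n P t) i,
      fun i => ⟨?_, ?_⟩, ?_⟩
    · refine DefGerm.add ?_ (hgerm i)
      refine ((defGerm_const ((n : ℝ)⁻¹ * (-1) ^ 1)).mul (hD (n - 1))).congr
        (.of_forall fun t => ?_)
      simp only [signedCoeff]
      ring
    · refine ContDiffAt.add ((contDiffAt_const.mul ((hC (n - 1)).of_le le_rfl)).div_const _) ?_
      -- A flat root is (t-t₀)^p times a continuous definable germ, hence C^p; no regularity of the
      -- quotient beyond continuity is needed.
      obtain ⟨g, -, hg⟩ := exists_eq_pow_mul_of_isBigO (p := p) (hy.1 i)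
        (hy.isBigO_of_sq hn hP (hO _) i)
      have hg0 : ContDiffAt ℝ (0 : ℕ) g t₀ :=
        contDiffAt_zero_iff_eventually.2 (hg.mono fun t ht => ht.1)
      have hgD : M.DefGerm t₀ g := (hgerm i).of_pow_mul (hg.mono fun t ht => ht.2)
      have := hgD.contDiffAt_pow_mul hg0 p
      rw [Nat.add_zero, ← Nat.zero_add p]
      exact this.congr_of_eventuallyEq (hg.mono fun t ht => ht.2)
    · filter_upwards [hy.2] with t ht
      conv_lhs => rw [centeredCurve_comp (n := n) (P := P) t]
      rw [ht, rootPoly_comp_X_add_C]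
      congr 1
      ext i
      rw [← ht]
      ring
  | @linear P hP =>
    refine ⟨fun _ t => signedCoeff 1 (P t) 1, fun i => ⟨?_, ?_⟩, ?_⟩
    · exact (defGerm_const _).mul (hD 0)
    · exact contDiffAt_const.mul (hC 0)
    · filter_upwards [hP.1] with t ht
      have h := (ordRoot_spec ht).2
      conv_lhs => rw [h]
      congr 1
      ext i
      conv_rhs => rw [h, signedCoeff_rootPoly_one le_rfl]
      rw [Fin.sum_univ_one, Subsingleton.elim i 0]

end OMinimalStructure

/-! ### The coefficients of `monicCurve` -/

section monicCurve
variable {n : ℕ} {a : ℕ → ℝ → ℝ} {t : ℝ}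

theorem monicCurve_monic_natDegree : (monicCurve n a t).Monic ∧ (monicCurve n a t).natDegree = n := by
  have hd : (∑ j ∈ Finset.Icc 1 n, C ((-1) ^ j * a j t) * X ^ (n - j)).degree < (n : WithBot ℕ) := by
    refine (degree_sum_le _ _).trans_lt ((Finset.sup_lt_iff (WithBot.bot_lt_coe n)).2 fun j hj => ?_)
    refine (degree_C_mul_X_pow_le _ _).trans_lt ?_
    have := Finset.mem_Icc.1 hj
    exact Nat.cast_lt.2 (by omega)
  refine ⟨monic_X_pow_add hd, ?_⟩
  rw [monicCurve, add_comm]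
  refine natDegree_eq_of_degree_eq_some ?_
  rw [degree_add_eq_right_of_degree_lt (by rwa [degree_X_pow]), degree_X_pow]

theorem coeff_monicCurve (j : ℕ) : (monicCurve n a t).coeff j = (if j = n then 1 else 0) +
    ∑ k ∈ Finset.Icc 1 n, (-1) ^ k * (if j = n - k then 1 else 0) * a k t := by
  rw [monicCurve, coeff_add, coeff_X_pow, finsetSum_coeff]
  congr 1
  refine Finset.sum_congr rfl fun k _ => ?_
  rw [coeff_C_mul, coeff_X_pow]
  ring

theorem coeff_monicCurve_induction {p : (ℝ → ℝ) → Prop} (hc : ∀ c : ℝ, p fun _ => c)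
    (hadd : ∀ f g, p f → p g → p fun a => f a + g a)
    (hmul : ∀ f g, p f → p g → p fun a => f a * g a) (h : ∀ k ∈ Finset.Icc 1 n, p (a k)) (j : ℕ) :
    p fun t => (monicCurve n a t).coeff j := by
  simp only [coeff_monicCurve]
  refine hadd _ _ (hc _) ?_
  have : ∀ s ⊆ Finset.Icc 1 n,
      p fun t => ∑ k ∈ s, (-1) ^ k * (if j = n - k then 1 else 0) * a k t := by
    intro s
    induction s using Finset.induction_on with
    | empty => intro _; simpa using hc 0
    | insert k s hk ih =>
      intro hs
      simp only [Finset.sum_insert hk]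
      exact hadd _ _ (hmul _ _ (hc _) (h k (hs (Finset.mem_insert_self _ _))))
        (ih ((Finset.subset_insert _ _).trans hs))
  exact this _ subset_rfl

theorem signedCoeff_monicCurve {k : ℕ} (hk : k ∈ Finset.Icc 1 n) :
    signedCoeff n (monicCurve n a t) k = a k t := by
  have hk' := Finset.mem_Icc.1 hk
  rw [signedCoeff, coeff_monicCurve, if_neg (by omega), Finset.sum_eq_single k, if_pos rfl, zero_add,
    mul_one, ← mul_assoc, ← mul_pow]
  · simp
  · intro j hj hjk
    have hj' := Finset.mem_Icc.1 hj
    rw [if_neg (by omega)]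
    simp
  · exact fun h => (h hk).elim

end monicCurve

/-! ### Existence of the local integers -/

/-- All finite orders of contact of roots of `P` at `t₀` are at most `m`. -/
def ContactLE (t₀ : ℝ) (n : ℕ) (P : ℝ → ℝ[X]) (m : ℕ∞) : Prop :=
  ∀ y, IsLocalParam t₀ n P y → ∀ i j, vanishingOrder t₀ (fun t => y i t - y j t) = ⊤ ∨
    vanishingOrder t₀ (fun t => y i t - y j t) ≤ m

section existence
variable {n n₁ n₂ r p : ℕ} {t₀ : ℝ} {P P₁ P₂ R : ℝ → ℝ[X]} {m : ℕ∞} {y : Fin n → ℝ → ℝ}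

theorem ContactLE.factor (h : ContactLE t₀ (n₁ + n₂) P m) (k₂ : IsHyperbolicCurveNear t₀ n₂ P₂)
    (hmul : ∀ᶠ t in 𝓝 t₀, P t = P₁ t * P₂ t) : ContactLE t₀ n₁ P₁ m := fun y hy i j => by
  have := h _ (hy.append k₂.isLocalParam_ordRoot hmul) (Fin.castAdd n₂ i) (Fin.castAdd n₂ j)
  simpa using this

/-- Differences of roots of P are (t-t₀)^r times those of R, so contact orders only decrease in
passing to R, and infinite ones stay infinite. -/
theorem ContactLE.reduction (h : ContactLE t₀ n P m) (hR : IsReduction t₀ n r P R) (hn : 1 ≤ n)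
    (hP : IsHyperbolicCurveNear t₀ n P) : ContactLE t₀ n R m := fun y hy i j => by
  have hg : ∀ᶠ t in 𝓝 t₀, ContinuousAt (fun t => y i t - y j t) t := by
    filter_upwards [hy.1 i, hy.1 j] with t h1 h2 using h1.sub h2
  have hf : ∀ᶠ t in 𝓝 t₀, ContinuousAt (fun t => (t - t₀) ^ r * (y i t - y j t)) t := by
    filter_upwards [hg] with t h1 using ((continuousAt_id.sub continuousAt_const).pow r).mul h1
  have h' := h _ (hR.isLocalParam hn hP hy) i j
  have e : (fun t => signedCoeff n (P t) 1 / n + (t - t₀) ^ r * y i t -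
      (signedCoeff n (P t) 1 / n + (t - t₀) ^ r * y j t)) =
      fun t => (t - t₀) ^ r * (y i t - y j t) := by ext t; ring
  rw [e] at h'
  refine h'.imp (fun h' => ?_) fun h' => le_trans ?_ h'
  · rw [vanishingOrder_eq_top_iff hf.self_of_nhds] at h'
    refine (vanishingOrder_eq_top_iff hg.self_of_nhds).2 fun p => ?_
    obtain ⟨u, -, hu⟩ := exists_eq_pow_mul_of_isBigO hf (h' (p + r + 1))
    refine isBigO_of_eq_pow_mul hu.self_of_nhds.1 (eventuallyEq_of_pow_mul (j := r)
      (f := fun t => y i t - y j t) (g := fun t => (t - t₀) ^ p * u t)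
      hg.self_of_nhds (continuousAt_pow_mul_of hu.self_of_nhds.1) ?_)
    filter_upwards [hu] with t ht
    rw [ht.2]; ring
  · refine ENat.forall_natCast_le_iff_le.1 fun p hp => ?_
    rw [le_vanishingOrder_iff hg.self_of_nhds] at hp
    rw [le_vanishingOrder_iff hf.self_of_nhds]
    have h1 : (fun t => (t - t₀) ^ r) =O[𝓝 t₀] fun _ => (1 : ℝ) :=
      (show ContinuousAt (fun t => (t - t₀) ^ r) t₀ by fun_prop).isBigO_one ℝ
    simpa using h1.mul hp

theorem IsLocalParam.signedCoeff_isBigO (hy : IsLocalParam t₀ n P y)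
    (h : ∀ i, y i =O[𝓝 t₀] fun t => (t - t₀) ^ p) {k : ℕ} (hk : k ≤ n) :
    (fun t => signedCoeff n (P t) k) =O[𝓝 t₀] fun t => (t - t₀) ^ (k * p) := by
  have h1 : (fun t => ∑ s ∈ Finset.powersetCard k (Finset.univ : Finset (Fin n)), ∏ i ∈ s, y i t)
      =O[𝓝 t₀] fun t => (t - t₀) ^ (k * p) := by
    refine IsBigO.fun_sum fun s hs => ?_
    refine (IsBigO.finsetProd fun i _ => h i).congr_right fun t => ?_
    rw [Finset.prod_const, (Finset.mem_powersetCard.1 hs).2, ← pow_mul, mul_comm]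
  refine h1.congr' ?_ .rfl
  filter_upwards [hy.2] with t ht
  rw [ht, signedCoeff_rootPoly _ hk, Finset.esymm_map_val]

/-- When the roots have mean zero, each is the average of its differences to all roots. -/
theorem IsLocalParam.isBigO_of_sub (hn : 1 ≤ n) (hy : IsLocalParam t₀ n P y)
    (h1 : ∀ᶠ t in 𝓝 t₀, signedCoeff n (P t) 1 = 0)
    (h : ∀ i j, (fun t => y i t - y j t) =O[𝓝 t₀] fun t => (t - t₀) ^ p) (i : Fin n) :
    y i =O[𝓝 t₀] fun t => (t - t₀) ^ p := by
  have h2 : (fun t => (n : ℝ)⁻¹ * ∑ j, (y i t - y j t)) =O[𝓝 t₀] fun t => (t - t₀) ^ p :=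
    (IsBigO.fun_sum fun j _ => h i j).const_mul_left _
  refine h2.congr' ?_ .rfl
  filter_upwards [h1, hy.2] with t h3 h4
  rw [h4, signedCoeff_rootPoly_one hn] at h3
  have : (n : ℝ) ≠ 0 := by positivity
  rw [Finset.sum_sub_distrib, h3]
  simp [this]

theorem contactDegree_succ (hn : 2 ≤ n) :
    n * (n + 1) / 2 - 1 = ((n - 1) * (n - 1 + 1) / 2 - 1) + n := by
  obtain ⟨k, rfl⟩ := Nat.exists_eq_add_of_le' hn
  obtain ⟨c, hc⟩ := Nat.even_mul_succ_self (k + 1)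
  have : (k + 2) * (k + 2 + 1) = c + c + 2 * (k + 2) := by rw [← hc]; ring
  rw [this, show k + 2 - 1 = k + 1 from rfl, hc]
  have : 1 ≤ c := by nlinarith
  omega

theorem contactDegree_mono (h : n₁ ≤ n₂) : n₁ * (n₁ + 1) / 2 - 1 ≤ n₂ * (n₂ + 1) / 2 - 1 :=
  Nat.sub_le_sub_right (Nat.div_le_div_right (Nat.mul_le_mul h (by omega))) 1

theorem exists_hasLocalGamma_of_not_coincident (hn : 2 ≤ n) (hP : IsHyperbolicCurveNear t₀ n P)
    (hm : ContactLE t₀ n P m)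
    (hC : ∀ j : ℕ, (j : ℕ∞) ≤ ((n - 1) * (n - 1 + 1) / 2 - 1 : ℕ) * m + 2 →
      ∀ k, ContDiffAt ℝ j (fun t => (P t).coeff k) t₀) (hne : ∀ c, P t₀ ≠ (X - C c) ^ n)
    (ih : ∀ n' < n, 1 ≤ n' → ∀ Q : ℝ → ℝ[X], IsHyperbolicCurveNear t₀ n' Q →
      ContactLE t₀ n' Q m → (∀ j : ℕ, (j : ℕ∞) ≤ (n' * (n' + 1) / 2 - 1 : ℕ) * m + 2 →
        ∀ k, ContDiffAt ℝ j (fun t => (Q t).coeff k) t₀) → ∃ Γ γ, HasLocalGamma t₀ n' Q Γ γ) :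
    ∃ Γ γ, HasLocalGamma t₀ n P Γ γ := by
  classical
  have hy := hP.isLocalParam_ordRoot
  set y : Fin n → ℝ → ℝ := fun i t => ordRoot n (P t) i
  -- The roots meeting the first one at t₀ form one factor, the rest the other; both have degree
  -- between 1 and n - 1.
  set S : Finset (Fin n) := Finset.univ.filter fun i => y i t₀ = y ⟨0, by omega⟩ t₀ with hS
  have k₁ := hy.subProd S
  have k₂ := hy.subProd Sᶜ
  have hcard : S.card + Sᶜ.card = n := by rw [Finset.card_add_card_compl]; simp
  have c₁ : 1 ≤ S.card := Finset.card_pos.2 ⟨⟨0, by omega⟩, by simp [hS]⟩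
  have c₂ : 1 ≤ Sᶜ.card := by
    by_contra hc
    have h0 : Sᶜ = ∅ := Finset.card_eq_zero.1 (by omega)
    refine hne (y ⟨0, by omega⟩ t₀) ?_
    rw [hy.2.self_of_nhds, ← rootPoly_const]
    congr 1
    ext i
    have : i ∈ S := by rw [← Finset.notMem_compl, h0]; simp
    exact (Finset.mem_filter.1 this).2
  have hmul : ∀ᶠ t in 𝓝 t₀, P t = subProd y S t * subProd y Sᶜ t := by
    filter_upwards [hy.2] with t ht
    rw [ht, subProd, subProd, Finset.prod_mul_prod_compl]; rfl
  have hmul₂ : ∀ᶠ t in 𝓝 t₀, P t = subProd y Sᶜ t * subProd y S t := by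
    simpa only [mul_comm] using hmul
  have hdisj : ∀ x : ℝ, ¬ ((subProd y S t₀).IsRoot x ∧ (subProd y Sᶜ t₀).IsRoot x) := by
    rintro x ⟨h1, h2⟩
    rw [subProd_isRoot] at h1 h2
    obtain ⟨i, hi, rfl⟩ := h1
    obtain ⟨j, hj, hij⟩ := h2
    refine Finset.mem_compl.1 hj ?_
    rw [hS, Finset.mem_filter] at hi ⊢
    exact ⟨Finset.mem_univ _, hij.trans hi.2⟩
  -- The maximum with 1 is there because smoothness of factors needs at least one derivative, which
  -- the summand 2 always provides.
  have hdeg : ∀ n' : ℕ, n' < n → ∀ j : ℕ, (j : ℕ∞) ≤ (n' * (n' + 1) / 2 - 1 : ℕ) * m + 2 →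
      ((max j 1 : ℕ) : ℕ∞) ≤ ((n - 1) * (n - 1 + 1) / 2 - 1 : ℕ) * m + 2 := fun n' hn' j hj => by
    refine (max_cases j 1).elim (fun h => ?_) fun h => ?_ <;> rw [h.1]
    · refine hj.trans ?_
      have h1 : ((n' * (n' + 1) / 2 - 1 : ℕ) : ℕ∞) ≤ ((n - 1) * (n - 1 + 1) / 2 - 1 : ℕ) := by
        exact_mod_cast contactDegree_mono (by omega)
      gcongr
    · exact le_trans (by exact_mod_cast one_le_two) (le_add_self : (2 : ℕ∞) ≤ _)
  have hfac := fun j hj => k₁.contDiffAt_coeff_factor k₂ hmul hdisj (N := max j 1) (by omega) (hC _ hj)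
  obtain ⟨Γ₁, γ₁, h₁⟩ := ih S.card (by omega) c₁ (subProd y S) k₁
    ((hcard.symm ▸ hm : ContactLE t₀ (S.card + Sᶜ.card) P m).factor k₂ hmul)
    fun j hj k => (hfac j (hdeg _ (by omega) j hj) k).1.of_le (by exact_mod_cast le_max_left _ _)
  obtain ⟨Γ₂, γ₂, h₂⟩ := ih Sᶜ.card (by omega) c₂ (subProd y Sᶜ) k₂
    (((by rw [add_comm, hcard]; exact hm) : ContactLE t₀ (Sᶜ.card + S.card) P m).factor k₁ hmul₂)
    fun j hj k => (hfac j (hdeg _ (by omega) j hj) k).2.of_le (by exact_mod_cast le_max_left _ _)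
  have := HasLocalGamma.split (k₁.mul k₂ hmul) hmul hdisj h₁ h₂
  rw [hcard] at this
  exact ⟨_, _, this⟩

/-- A nonpositive function has even order of vanishing. -/
theorem even_of_pow_mul_nonpos {f g : ℝ → ℝ} {k : ℕ} (hg : ContinuousAt g t₀) (hg0 : g t₀ ≠ 0)
    (h : ∀ᶠ t in 𝓝 t₀, f t = (t - t₀) ^ k * g t) (hf : ∀ᶠ t in 𝓝 t₀, f t ≤ 0) : Even k := by
  by_contra hk
  rw [Nat.not_even_iff_odd] at hk
  -- Reflection in t₀ changes the sign of an odd power, so g(t)g(2t₀-t) ≤ 0 for t ≠ t₀ near t₀,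
  -- against its limit g(t₀)² > 0.
  have hr : Tendsto (fun t => 2 * t₀ - t) (𝓝 t₀) (𝓝 t₀) :=
    Continuous.tendsto' (by fun_prop) _ _ (by ring)
  have hlim : Tendsto (fun t => - (g t * g (2 * t₀ - t))) (𝓝[≠] t₀) (𝓝 (-(g t₀ * g t₀))) :=
    ((hg.tendsto.mul (hg.tendsto.comp hr)).neg).mono_left nhdsWithin_le_nhds
  have hpos : ∀ᶠ t in 𝓝[≠] t₀, 0 ≤ - (g t * g (2 * t₀ - t)) := by
    have := ((h.and hf).and (hr.eventually (h.and hf))).filter_mono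
      (nhdsWithin_le_nhds (s := {t₀}ᶜ))
    filter_upwards [this, self_mem_nhdsWithin] with t ⟨⟨h1, h2⟩, h3, h4⟩ hne
    have hprod := mul_nonneg_of_nonpos_of_nonpos h2 h4
    rw [h1, h3, show 2 * t₀ - t - t₀ = -(t - t₀) by ring, hk.neg_pow] at hprod
    have hs : 0 < ((t - t₀) ^ k) ^ 2 := by
      have : (t - t₀) ^ k ≠ 0 := pow_ne_zero _ (sub_ne_zero.2 hne)
      positivity
    by_contra! hc
    nlinarith
  have := ge_of_tendsto hlim hpos
  have h2 : 0 < g t₀ * g t₀ := mul_self_pos.2 hg0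
  linarith

theorem IsHyperbolicCurveNear.signedCoeff_two_nonpos (hn : 2 ≤ n)
    (hP : IsHyperbolicCurveNear t₀ n P) :
    ∀ᶠ t in 𝓝 t₀, signedCoeff n (centeredCurve n P t) 2 ≤ 0 := by
  filter_upwards [(hP.centered (by omega)).isLocalParam_ordRoot.2,
    hP.signedCoeff_centered_one (by omega)] with t h1 h2
  rw [h1, signedCoeff_rootPoly_one (by omega)] at h2
  have h3 := sum_sq_eq hn fun i => ordRoot n (centeredCurve n P t) i
  rw [h2, ← h1] at h3
  have : 0 ≤ ∑ i, ordRoot n (centeredCurve n P t) i ^ 2 := Finset.sum_nonneg fun i _ => sq_nonneg _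
  linarith

/-- A reduced curve exists as soon as the centered roots are `O((t - t₀)^r)`. -/
theorem exists_isReduction (hn : 1 ≤ n) (hP : IsHyperbolicCurveNear t₀ n P)
    (hy : IsLocalParam t₀ n (centeredCurve n P) y)
    (h : ∀ i, y i =O[𝓝 t₀] fun t => (t - t₀) ^ r)
    (hC : ∀ k, ContDiffAt ℝ (n * r : ℕ) (fun t => (P t).coeff k) t₀) :
    ∃ R, IsHyperbolicCurveNear t₀ n R ∧ IsReduction t₀ n r P R := by
  have h1 : ∀ k, ∃ g : ℝ → ℝ, k ∈ Finset.Icc 1 n → ContDiffAt ℝ (0 : ℕ) g t₀ ∧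
      ∀ᶠ t in 𝓝 t₀, signedCoeff n (centeredCurve n P t) k = (t - t₀) ^ (k * r) * g t := fun k => by
    by_cases hk : k ∈ Finset.Icc 1 n
    · have hk' := (Finset.mem_Icc.1 hk).2
      have hC' : ContDiffAt ℝ (0 + k * r : ℕ) (fun t => signedCoeff n (centeredCurve n P t) k) t₀ := by
        refine contDiffAt_const.mul ((hP.contDiffAt_centered hC (n - k)).of_le ?_)
        rw [zero_add]
        exact_mod_cast Nat.mul_le_mul_right r hk'
      obtain ⟨g, hg⟩ := hC'.exists_eq_pow_mul (hy.signedCoeff_isBigO h hk')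
      exact ⟨g, fun _ => hg⟩
    · exact ⟨0, fun h => (hk h).elim⟩
  choose b hb using h1
  -- Off t₀ this curve is real-rooted, its roots being the centered roots divided by (t-t₀)^r; at t₀
  -- it is a limit of real-rooted polynomials.
  have hred : IsReduction t₀ n r P (monicCurve n b) := by
    refine (Filter.eventually_all_finset _).2 fun k hk => ?_
    filter_upwards [(hb k hk).2] with t ht
    rw [ht, signedCoeff_monicCurve hk]
  refine ⟨monicCurve n b, isHyperbolicCurveNear_of_punctured ?_ fun j => ?_, hred⟩
  · filter_upwards [hred.filter_mono nhdsWithin_le_nhds, hy.2.filter_mono nhdsWithin_le_nhds,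
      (hP.centered hn).1.filter_mono nhdsWithin_le_nhds, self_mem_nhdsWithin] with t h1 h2 h3 hne
    have hs : (t - t₀) ^ r ≠ 0 := pow_ne_zero _ (sub_ne_zero.2 hne)
    have : monicCurve n b t = rootPoly fun i => ((t - t₀) ^ r)⁻¹ * y i t := by
      refine eq_of_signedCoeff_eq monicCurve_monic_natDegree.1 monicCurve_monic_natDegree.2
        (rootPoly_monic _) (by simp [rootPoly_natDegree]) fun k hk => ?_
      rw [signedCoeff_scale _ _ (Finset.mem_Icc.1 hk).2, ← h2, h1 k hk, mul_comm k r, pow_mul,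
        ← mul_assoc, ← mul_pow, inv_mul_cancel₀ hs, one_pow, one_mul]
    exact ⟨monicCurve_monic_natDegree.1, monicCurve_monic_natDegree.2, this ▸ rootPoly_splits _⟩
  · refine coeff_monicCurve_induction (p := fun f => ∀ᶠ t in 𝓝 t₀, ContinuousAt f t)
      (fun c => .of_forall fun _ => continuousAt_const)
      (fun f g hf hg => by filter_upwards [hf, hg] with t h1 h2 using h1.add h2)
      (fun f g hf hg => by filter_upwards [hf, hg] with t h1 h2 using h1.mul h2)
      (fun k hk => contDiffAt_zero_iff_eventually.1 (hb k hk).1) j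

/-- Induction on the degree. When all roots coincide, a₂ is either flat or of exact order 2r with r
≤ m. A reduction uses at most nm derivatives, leaves d(n-1)m + 2 of them, and produces a curve whose
roots no longer all coincide, so it splits into lower degrees. -/
theorem exists_hasLocalGamma (hn : 1 ≤ n) (hP : IsHyperbolicCurveNear t₀ n P)
    (hm : ContactLE t₀ n P m) (hC : ∀ j : ℕ, (j : ℕ∞) ≤ (n * (n + 1) / 2 - 1 : ℕ) * m + 2 →
      ∀ k, ContDiffAt ℝ j (fun t => (P t).coeff k) t₀) : ∃ Γ γ, HasLocalGamma t₀ n P Γ γ := by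
  induction n using Nat.strong_induction_on generalizing P with
  | _ n ih =>
  obtain rfl | hn2 : n = 1 ∨ 2 ≤ n := by omega
  · exact ⟨0, 0, .linear hP⟩
  have hd := contactDegree_succ hn2
  have ih' := fun n' h h' Q => ih n' h (P := Q) h'
  by_cases hroot : ∃ c, P t₀ = (X - C c) ^ n
  swap
  · refine exists_hasLocalGamma_of_not_coincident hn2 hP hm (fun j hj => hC j (hj.trans ?_))
      (not_exists.1 hroot) ih'
    have h1 : (((n - 1) * (n - 1 + 1) / 2 - 1 : ℕ) : ℕ∞) ≤ (n * (n + 1) / 2 - 1 : ℕ) := by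
      exact_mod_cast contactDegree_mono (Nat.sub_le _ _)
    gcongr
  have hP' := hP.centered hn
  have hy := hP'.isLocalParam_ordRoot
  set y : Fin n → ℝ → ℝ := fun i t => ordRoot n (centeredCurve n P t) i
  have hone := hP.signedCoeff_centered_one hn
  have hcont2 := hP'.continuousAt_signedCoeff 2
  have hC2 : ∀ j : ℕ, (j : ℕ∞) ≤ (n * (n + 1) / 2 - 1 : ℕ) * m + 2 →
      ContDiffAt ℝ j (fun t => signedCoeff n (centeredCurve n P t) 2) t₀ := fun j hj =>
    contDiffAt_const.mul (hP.contDiffAt_centered (hC j hj) (n - 2))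
  have hcontact : ∀ i j, vanishingOrder t₀ (fun t => y i t - y j t) = ⊤ ∨
      vanishingOrder t₀ (fun t => y i t - y j t) ≤ m := fun i j => by
    have h0 : IsReduction t₀ n 0 P (centeredCurve n P) := .of_forall fun t k _ => by simp
    exact hm.reduction h0 hn hP y hy i j
  have hyc : ∀ i j, ContinuousAt (fun t => y i t - y j t) t₀ := fun i j =>
    (hy.1 i).self_of_nhds.sub (hy.1 j).self_of_nhds
  by_cases hflat : ∀ j : ℕ, (j : ℕ∞) ≤ (n * (n + 1) / 2 - 1 : ℕ) * m + 2 →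
    (fun t => signedCoeff n (centeredCurve n P t) 2) =O[𝓝 t₀] fun t => (t - t₀) ^ j
  · refine ⟨0, 0, .flat hP (by omega) hroot ((multiplicityAt_eq_top_iff hcont2).2 ?_)⟩
    have hyO : ∀ q : ℕ, ∀ i j, (fun t => y i t - y j t) =O[𝓝 t₀] fun t => (t - t₀) ^ q := by
      intro q i j
      by_cases hq : ((2 * q : ℕ) : ℕ∞) ≤ (n * (n + 1) / 2 - 1 : ℕ) * m + 2
      · exact (hy.isBigO_of_sq hn2 hP (hflat _ hq) i).sub (hy.isBigO_of_sq hn2 hP (hflat _ hq) j)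
      -- Only finitely many orders are visible if m is finite. But 2(m+1) ≤ d(n)m + 2, since d(n) ≥
      -- 2, so the contact orders are at least m + 1 and therefore infinite. This is what the
      -- summand 2 in the regularity is for.
      · induction m using ENat.recTopCoe with
        | top =>
          refine (hq ?_).elim
          rw [ENat.mul_top (by exact_mod_cast (by omega)), top_add]
          exact le_top
        | coe m =>
          have h2 : ((2 * (m + 1) : ℕ) : ℕ∞) ≤ (n * (n + 1) / 2 - 1 : ℕ) * (m : ℕ∞) + 2 := by
            have : 2 * m ≤ (n * (n + 1) / 2 - 1) * m := Nat.mul_le_mul_right _ (by omega)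
            exact_mod_cast (by omega)
          have h3 : (fun t => y i t - y j t) =O[𝓝 t₀] fun t => (t - t₀) ^ (m + 1) :=
            (hy.isBigO_of_sq hn2 hP (hflat _ h2) i).sub (hy.isBigO_of_sq hn2 hP (hflat _ h2) j)
          rw [← le_vanishingOrder_iff (hyc i j)] at h3
          rcases hcontact i j with h4 | h4
          · exact (vanishingOrder_eq_top_iff (hyc i j)).1 h4 q
          · have := h3.trans h4
            norm_cast at this
            omega
    intro q
    have h1 := hy.signedCoeff_isBigO (hy.isBigO_of_sub hn hone (hyO q)) hn2
    simp only [mul_comm 2 q, pow_mul, pow_two] at h1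
    refine h1.trans ?_
    have h2 : (fun t => (t - t₀) ^ q) =O[𝓝 t₀] fun _ => (1 : ℝ) :=
      (show ContinuousAt (fun t => (t - t₀) ^ q) t₀ by fun_prop).isBigO_one ℝ
    simpa using h2.mul (isBigO_refl (fun t => (t - t₀) ^ q) (𝓝 t₀))
  push Not at hflat
  obtain ⟨N, hN, hNO⟩ := hflat
  obtain ho | ⟨k, hk, g, hg, hg0, hgk⟩ := (hC2 N hN).isLittleO_or_exists
  · exact (hNO ho.isBigO).elim
  have hgc : ∀ᶠ t in 𝓝 t₀, ContinuousAt g t :=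
    contDiffAt_zero_iff_eventually.1 (hg.of_le (by simp))
  obtain ⟨r, rfl⟩ := (even_of_pow_mul_nonpos hgc.self_of_nhds hg0 hgk
    (hP.signedCoeff_two_nonpos hn2)).two_dvd
  have hyr := hy.isBigO_of_sq hn2 hP (isBigO_of_eq_pow_mul hgc.self_of_nhds hgk)
  -- Otherwise all contact orders exceed m and are infinite, so the centered roots are
  -- O((t-t₀)^{r+1}) and a₂ vanishes to order higher than 2r.
  have hrm : (r : ℕ∞) ≤ m := by
    by_contra hc
    have hyO : ∀ i j, (fun t => y i t - y j t) =O[𝓝 t₀] fun t => (t - t₀) ^ (r + 1) := by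
      intro i j
      have h3 := (le_vanishingOrder_iff (hyc i j)).2 ((hyr i).sub (hyr j))
      rcases hcontact i j with h4 | h4
      · exact (vanishingOrder_eq_top_iff (hyc i j)).1 h4 _
      · exact (hc (h3.trans h4)).elim
    have h1 := hy.signedCoeff_isBigO (hy.isBigO_of_sub hn hone hyO) hn2
    have := isBigO_pow_le_of_mul hgc.self_of_nhds hg0 (h1.congr' hgk .rfl)
    omega
  have hdeg : ∀ j : ℕ, (j : ℕ∞) ≤ ((n - 1) * (n - 1 + 1) / 2 - 1 : ℕ) * m + 2 →
      ((j + n * r : ℕ) : ℕ∞) ≤ (n * (n + 1) / 2 - 1 : ℕ) * m + 2 := fun j hj => by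
    rw [hd]
    push_cast
    calc (j : ℕ∞) + n * r ≤ (((n - 1) * (n - 1 + 1) / 2 - 1 : ℕ) * m + 2) + n * m := by gcongr
      _ = _ := by push_cast; ring
  obtain ⟨R, hRh, hR⟩ := exists_isReduction hn hP hy hyr (hC _ (by simpa using hdeg 0 (by simp)))
  -- The a₂ of R at t₀ is g(t₀) ≠ 0, whereas for coinciding roots of mean zero it would vanish.
  have hne : ∀ c, R t₀ ≠ (X - C c) ^ n := fun c hc => by
    have h1 := (hR.signedCoeff_one hn hP hRh).self_of_nhds
    have h2 := centeredCurve_eq_of_coincident hn hc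
    rw [centeredCurve_of_signedCoeff_one h1] at h2
    have h3 := eventuallyEq_of_pow_mul (j := 2 * r) (g := fun t => signedCoeff n (R t) 2)
      hgc.self_of_nhds (hRh.continuousAt_signedCoeff 2).self_of_nhds (by
        filter_upwards [hgk, hR] with t h3 h4
        rw [← h3, h4 2 (Finset.mem_Icc.2 ⟨by omega, hn2⟩)])
    refine hg0 (h3.self_of_nhds.trans ?_)
    beta_reduce
    rw [h2, signedCoeff, coeff_X_pow, if_neg (by omega), mul_zero]
  obtain ⟨Γ, γ, h⟩ := exists_hasLocalGamma_of_not_coincident hn2 hRh (hm.reduction hR hn hP)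
    (fun j hj => hR.contDiffAt hP hRh (hC _ (hdeg j hj))) hne ih'
  exact ⟨_, _, .reduce hP (by omega) hroot (multiplicityAt_pow_mul hgc hg0 hgk) hR h⟩

end existence

/-! ### Comparison of root parameterizations -/

section rigid
variable {n : ℕ} {t₀ : ℝ} {P : ℝ → ℝ[X]} {y z l : Fin n → ℝ → ℝ}

theorem IsLocalParam.eventually (h : IsLocalParam t₀ n P y) :
    ∀ᶠ t in 𝓝 t₀, IsLocalParam t n P y := by
  filter_upwards [h.eventually_continuousAt.eventually_nhds, h.2.eventually_nhds] with t h1 h2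
  exact ⟨fun i => h1.mono fun s hs => hs i, h2⟩

theorem IsLocalParam.continuousAt (h : IsLocalParam t₀ n P y) (i : Fin n) : ContinuousAt (y i) t₀ :=
  (h.1 i).self_of_nhds

theorem IsLocalParam.of_eventuallyEq (h : IsLocalParam t₀ n P y) (he : ∀ i, z i =ᶠ[𝓝 t₀] y i) :
    IsLocalParam t₀ n P z := by
  refine ⟨fun i => ?_, ?_⟩
  · filter_upwards [h.1 i, (he i).eventually_nhds] with t h1 h2 using h1.congr (h2.mono fun _ h => h.symm)
  · filter_upwards [h.2, eventually_all.2 he] with t h1 h2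
    rw [h1]
    simp only [h2]

theorem IsLocalParam.perm (h : IsLocalParam t₀ n P y) (σ : Equiv.Perm (Fin n)) :
    IsLocalParam t₀ n P fun i => y (σ i) :=
  ⟨fun i => h.1 _, h.2.mono fun t ht => by rw [ht, ← rootPoly_comp_equiv σ]⟩

/-- Near `t₀`, the roots of `P` do not split: continuous roots with the same value at `t₀` agree. -/
def IsRigidAt (t₀ : ℝ) (n : ℕ) (P : ℝ → ℝ[X]) : Prop :=
  ∀ y z : Fin n → ℝ → ℝ, IsLocalParam t₀ n P y → IsLocalParam t₀ n P z →
    ∀ i k, y i t₀ = z k t₀ → y i =ᶠ[𝓝 t₀] z k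

/-- It suffices to test one parameterization l. A continuous root starting at the value l k t₀
cannot meet an l k' with a different value nearby, and the l k' with the same value agree with l k.
-/
theorem IsLocalParam.isRigidAt (h : IsLocalParam t₀ n P l)
    (hl : ∀ i k, l i t₀ = l k t₀ → l i =ᶠ[𝓝 t₀] l k) : IsRigidAt t₀ n P := by
  have key : ∀ y : Fin n → ℝ → ℝ, IsLocalParam t₀ n P y → ∀ i k, y i t₀ = l k t₀ →
      y i =ᶠ[𝓝 t₀] l k := by
    intro y hy i k hik
    have h1 : ∀ᶠ t in 𝓝 t₀, ∀ k', l k' t = y i t → l k' t = l k t := by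
      refine eventually_all.2 fun k' => ?_
      by_cases hk : l k' t₀ = l k t₀
      · exact (hl k' k hk).mono fun t ht _ => ht
      · have : ∀ᶠ t in 𝓝 t₀, l k' t - y i t ≠ 0 :=
          ((h.continuousAt k').sub (hy.continuousAt i)).eventually_ne
            (sub_ne_zero.2 (hik ▸ hk))
        exact this.mono fun t ht h' => (ht (sub_eq_zero.2 h')).elim
    filter_upwards [h1, h.2, hy.2] with t h1 h2 h3
    have : (rootPoly fun i => l i t).IsRoot (y i t) := by
      rw [← h2, h3]; exact rootPoly_isRoot.2 ⟨i, rfl⟩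
    obtain ⟨k', hk'⟩ := rootPoly_isRoot.1 this
    rw [← hk', h1 k' hk']
  intro y z hy hz i k hik
  have : (rootPoly fun i => l i t₀).IsRoot (y i t₀) := by
    rw [← h.2.self_of_nhds, hy.2.self_of_nhds]; exact rootPoly_isRoot.2 ⟨i, rfl⟩
  obtain ⟨k', hk'⟩ := rootPoly_isRoot.1 this
  exact (key y hy i k' hk'.symm).trans (key z hz k k' (hik ▸ hk'.symm)).symm

/-- Match the two tuples at one point. By rigidity, two roots agreeing at a point agree near it, and
by continuity roots that differ keep differing; connectedness then propagates the matching. -/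
theorem IsLocalParam.eqOn_of_isRigidAt {J : Set ℝ} (hJ : IsPreconnected J)
    (hr : ∀ t ∈ J, IsRigidAt t n P) (hy : ∀ t ∈ J, IsLocalParam t n P y)
    (hz : ∀ t ∈ J, IsLocalParam t n P z) {t₁ : ℝ} (ht₁ : t₁ ∈ J) :
    ∃ σ : Equiv.Perm (Fin n), ∀ t ∈ J, ∀ i, y i t = z (σ i) t := by
  obtain ⟨σ, hσ⟩ := exists_perm_of_rootPoly_eq
    ((hy t₁ ht₁).2.self_of_nhds.symm.trans (hz t₁ ht₁).2.self_of_nhds)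
  refine ⟨σ, fun t ht i => ?_⟩
  have hsub : J ⊆ {t | ∀ᶠ s in 𝓝 t, y i s = z (σ i) s} := by
    refine hJ.subset_left_of_subset_union (v := {t | ∀ᶠ s in 𝓝 t, y i s ≠ z (σ i) s})
      isOpen_setOfPred_eventually_nhds isOpen_setOfPred_eventually_nhds ?_ (fun t ht => ?_)
      ⟨t₁, ht₁, hr t₁ ht₁ y z (hy t₁ ht₁) (hz t₁ ht₁) _ _ (hσ i)⟩
    · exact Set.disjoint_left.2 fun t h1 h2 =>
        h2.self_of_nhds (h1.self_of_nhds : y i t = z (σ i) t)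
    · by_cases h : y i t = z (σ i) t
      · exact Or.inl (hr t ht y z (hy t ht) (hz t ht) _ _ h)
      · refine Or.inr ?_
        have : ∀ᶠ s in 𝓝 t, y i s - z (σ i) s ≠ 0 :=
          (((hy t ht).continuousAt i).sub ((hz t ht).continuousAt _)).eventually_ne (sub_ne_zero.2 h)
        exact this.mono fun s hs => sub_ne_zero.1 hs
  exact (hsub ht).self_of_nhds

/-- Continuous roots on both sides of an isolated splitting point may be permuted on the right so
that they match a given local parameterization. -/
theorem IsLocalParam.exists_perm_glue (hy : IsLocalParam t₀ n P y) (hz : IsLocalParam t₀ n P z)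
    (hr : ∀ᶠ t in 𝓝[≠] t₀, IsRigidAt t n P) : ∃ τ ρ : Equiv.Perm (Fin n), ∀ i, ∀ᶠ t in 𝓝 t₀,
      (t ≤ t₀ → y i t = z (ρ i) t) ∧ (t₀ < t → y (τ i) t = z (ρ i) t) := by
  rw [eventually_nhdsWithin_iff] at hr
  obtain ⟨ε, hε, hball⟩ := Metric.eventually_nhds_iff_ball.1 ((hy.eventually.and hz.eventually).and hr)
  have hl : ∀ t ∈ Set.Ioo (t₀ - ε) t₀, t ∈ Metric.ball t₀ ε ∧ t ≠ t₀ := fun t ht => by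
    rw [Real.ball_eq_Ioo]; exact ⟨⟨ht.1, by linarith [ht.2]⟩, ht.2.ne⟩
  have hr : ∀ t ∈ Set.Ioo t₀ (t₀ + ε), t ∈ Metric.ball t₀ ε ∧ t ≠ t₀ := fun t ht => by
    rw [Real.ball_eq_Ioo]; exact ⟨⟨by linarith [ht.1], ht.2⟩, ht.1.ne'⟩
  obtain ⟨σ, hσ⟩ := IsLocalParam.eqOn_of_isRigidAt isPreconnected_Ioo
    (fun t ht => (hball t (hl t ht).1).2 (hl t ht).2) (fun t ht => (hball t (hl t ht).1).1.1)
    (fun t ht => (hball t (hl t ht).1).1.2)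
    (show t₀ - ε / 2 ∈ Set.Ioo (t₀ - ε) t₀ by constructor <;> linarith)
  obtain ⟨σ', hσ'⟩ := IsLocalParam.eqOn_of_isRigidAt isPreconnected_Ioo
    (fun t ht => (hball t (hr t ht).1).2 (hr t ht).2) (fun t ht => (hball t (hr t ht).1).1.1)
    (fun t ht => (hball t (hr t ht).1).1.2)
    (show t₀ + ε / 2 ∈ Set.Ioo t₀ (t₀ + ε) by constructor <;> linarith)
  refine ⟨σ.trans σ'.symm, σ, fun i => ?_⟩
  have h0 : y i t₀ = z (σ i) t₀ := by
    refine tendsto_nhds_unique ((hy.continuousAt i).tendsto.mono_left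
      (nhdsWithin_le_nhds (s := Set.Iio t₀))) ?_
    refine ((hz.continuousAt (σ i)).tendsto.mono_left nhdsWithin_le_nhds).congr' ?_
    filter_upwards [Ioo_mem_nhdsLT (show t₀ - ε < t₀ by linarith)] with t ht using (hσ t ht i).symm
  filter_upwards [Ioo_mem_nhds (show t₀ - ε < t₀ by linarith) (show t₀ < t₀ + ε by linarith)]
    with t ht
  refine ⟨fun h => ?_, fun h => ?_⟩
  · rcases h.eq_or_lt with rfl | h
    · exact h0
    · exact hσ t ⟨ht.1, h⟩ i
  · rw [hσ' t ⟨h, ht.2⟩]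
    simp

/-- A positive Γ yields two roots of finite positive contact order, which meet at t₀ without
agreeing near it. -/
theorem HasLocalGamma.eq_zero_of_isRigidAt {Γ γ : ℕ} (h : HasLocalGamma t₀ n P Γ γ)
    (hr : IsRigidAt t₀ n P) : Γ = 0 := by
  refine h.exists_contact.resolve_right ?_
  rintro ⟨y, hy, i, j, c, hc, -, u, hu, hu0, hij⟩
  have h0 : y i t₀ = y j t₀ := by
    have := hij.self_of_nhds
    rwa [sub_self, zero_pow (by omega), zero_mul, sub_eq_zero] at this
  have h1 := eventuallyEq_of_pow_mul (j := c) (g := fun _ => 0) hu continuousAt_const (by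
    filter_upwards [hij, hr y y hy hy i j h0] with t h1 h2
    rw [← h1, h2]; simp)
  exact hu0 h1.self_of_nhds

theorem HasLocalGamma.le_of_contactLE {Γ γ : ℕ} {m : ℕ∞} (h : HasLocalGamma t₀ n P Γ γ)
    (hm : ContactLE t₀ n P m) : (Γ : ℕ∞) ≤ (n * (n + 1) / 2 - 1 : ℕ) * m := by
  have hn := h.pos
  obtain rfl | hn2 : n = 1 ∨ 2 ≤ n := by omega
  · rw [((HasLocalGamma.linear h.isHyperbolicCurveNear).unique h).1]
    simp
  rcases h.exists_contact with rfl | ⟨y, hy, i, j, c, -, hΓ, u, hu, hu0, hij⟩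
  · simp
  have hc : (c : ℕ∞) ≤ m := by
    have := hm y hy i j
    rw [vanishingOrder_pow_mul hu hu0 hij] at this
    exact this.resolve_left (ENat.natCast_ne_top _)
  calc (Γ : ℕ∞) ≤ (n * c : ℕ) := by exact_mod_cast hΓ
    _ = n * c := by push_cast; rfl
    _ ≤ (n * (n + 1) / 2 - 1 : ℕ) * m := by
      have : (n : ℕ∞) ≤ (n * (n + 1) / 2 - 1 : ℕ) := by
        exact_mod_cast (by have := contactDegree_succ hn2; omega)
      gcongr

end rigid

/-! ### Extension of local parameterizations and orders of contact -/

section contact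
variable {n : ℕ} {t₀ : ℝ} {P : ℝ → ℝ[X]} {I : Set ℝ} {y l : Fin n → ℝ → ℝ}

/-- Contact orders over I are defined by parameterizations on all of I, whereas the recursion only
produces roots near t₀. This extension bridges the two. -/
theorem IsLocalParam.exists_isRootParam (hI : IsOpen I) (ht₀ : t₀ ∈ I)
    (hl : ∀ t ∈ I, IsLocalParam t n P l) (hy : IsLocalParam t₀ n P y) :
    ∃ r : Fin n → ℝ → ℝ, IsRootParam I n P r ∧ (∀ i, ContinuousOn (r i) I) ∧
      ∀ i, r i =ᶠ[𝓝 t₀] y i := by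
  obtain ⟨ε, hε, hball⟩ := Metric.eventually_nhds_iff_ball.1
    (hy.eventually.and (hI.mem_nhds ht₀))
  set a := t₀ - ε / 2 with ha
  set b := t₀ + ε / 2 with hb
  have hab : a ≤ b := by linarith
  have hmem : ∀ t ∈ Set.Icc a b, IsLocalParam t n P y ∧ t ∈ I := fun t ht => by
    refine hball t ?_
    rw [Real.ball_eq_Ioo]
    exact ⟨by linarith [ht.1], by linarith [ht.2]⟩
  have haI := hmem a ⟨le_rfl, hab⟩
  have hbI := hmem b ⟨hab, le_rfl⟩
  obtain ⟨σ, hσ⟩ := exists_perm_of_rootPoly_eq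
    (haI.1.2.self_of_nhds.symm.trans (hl a haI.2).2.self_of_nhds)
  obtain ⟨τ, hτ⟩ := exists_perm_of_rootPoly_eq
    (hbI.1.2.self_of_nhds.symm.trans (hl b hbI.2).2.self_of_nhds)
  -- The clamped arguments make each summand vary only on its own piece: l (σ i) left of a, y i on
  -- [a, b], l (τ i) right of b. Continuity is thereby automatic, the permutations having been
  -- chosen to match at a and b.
  set r : Fin n → ℝ → ℝ := fun i t => (l (σ i) (min t a) - l (σ i) a) + y i (max a (min t b)) +
    (l (τ i) (max t b) - l (τ i) b)
  have r₁ : ∀ t ≤ a, ∀ i, r i t = l (σ i) t := fun t ht i => by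
    simp only [r, min_eq_left ht, min_eq_left (ht.trans hab), max_eq_left ht,
      max_eq_right (ht.trans hab), hσ]
    ring
  have r₂ : ∀ t ∈ Set.Icc a b, ∀ i, r i t = y i t := fun t ht i => by
    simp only [r, min_eq_right ht.1, min_eq_left ht.2, max_eq_right ht.1, max_eq_right ht.2]
    ring
  have r₃ : ∀ t, b ≤ t → ∀ i, r i t = l (τ i) t := fun t ht i => by
    simp only [r, min_eq_right ht, min_eq_right (hab.trans ht), max_eq_right hab, max_eq_left ht, hτ]
    ring
  have hlc : ∀ i, ContinuousOn (l i) I := fun i t ht =>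
    ((hl t ht).continuousAt i).continuousWithinAt
  have hyc : ∀ i, ContinuousOn (y i) (Set.Icc a b) := fun i t ht =>
    ((hmem t ht).1.continuousAt i).continuousWithinAt
  refine ⟨r, fun t ht => ?_, fun i => ?_, fun i => ?_⟩
  · change P t = rootPoly fun i => r i t
    rcases le_total t a with h | h
    · simp only [r₁ t h]
      rw [(hl t ht).2.self_of_nhds, ← rootPoly_comp_equiv σ]
    rcases le_total t b with h' | h'
    · simp only [r₂ t ⟨h, h'⟩]
      exact (hmem t ⟨h, h'⟩).1.2.self_of_nhds
    · simp only [r₃ t h']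
      rw [(hl t ht).2.self_of_nhds, ← rootPoly_comp_equiv τ]
  · refine ContinuousOn.add (ContinuousOn.add (ContinuousOn.sub ?_ continuousOn_const) ?_)
      (ContinuousOn.sub ?_ continuousOn_const)
    · refine (hlc _).comp (by fun_prop) fun t ht => ?_
      rcases min_choice t a with h | h <;> rw [h]
      exacts [ht, haI.2]
    · exact (hyc i).comp (by fun_prop) fun t ht => ⟨le_max_left _ _, max_le hab (min_le_right _ _)⟩
    · refine (hlc _).comp (by fun_prop) fun t ht => ?_
      rcases max_choice t b with h | h <;> rw [h]
      exacts [ht, hbI.2]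
  · filter_upwards [Icc_mem_nhds (show a < t₀ by linarith) (show t₀ < b by linarith)] with t ht
    exact r₂ t ht i

theorem contactLE_maxContactOrder (hI : IsOpen I) (ht₀ : t₀ ∈ I)
    (h : ∀ t ∈ I, IsHyperbolicCurveNear t n P) : ContactLE t₀ n P (maxContactOrder I n P) := by
  intro y hy i j
  obtain ⟨r, hr, hc, he⟩ := hy.exists_isRootParam hI ht₀ (fun t ht => (h t ht).isLocalParam_ordRoot)
  refine or_iff_not_imp_left.2 fun hne => le_sSup ⟨hne, t₀, ht₀, r, hr, hc, i, j, ?_⟩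
  exact (vanishingOrder_congr ((he i).sub (he j))).symm

end contact

/-! ### Globally defined differentiable roots -/

namespace OMinimalStructure
variable {M : OMinimalStructure} {n : ℕ} {P : ℝ → ℝ[X]} {I : Set ℝ}

open Classical in
/-- Definable roots, continuous everywhere, can be rearranged so as to become as differentiable as
the local roots. -/
theorem exists_contDiffAt_roots {K : ℕ} {E : Finset ℝ}
    (hE : ∀ t ∈ I, t ∉ E → IsRigidAt t n P) (hI : IsOpen I)
    (hs : ∀ t ∈ I, ∃ s, IsLocalParam t n P s ∧ ∀ i, ContDiffAt ℝ K (s i) t)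
    {l : Fin n → ℝ → ℝ} (hl : ∀ t ∈ I, IsLocalParam t n P l) (hlD : ∀ i, M.Def (l i)) :
    ∃ r : Fin n → ℝ → ℝ, (∀ i, M.Def (r i)) ∧ (∀ t ∈ I, IsLocalParam t n P r) ∧
      ∀ t ∈ I, ∀ i, ContDiffAt ℝ K (r i) t := by
  -- F collects the exceptional points already repaired. Treating a further point e only relabels
  -- the roots to its right, which keeps the regularity obtained elsewhere.
  suffices h : ∀ F : Finset ℝ, ∃ r : Fin n → ℝ → ℝ, (∀ i, M.Def (r i)) ∧
      (∀ t ∈ I, IsLocalParam t n P r) ∧ ∀ t ∈ I, t ∉ E ∨ t ∈ F → ∀ i, ContDiffAt ℝ K (r i) t by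
    obtain ⟨r, h1, h2, h3⟩ := h E
    exact ⟨r, h1, h2, fun t ht => h3 t ht (or_comm.1 (Classical.em _))⟩
  intro F
  induction F using Finset.induction_on with
  | empty =>
    refine ⟨l, hlD, hl, fun t ht htE i => ?_⟩
    obtain ⟨s, hs, hsC⟩ := hs t ht
    have hi : (rootPoly fun i => s i t).IsRoot (l i t) := by
      rw [← hs.2.self_of_nhds, (hl t ht).2.self_of_nhds]; exact rootPoly_isRoot.2 ⟨i, rfl⟩
    obtain ⟨k, hk⟩ := rootPoly_isRoot.1 hi
    exact (hsC k).congr_of_eventuallyEq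
      (hE t ht (htE.resolve_right (by simp)) l s (hl t ht) hs i k hk.symm)
  | insert e F _ ih =>
    obtain ⟨r, hrD, hr, hrC⟩ := ih
    by_cases heI : e ∈ I
    swap
    · refine ⟨r, hrD, hr, fun t ht h => hrC t ht (h.imp_right fun h => ?_)⟩
      exact Finset.mem_of_mem_insert_of_ne h fun h' => heI (h' ▸ ht)
    obtain ⟨s, hs, hsC⟩ := hs e heI
    have hrig : ∀ᶠ t in 𝓝[≠] e, IsRigidAt t n P := by
      have h1 : ∀ᶠ t in 𝓝[≠] e, t ∉ E := by
        have : (↑(E.erase e) : Set ℝ)ᶜ ∈ 𝓝 e :=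
          (Finset.finite_toSet _).isClosed.isOpen_compl.mem_nhds (by simp)
        filter_upwards [mem_nhdsWithin_of_mem_nhds this, self_mem_nhdsWithin] with t h1 h2 h3
        exact h1 (Finset.mem_coe.2 (Finset.mem_erase.2 ⟨h2, h3⟩))
      filter_upwards [h1, mem_nhdsWithin_of_mem_nhds (hI.mem_nhds heI)] with t h1 h2 using hE t h2 h1
    obtain ⟨τ, ρ, hτρ⟩ := (hr e heI).exists_perm_glue hs hrig
    set r' : Fin n → ℝ → ℝ := fun i t => if t ≤ e then r i t else r (τ i) t with hr'
    have hlt : ∀ t < e, ∀ i, r' i =ᶠ[𝓝 t] r i := fun t ht i => by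
      filter_upwards [gt_mem_nhds ht] with s hs using if_pos hs.le
    have hgt : ∀ t, e < t → ∀ i, r' i =ᶠ[𝓝 t] r (τ i) := fun t ht i => by
      filter_upwards [lt_mem_nhds ht] with s hs using if_neg (not_le.2 hs)
    have heq : ∀ i, r' i =ᶠ[𝓝 e] s (ρ i) := fun i => by
      filter_upwards [hτρ i] with t ht
      simp only [r']
      split_ifs with h
      exacts [ht.1 h, ht.2 (not_le.1 h)]
    refine ⟨r', fun i => ?_, fun t ht => ?_, fun t ht h i => ?_⟩
    · exact Def.ite (p := fun t => t ≤ e) ((defFun_coord 0).le (defFun_const e)) (hrD _) (hrD _)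
    · rcases lt_trichotomy t e with h | rfl | h
      · exact (hr t ht).of_eventuallyEq (hlt t h)
      · exact (hs.perm ρ).of_eventuallyEq heq
      · exact ((hr t ht).perm τ).of_eventuallyEq (hgt t h)
    · rcases lt_trichotomy t e with h' | rfl | h'
      · exact (hrC t ht (h.imp_right fun h => Finset.mem_of_mem_insert_of_ne h h'.ne)
          i).congr_of_eventuallyEq (hlt t h' i)
      · exact (hsC _).congr_of_eventuallyEq (heq i)
      · exact (hrC t ht (h.imp_right fun h => Finset.mem_of_mem_insert_of_ne h h'.ne')
          _).congr_of_eventuallyEq (hgt t h' i)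

variable {a : ℕ → ℝ → ℝ}

open Classical in
theorem def_coeff_monicCurve (hI : M.Def₁ (· ∈ I))
    (ha : ∀ j ∈ Finset.Icc 1 n, M.DefinableOn I (a j)) (k : ℕ) :
    M.Def fun t => (monicCurve n (fun j t => if t ∈ I then a j t else 0) t).coeff k :=
  coeff_monicCurve_induction (p := fun f => M.Def f) def_const (fun _ _ hf hg => hf.add hg)
    (fun _ _ hf hg => hf.mul hg) (fun j hj => (ha j hj).indicator hI) k

open Classical in
theorem monicCurve_indicator {t : ℝ} (ht : t ∈ I) :
    monicCurve n (fun j t => if t ∈ I then a j t else 0) t = monicCurve n a t := by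
  simp [monicCurve, ht]

theorem defGerm_coeff_monicCurve (hI : IsOpen I) (hI' : I.OrdConnected)
    (ha : ∀ j ∈ Finset.Icc 1 n, M.DefinableOn I (a j)) {t : ℝ} (ht : t ∈ I) (k : ℕ) :
    M.DefGerm t fun t => (monicCurve n a t).coeff k := by
  classical
  refine ((def_coeff_monicCurve (def₁_of_isOpen hI hI') ha k).defGerm t).congr ?_
  filter_upwards [hI.mem_nhds ht] with s hs
  rw [monicCurve_indicator hs]

/-- A hyperbolic curve with definable coefficients has continuous definable roots, which split only
at finitely many points. -/
theorem exists_def_roots (hI : IsOpen I) (hI' : I.OrdConnected)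
    (ha : ∀ j ∈ Finset.Icc 1 n, M.DefinableOn I (a j))
    (h : ∀ t ∈ I, IsHyperbolicCurveNear t n (monicCurve n a)) :
    ∃ l : Fin n → ℝ → ℝ, (∀ i, M.Def (l i)) ∧ (∀ t ∈ I, IsLocalParam t n (monicCurve n a) l) ∧
      ∃ E : Finset ℝ, ∀ t ∈ I, t ∉ E → IsRigidAt t n (monicCurve n a) := by
  classical
  have hU := def₁_of_isOpen (M := M) hI hI'
  set l : Fin n → ℝ → ℝ := fun i t => if t ∈ I then ordRoot n (monicCurve n a t) i else 0 with hl
  have hlD : ∀ i, M.Def (l i) := fun i => by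
    refine def_ordRoot hU (fun k _ => def_coeff_monicCurve hU ha k) (fun t ht => ⟨(h t ht).1.self_of_nhds,
      fun k _ => ?_⟩) i
    rw [monicCurve_indicator ht]
  have hlP : ∀ t ∈ I, IsLocalParam t n (monicCurve n a) l := fun t ht => by
    refine (h t ht).isLocalParam_ordRoot.of_eventuallyEq fun i => ?_
    filter_upwards [hI.mem_nhds ht] with s hs using if_pos hs
  -- The coincidence set of two definable roots has finite boundary; outside the union of these
  -- boundaries no two roots split.
  have hF : ∀ q : Fin n × Fin n, ∃ F : Finset ℝ, ∀ t ∉ F,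
      (∀ᶠ s in 𝓝 t, l q.1 s = l q.2 s) ∨ ∀ᶠ s in 𝓝 t, ¬ l q.1 s = l q.2 s := fun q =>
    Def₁.exists_finset (DefFun.eq (hlD q.1) (hlD q.2))
  choose F hF using hF
  refine ⟨l, hlD, hlP, Finset.univ.biUnion F, fun t ht htE => (hlP t ht).isRigidAt fun i k hik => ?_⟩
  have : t ∉ F (i, k) := fun h' => htE (Finset.mem_biUnion.2 ⟨_, Finset.mem_univ _, h'⟩)
  exact (hF (i, k) t this).resolve_right fun h' => h'.self_of_nhds hik

end OMinimalStructure

/-! ### The global integers -/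

section hasGamma
variable {n : ℕ} {a : ℕ → ℝ → ℝ} {I : Set ℝ} {P : ℝ → ℝ[X]} {Γ γ : ℕ}

theorem HasGamma.isHyperbolicCurveNear (h : HasGamma I n P Γ γ) {t : ℝ} (ht : t ∈ I) :
    IsHyperbolicCurveNear t n P := by
  obtain ⟨Γl, γl, h, -⟩ := h
  exact (h t ht).isHyperbolicCurveNear

theorem HasGamma.unique {Γ' γ' : ℕ} (h : HasGamma I n P Γ γ) (h' : HasGamma I n P Γ' γ') :
    Γ' = Γ ∧ γ' = γ := by
  obtain ⟨Γl, γl, h1, h2, D, h3, rfl⟩ := h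
  obtain ⟨Γl', γl', h1', h2', D', h3', rfl⟩ := h'
  have e1 : Γl' '' I = Γl '' I := Set.image_congr fun t ht => ((h1 t ht).unique (h1' t ht)).1
  have e2 : (fun t => Γl' t - γl' t) '' I = (fun t => Γl t - γl t) '' I :=
    Set.image_congr fun t ht => by
      rw [((h1 t ht).unique (h1' t ht)).1, ((h1 t ht).unique (h1' t ht)).2]
  rw [e1] at h2'
  rw [e2] at h3'
  obtain rfl := h2.unique h2'
  obtain rfl := h3.unique h3'
  exact ⟨rfl, rfl⟩

theorem HasGamma.le (h : HasGamma I n P Γ γ) : γ ≤ Γ := by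
  obtain ⟨Γl, γl, -, -, D, -, rfl⟩ := h
  exact Nat.sub_le _ _

theorem IsLUB.mem_of_nat {S : Set ℕ} {b : ℕ} (h : IsLUB S b) (hS : S.Nonempty) : b ∈ S := by
  rw [← h.csSup_eq hS]
  exact Nat.sSup_mem hS ⟨b, h.1⟩

theorem HasGamma.le_maxContactOrder (h : HasGamma I n P Γ γ) (hI : IsOpen I) (hne : I.Nonempty) :
    (Γ : ℕ∞) ≤ (n * (n + 1) / 2 - 1 : ℕ) * maxContactOrder I n P := by
  have hh := fun t ht => h.isHyperbolicCurveNear (t := t) ht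
  obtain ⟨Γl, γl, h1, h2, -⟩ := h
  obtain ⟨t, ht, rfl⟩ := h2.mem_of_nat (hne.image _)
  exact (h1 t ht).le_of_contactLE (contactLE_maxContactOrder hI ht hh)

theorem HasGamma.exists_local (h : HasGamma I n P Γ γ) {t : ℝ} (ht : t ∈ I) :
    ∃ Γ₁ γ₁, HasLocalGamma t n P Γ₁ γ₁ ∧ Γ₁ ≤ Γ ∧ γ + (Γ₁ - γ₁) ≤ Γ := by
  obtain ⟨Γl, γl, h1, h2, D, h3, rfl⟩ := h
  have hD : D ≤ Γ := h3.2 (by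
    rintro _ ⟨s, hs, rfl⟩
    exact (Nat.sub_le _ _).trans (h2.1 ⟨s, hs, rfl⟩))
  have h4 : Γl t - γl t ≤ D := h3.1 ⟨t, ht, rfl⟩
  exact ⟨_, _, h1 t ht, h2.1 ⟨t, ht, rfl⟩, by omega⟩

/-- Γ_t vanishes at rigid points, so only the finitely many points of E matter and the suprema are
finite. -/
theorem exists_hasGamma_of_finite (h : ∀ t ∈ I, ∃ Γ γ, HasLocalGamma t n P Γ γ) (hne : I.Nonempty)
    {E : Finset ℝ} (hE : ∀ t ∈ I, t ∉ E → IsRigidAt t n P) : ∃ Γ γ, HasGamma I n P Γ γ := by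
  have h' : ∀ t, ∃ Γ γ, t ∈ I → HasLocalGamma t n P Γ γ := fun t => by
    by_cases ht : t ∈ I
    · obtain ⟨Γ, γ, h⟩ := h t ht
      exact ⟨Γ, γ, fun _ => h⟩
    · exact ⟨0, 0, fun h => (ht h).elim⟩
  choose Γl γl hΓ using h'
  have hb : ∃ B, ∀ t ∈ I, Γl t ≤ B := by
    refine ⟨∑ t ∈ E, Γl t, fun t ht => ?_⟩
    by_cases htE : t ∈ E
    · exact Finset.single_le_sum (fun _ _ => Nat.zero_le _) htE
    · rw [(hΓ t ht).eq_zero_of_isRigidAt (hE t ht htE)]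
      exact Nat.zero_le _
  obtain ⟨B, hB⟩ := hb
  refine ⟨_, _, Γl, γl, hΓ, isLUB_csSup (hne.image _) ⟨B, ?_⟩, _,
    isLUB_csSup (hne.image _) ⟨B, ?_⟩, rfl⟩
  · rintro _ ⟨t, ht, rfl⟩
    exact hB t ht
  · rintro _ ⟨t, ht, rfl⟩
    exact (Nat.sub_le _ _).trans (hB t ht)

theorem contDiffAt_coeff_monicCurve {N : WithTop ℕ∞} {t : ℝ}
    (h : ∀ j ∈ Finset.Icc 1 n, ContDiffAt ℝ N (a j) t) (k : ℕ) :
    ContDiffAt ℝ N (fun t => (monicCurve n a t).coeff k) t :=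
  coeff_monicCurve_induction (p := fun f => ContDiffAt ℝ N f t) (fun _ => contDiffAt_const)
    (fun _ _ hf hg => hf.add hg) (fun _ _ hf hg => hf.mul hg) h k

theorem isHyperbolicCurveNear_monicCurve (hI : IsOpen I) (hs : ∀ t ∈ I, (monicCurve n a t).Splits)
    (hc : ∀ j ∈ Finset.Icc 1 n, ContinuousOn (a j) I) {t : ℝ} (ht : t ∈ I) :
    IsHyperbolicCurveNear t n (monicCurve n a) := by
  refine ⟨?_, fun k => ?_⟩
  · filter_upwards [hI.mem_nhds ht] with s hs'
    exact ⟨monicCurve_monic_natDegree.1, monicCurve_monic_natDegree.2, hs s hs'⟩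
  · filter_upwards [hI.mem_nhds ht] with s hs'
    exact coeff_monicCurve_induction (p := fun f => ContinuousAt f s) (fun _ => continuousAt_const)
      (fun _ _ hf hg => hf.add hg) (fun _ _ hf hg => hf.mul hg)
      (fun j hj => (hc j hj).continuousAt (hI.mem_nhds hs')) k

theorem exists_hasGamma (M : OMinimalStructure) (hI : IsOpen I) (hI' : I.OrdConnected)
    (hne : I.Nonempty) (hn : 1 ≤ n) (ha : ∀ j ∈ Finset.Icc 1 n, M.DefinableOn I (a j))
    (hs : ∀ t ∈ I, (monicCurve n a t).Splits)
    (hC : ∀ j ∈ Finset.Icc 1 n, ContDiffOn ℝ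
      (((n * (n + 1) / 2 - 1 : ℕ) * maxContactOrder I n (monicCurve n a) + 2 : ℕ∞) :
        WithTop ℕ∞) (a j) I) : ∃ Γ γ : ℕ, HasGamma I n (monicCurve n a) Γ γ := by
  have hh := fun t ht => isHyperbolicCurveNear_monicCurve hI hs
    (fun j hj => (hC j hj).continuousOn) (t := t) ht
  obtain ⟨l, -, -, E, hE⟩ := M.exists_def_roots hI hI' ha hh
  refine exists_hasGamma_of_finite (fun t ht => ?_) hne hE
  refine exists_hasLocalGamma hn (hh t ht) (contactLE_maxContactOrder hI ht hh) fun j hj k => ?_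
  exact contDiffAt_coeff_monicCurve (fun i hi => ((hC i hi).contDiffAt (hI.mem_nhds ht)).of_le
    (by exact_mod_cast hj)) k

theorem HasGamma.exists_contDiffOn_roots (M : OMinimalStructure)
    (h : HasGamma I n (monicCurve n a) Γ γ) (hI : IsOpen I) (hI' : I.OrdConnected)
    (ha : ∀ j ∈ Finset.Icc 1 n, M.DefinableOn I (a j)) {p : ℕ} (hp : 0 < p)
    (hC : ∀ j ∈ Finset.Icc 1 n, ContDiffOn ℝ ((p + Γ : ℕ) : WithTop ℕ∞) (a j) I) :
    ∃ r : Fin n → ℝ → ℝ, IsRootParam I n (monicCurve n a) r ∧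
      ∀ i, M.DefinableOn I (r i) ∧ ContDiffOn ℝ ((p + γ : ℕ) : WithTop ℕ∞) (r i) I := by
  obtain ⟨l, hlD, hl, E, hE⟩ := M.exists_def_roots hI hI' ha fun t ht => h.isHyperbolicCurveNear ht
  have hs : ∀ t ∈ I, ∃ s, IsLocalParam t n (monicCurve n a) s ∧
      ∀ i, ContDiffAt ℝ (p + γ : ℕ) (s i) t := fun t ht => by
    obtain ⟨Γ₁, γ₁, hloc, h1, h2⟩ := h.exists_local ht
    have h3 := hloc.le
    -- The surplus Γ - Γ₁ is added to p: the local roots have class p + Γ - (Γ₁ - γ₁), at least p +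
    -- γ.
    obtain ⟨s, hs, hsP⟩ := hloc.exists_contDiffAt_roots (M := M) (p := p + (Γ - Γ₁)) (by omega)
      (M.defGerm_coeff_monicCurve hI hI' ha ht) (contDiffAt_coeff_monicCurve fun i hi =>
        ((hC i hi).contDiffAt (hI.mem_nhds ht)).of_le (by exact_mod_cast (by omega)))
    exact ⟨s, ⟨fun i => contDiffAt_zero_iff_eventually.1 ((hs i).2.of_le (by simp)), hsP⟩,
      fun i => (hs i).2.of_le (by exact_mod_cast (by omega))⟩
  obtain ⟨r, hrD, hr, hrC⟩ := M.exists_contDiffAt_roots hE hI hs hl hlD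
  exact ⟨r, fun t ht => (hr t ht).2.self_of_nhds, fun i =>
    ⟨(hrD i).definableOn (OMinimalStructure.def₁_of_isOpen hI hI'),
      fun t ht => (hrC t ht i).contDiffWithinAt⟩⟩

end hasGamma

/-! ### Curves with distinct roots -/

section distinct
variable {n : ℕ} {t₀ : ℝ} {P : ℝ → ℝ[X]} {y : Fin n → ℝ → ℝ}

/-- Distinct roots can be split off one at a time into linear factors, which contribute nothing. -/
theorem IsLocalParam.hasLocalGamma_of_injective (hn : 1 ≤ n) (hy : IsLocalParam t₀ n P y)
    (h : Function.Injective fun i => y i t₀) : HasLocalGamma t₀ n P 0 0 := by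
  induction n, hn using Nat.le_induction generalizing P with
  | base => exact .linear hy.isHyperbolicCurveNear
  | succ n hn ih =>
    have h₁ : IsLocalParam t₀ n (fun t => rootPoly fun i : Fin n => y i.castSucc t)
        fun i => y i.castSucc := ⟨fun i => hy.1 _, .of_forall fun t => rfl⟩
    have h₂ : IsLocalParam t₀ 1 (fun t => rootPoly fun _ : Fin 1 => y (Fin.last n) t)
        fun _ => y (Fin.last n) := ⟨fun i => hy.1 _, .of_forall fun t => rfl⟩
    have hmul : ∀ᶠ t in 𝓝 t₀, P t = (rootPoly fun i : Fin n => y i.castSucc t) *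
        rootPoly fun _ : Fin 1 => y (Fin.last n) t := by
      filter_upwards [hy.2] with t ht
      rw [ht]
      simp [rootPoly, Fin.prod_univ_castSucc]
    refine HasLocalGamma.split (Γ₁ := 0) (γ₁ := 0) (Γ₂ := 0) (γ₂ := 0)
      hy.isHyperbolicCurveNear hmul ?_
      (ih h₁ fun i j hij => Fin.castSucc_injective n (h hij)) (.linear h₂.isHyperbolicCurveNear)
    rintro x ⟨h1, h2⟩
    obtain ⟨i, rfl⟩ := rootPoly_isRoot.1 h1
    obtain ⟨j, hj⟩ := rootPoly_isRoot.1 h2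
    exact Fin.castSucc_ne_last i (h hj).symm

theorem IsLocalParam.isRigidAt_of_injective (hy : IsLocalParam t₀ n P y)
    (h : Function.Injective fun i => y i t₀) : IsRigidAt t₀ n P :=
  hy.isRigidAt fun i k hik => by rw [h hik]

theorem IsLocalParam.injective (hy : IsLocalParam t₀ n P y) {x : Fin n → ℝ}
    (hx : Function.Injective x) (h : P t₀ = rootPoly x) : Function.Injective fun i => y i t₀ := by
  obtain ⟨σ, hσ⟩ := exists_perm_of_rootPoly_eq (hy.2.self_of_nhds.symm.trans h)
  intro i j hij
  exact σ.injective (hx (by rw [← hσ, ← hσ]; exact hij))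

theorem eq_rootPoly_of_injective {Q : ℝ[X]} (hm : Q.Monic) (hn : Q.natDegree = n) {x : Fin n → ℝ}
    (hx : Function.Injective x) (h : ∀ i, Q.IsRoot (x i)) : Q = rootPoly x := by
  refine eq_of_monic_of_dvd_of_natDegree_le (rootPoly_monic x) hm ?_ (by simp [rootPoly_natDegree, hn])
  exact Finset.prod_dvd_of_coprime ((pairwise_coprime_X_sub_C hx).set_pairwise _)
    fun i _ => dvd_iff_isRoot.2 (h i)

end distinct

/-! ### The function `halfPower` -/

section halfPower
variable {q : ℕ} {t : ℝ}

theorem halfPower_eq (q : ℕ) (t : ℝ) : halfPower q t = t ^ q * max t 0 := by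
  rw [halfPower]
  split_ifs with h
  · rw [max_eq_left h, pow_succ]
  · rw [max_eq_right (not_le.1 h).le, mul_zero]

theorem halfPower_add (q k : ℕ) (t : ℝ) : halfPower (q + k) t = t ^ k * halfPower q t := by
  rw [halfPower_eq, halfPower_eq, pow_add]; ring

theorem continuous_halfPower (q : ℕ) : Continuous (halfPower q) := by
  rw [show halfPower q = fun t => t ^ q * max t 0 from funext (halfPower_eq q)]
  fun_prop

theorem halfPower_zero (q : ℕ) : halfPower q 0 = 0 := by simp [halfPower_eq]

theorem halfPower_of_nonpos (h : t ≤ 0) : halfPower q t = 0 := by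
  rw [halfPower_eq, max_eq_right h, mul_zero]

theorem halfPower_of_nonneg (h : 0 ≤ t) : halfPower q t = t ^ (q + 1) := if_pos h

theorem hasDerivAt_halfPower (q : ℕ) (t : ℝ) :
    HasDerivAt (halfPower (q + 1)) ((q + 2) * halfPower q t) t := by
  rcases lt_trichotomy t 0 with h | rfl | h
  · rw [halfPower_of_nonpos h.le, mul_zero]
    refine (hasDerivAt_const t (0 : ℝ)).congr_of_eventuallyEq ?_
    filter_upwards [gt_mem_nhds h] with s hs using halfPower_of_nonpos hs.le
  · rw [halfPower_zero, mul_zero, hasDerivAt_iff_isLittleO]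
    simp only [halfPower_zero, sub_zero, smul_zero]
    have h1 : halfPower q =o[𝓝 0] fun _ => (1 : ℝ) := by
      rw [isLittleO_one_iff]
      simpa [halfPower_zero] using (continuous_halfPower q).tendsto 0
    refine ((isBigO_refl (fun t : ℝ => t) (𝓝 0)).mul_isLittleO h1).congr (fun t => ?_)
      fun t => mul_one t
    rw [halfPower_add, pow_one]
  · have h1 : HasDerivAt (fun s : ℝ => s ^ (q + 2)) ((q + 2) * halfPower q t) t := by
      rw [halfPower_of_nonneg h.le]
      exact_mod_cast hasDerivAt_pow (q + 2) t
    refine h1.congr_of_eventuallyEq ?_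
    filter_upwards [lt_mem_nhds h] with s hs using halfPower_of_nonneg hs.le

theorem deriv_halfPower (q : ℕ) : deriv (halfPower (q + 1)) = fun t => (q + 2) * halfPower q t :=
  funext fun t => (hasDerivAt_halfPower q t).deriv

theorem contDiff_halfPower (q : ℕ) : ContDiff ℝ q (halfPower q) := by
  induction q with
  | zero => exact contDiff_zero.2 (continuous_halfPower 0)
  | succ q ih =>
    rw [Nat.cast_add_one, contDiff_succ_iff_deriv]
    refine ⟨fun t => (hasDerivAt_halfPower q t).differentiableAt, fun h => ?_, ?_⟩
    · exact absurd h (by simp)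
    · rw [deriv_halfPower]
      exact contDiff_const.mul ih

theorem locallyLipschitz_const_mul {f : ℝ → ℝ} (hf : LocallyLipschitz f) (c : ℝ) :
    LocallyLipschitz fun t => c * f t :=
  (ContDiff.locallyLipschitz (𝕂 := ℝ) (f := fun t : ℝ => c * t) (by fun_prop)).comp hf

theorem locallyLipschitz_iteratedDeriv_halfPower (q : ℕ) :
    LocallyLipschitz (iteratedDeriv q (halfPower q)) := by
  induction q with
  | zero =>
    rw [iteratedDeriv_zero, show halfPower 0 = fun t => max (id t) 0 from
      funext fun t => by simp [halfPower_eq]]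
    exact ((LipschitzWith.id (α := ℝ)).max_const 0).locallyLipschitz
  | succ q ih =>
    rw [iteratedDeriv_succ', deriv_halfPower]
    rw [show iteratedDeriv q (fun t => ((q : ℝ) + 2) * halfPower q t) =
      fun t => ((q : ℝ) + 2) * iteratedDeriv q (halfPower q) t from
      funext fun t => iteratedDeriv_const_mul_field _ _]
    exact locallyLipschitz_const_mul ih _

theorem cubicCoeff_two (q : ℕ) : cubicCoeff q 2 = fun t => 2 * halfPower q t - t ^ 2 := by
  ext t; simp [cubicCoeff]

theorem cubicCoeff_of_ne {j : ℕ} (h : j ≠ 2) : cubicCoeff q j = halfPower q := by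
  ext t; simp [cubicCoeff, h]

theorem contDiff_cubicCoeff (q j : ℕ) : ContDiff ℝ q (cubicCoeff q j) := by
  rcases eq_or_ne j 2 with rfl | h
  · rw [cubicCoeff_two]
    exact (contDiff_const.mul (contDiff_halfPower q)).sub (contDiff_id.pow 2)
  · rw [cubicCoeff_of_ne h]
    exact contDiff_halfPower q

theorem locallyLipschitz_iteratedDeriv_cubicCoeff (q j : ℕ) :
    LocallyLipschitz (iteratedDeriv q (cubicCoeff q j)) := by
  rcases eq_or_ne j 2 with rfl | h
  · rw [cubicCoeff_two]
    have e : iteratedDeriv q (fun t => 2 * halfPower q t - t ^ 2) = fun t =>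
        2 * iteratedDeriv q (halfPower q) t - iteratedDeriv q (fun t => t ^ 2) t := by
      ext t
      rw [iteratedDeriv_fun_sub (g := fun t => t ^ 2)
        (contDiff_const.mul (contDiff_halfPower q)).contDiffAt (by fun_prop),
        iteratedDeriv_const_mul_field]
    rw [e]
    refine (locallyLipschitz_const_mul (locallyLipschitz_iteratedDeriv_halfPower q) 2).sub
      (ContDiff.locallyLipschitz (𝕂 := ℝ) ?_)
    rw [iteratedDeriv_eq_iterate]
    exact_mod_cast ContDiff.iterate_deriv' 1 q (contDiff_id.pow 2)
  · rw [cubicCoeff_of_ne h]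
    exact locallyLipschitz_iteratedDeriv_halfPower q

theorem OMinimalStructure.def_halfPower (M : OMinimalStructure) (q : ℕ) : M.Def (halfPower q) := by
  classical
  have h : M.Def fun t => if (0 : ℝ) ≤ t then t ^ (q + 1) else 0 :=
    Def.ite (p := fun t => 0 ≤ t) ((defFun_const 0).le (defFun_coord 0))
      ((defFun_coord 0).pow (q + 1)) (def_const 0)
  refine h.congr fun t => ?_
  rw [halfPower]

theorem OMinimalStructure.def_cubicCoeff (M : OMinimalStructure) (q j : ℕ) :
    M.Def (cubicCoeff q j) := by
  rcases eq_or_ne j 2 with rfl | h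
  · rw [cubicCoeff_two]
    exact DefFun.sub ((def_const 2).mul (M.def_halfPower q)) ((defFun_coord 0).pow 2)
  · rw [cubicCoeff_of_ne h]
    exact M.def_halfPower q

end halfPower

/-! ### The cubic curve -/

section cubic
variable {q : ℕ} {t : ℝ}

theorem monicCurve_three (a : ℕ → ℝ → ℝ) (t : ℝ) :
    monicCurve 3 a t = X ^ 3 - C (a 1 t) * X ^ 2 + C (a 2 t) * X - C (a 3 t) := by
  rw [monicCurve, show Finset.Icc 1 3 = {1, 2, 3} from rfl]
  simp
  ring

theorem centeredCurve_three (a : ℕ → ℝ → ℝ) (t : ℝ) : centeredCurve 3 (monicCurve 3 a) t =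
    X ^ 3 + C (a 2 t - 3 * (a 1 t / 3) ^ 2) * X -
      C (a 3 t - a 2 t * (a 1 t / 3) + 2 * (a 1 t / 3) ^ 3) := by
  have h : a 1 t = 3 * (a 1 t / 3) := by ring
  rw [centeredCurve, signedCoeff_monicCurve (by decide), monicCurve_three]
  push_cast
  generalize a 1 t / 3 = s at *
  rw [h]
  simp only [sub_comp, add_comp, mul_comp, pow_comp, X_comp, C_comp]
  simp only [map_sub, map_add, map_mul, map_pow, map_ofNat]
  ring

theorem eval_cubic (q : ℕ) (t x : ℝ) : (monicCurve 3 (cubicCoeff q) t).eval x =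
    x * (x ^ 2 - t ^ 2) - halfPower q t * (x - 1) ^ 2 := by
  rw [monicCurve_three, cubicCoeff_two, cubicCoeff_of_ne (by decide), cubicCoeff_of_ne (by decide)]
  simp
  ring

theorem cubic_of_nonpos (h : t ≤ 0) : monicCurve 3 (cubicCoeff q) t = rootPoly ![0, t, -t] := by
  rw [monicCurve_three, cubicCoeff_two, cubicCoeff_of_ne (by decide), cubicCoeff_of_ne (by decide),
    rootPoly, Fin.prod_univ_three]
  simp [halfPower_of_nonpos h]
  ring

theorem injective_vec_three {a b c : ℝ} (h1 : a ≠ b) (h2 : a ≠ c) (h3 : b ≠ c) :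
    Function.Injective ![a, b, c] := by
  intro i j hij
  fin_cases i <;> fin_cases j <;> simp_all

theorem signedCoeff_depressed (b c : ℝ) : signedCoeff 3 (X ^ 3 + C b * X - C c) 2 = b ∧
    signedCoeff 3 (X ^ 3 + C b * X - C c) 3 = c := by
  constructor <;> simp [signedCoeff, coeff_X_pow, coeff_C, show (-1 : ℝ) ^ 3 = -1 by norm_num]

theorem exists_cubic_roots (hq : 3 < q) (h : t ∈ Set.Ioo (-(1 / 4)) (1 / 4 : ℝ)) (h0 : t ≠ 0) :
    ∃ x : Fin 3 → ℝ, Function.Injective x ∧ monicCurve 3 (cubicCoeff q) t = rootPoly x := by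
  rcases h0.lt_or_gt with hneg | hpos
  · exact ⟨_, injective_vec_three hneg.ne' (by linarith) (by linarith), cubic_of_nonpos hneg.le⟩
  have hf0 : 0 < halfPower q t := by rw [halfPower_of_nonneg hpos.le]; positivity
  -- With q ≥ 4 and t < 1/4 the perturbation f(x-1)² is too small to change the signs of x(x²-t²) at
  -- ±2t and ±t/2, so each of the three intervals between these points contains a root.
  have hf1 : halfPower q t ≤ t ^ 3 / 16 := by
    rw [halfPower_of_nonneg hpos.le]
    calc t ^ (q + 1) ≤ t ^ 5 := pow_le_pow_of_le_one hpos.le (by linarith [h.2]) (by omega)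
      _ = t ^ 3 * t ^ 2 := by ring
      _ ≤ t ^ 3 * (1 / 4) ^ 2 := by
        have := h.2.le
        gcongr
      _ = t ^ 3 / 16 := by ring
  have ht3 : 0 < t ^ 3 := by positivity
  have hcont : Continuous fun x => (monicCurve 3 (cubicCoeff q) t).eval x := by fun_prop
  have e1 : (monicCurve 3 (cubicCoeff q) t).eval (-(2 * t)) < 0 := by
    rw [eval_cubic]
    nlinarith [mul_nonneg hf0.le (sq_nonneg (-(2 * t) - 1))]
  have e2 : 0 < (monicCurve 3 (cubicCoeff q) t).eval (-(t / 2)) := by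
    rw [eval_cubic]
    have : (-(t / 2) - 1) ^ 2 ≤ 2 := by nlinarith [h.2]
    nlinarith [mul_le_mul_of_nonneg_left this hf0.le]
  have e3 : (monicCurve 3 (cubicCoeff q) t).eval (t / 2) < 0 := by
    rw [eval_cubic]
    nlinarith [mul_nonneg hf0.le (sq_nonneg (t / 2 - 1))]
  have e4 : 0 < (monicCurve 3 (cubicCoeff q) t).eval (2 * t) := by
    rw [eval_cubic]
    have : (2 * t - 1) ^ 2 ≤ 1 := by nlinarith [h.2]
    nlinarith [mul_le_mul_of_nonneg_left this hf0.le]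
  obtain ⟨a, ha, ha'⟩ := intermediate_value_Ioo (show -(2 * t) ≤ -(t / 2) by linarith)
    hcont.continuousOn ⟨e1, e2⟩
  obtain ⟨b, hb, hb'⟩ := intermediate_value_Ioo' (show -(t / 2) ≤ t / 2 by linarith)
    hcont.continuousOn ⟨e3, e2⟩
  obtain ⟨c, hc, hc'⟩ := intermediate_value_Ioo (show t / 2 ≤ 2 * t by linarith)
    hcont.continuousOn ⟨e3, e4⟩
  have hI := injective_vec_three (ha.2.trans hb.1).ne ((ha.2.trans hb.1).trans (hb.2.trans hc.1)).ne
    (hb.2.trans hc.1).ne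
  refine ⟨_, hI, eq_rootPoly_of_injective monicCurve_monic_natDegree.1
    monicCurve_monic_natDegree.2 hI fun i => ?_⟩
  fin_cases i
  exacts [ha', hb', hc']

theorem splits_cubic (hq : 3 < q) (h : t ∈ Set.Ioo (-(1 / 4)) (1 / 4 : ℝ)) :
    (monicCurve 3 (cubicCoeff q) t).Splits := by
  rcases eq_or_ne t 0 with rfl | h0
  · rw [cubic_of_nonpos le_rfl]
    exact rootPoly_splits _
  · obtain ⟨x, -, hx⟩ := exists_cubic_roots hq h h0
    rw [hx]
    exact rootPoly_splits _

theorem isHyperbolicCurveNear_cubic (hq : 3 < q) (h : t ∈ Set.Ioo (-(1 / 4)) (1 / 4 : ℝ)) :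
    IsHyperbolicCurveNear t 3 (monicCurve 3 (cubicCoeff q)) :=
  isHyperbolicCurveNear_monicCurve isOpen_Ioo (fun _ ht => splits_cubic hq ht)
    (fun _ _ => (contDiff_cubicCoeff q _).continuous.continuousOn) h

/-- Since f is divisible by t³, a₂ is -t² to leading order and r = 1. The reduced curve at 0 is x³ -
x with distinct roots, so (Γ, γ) = (0 + 3·1, 0 + 1). -/
theorem hasLocalGamma_cubic_zero (hq : 3 < q) :
    HasLocalGamma 0 3 (monicCurve 3 (cubicCoeff q)) 3 1 := by
  have hP : IsHyperbolicCurveNear 0 3 (monicCurve 3 (cubicCoeff q)) :=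
    isHyperbolicCurveNear_cubic hq (by norm_num)
  have hcoeff : ∀ t, centeredCurve 3 (monicCurve 3 (cubicCoeff q)) t =
      X ^ 3 + C (2 * halfPower q t - t ^ 2 - 3 * (halfPower q t / 3) ^ 2) * X -
      C (halfPower q t - (2 * halfPower q t - t ^ 2) * (halfPower q t / 3) +
        2 * (halfPower q t / 3) ^ 3) := fun t => by
    rw [centeredCurve_three, cubicCoeff_two, cubicCoeff_of_ne (by decide),
      cubicCoeff_of_ne (by decide)]
  obtain ⟨k, rfl⟩ : ∃ k, q = k + 4 := ⟨q - 4, by omega⟩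
  have hfac : ∀ t : ℝ, halfPower (k + 4) t = t ^ 3 * halfPower (k + 1) t := fun t =>
    halfPower_add (k + 1) 3 t
  have hc := continuous_halfPower (k + 1)
  have h2 : ∀ t, signedCoeff 3 (centeredCurve 3 (monicCurve 3 (cubicCoeff (k + 4))) t) 2 =
      (t - 0) ^ (2 * 1) * (2 * t * halfPower (k + 1) t - 1 - t ^ 4 * halfPower (k + 1) t ^ 2 / 3) := by
    intro t
    rw [hcoeff, (signedCoeff_depressed _ _).1, hfac]
    ring
  have h3 : ∀ t, signedCoeff 3 (centeredCurve 3 (monicCurve 3 (cubicCoeff (k + 4))) t) 3 =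
      (t - 0) ^ (3 * 1) * (halfPower (k + 1) t - (2 * halfPower (k + 4) t - t ^ 2) *
        (halfPower (k + 1) t / 3) + 2 * halfPower (k + 1) t * (halfPower (k + 4) t) ^ 2 / 27) := by
    intro t
    rw [hcoeff, (signedCoeff_depressed _ _).2, hfac]
    ring
  have hg : Continuous fun t =>
      2 * t * halfPower (k + 1) t - 1 - t ^ 4 * halfPower (k + 1) t ^ 2 / 3 := by fun_prop
  have hg' : Continuous fun t => halfPower (k + 1) t - (2 * halfPower (k + 4) t - t ^ 2) *
        (halfPower (k + 1) t / 3) + 2 * halfPower (k + 1) t * (halfPower (k + 4) t) ^ 2 / 27 := by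
    have := continuous_halfPower (k + 4)
    fun_prop
  have hy := (hP.centered (by norm_num)).isLocalParam_ordRoot
  obtain ⟨R, hR, hred⟩ := exists_isReduction (r := 1) (by norm_num) hP hy
    (hy.isBigO_of_sq (by norm_num) hP (isBigO_of_eq_pow_mul hg.continuousAt (.of_forall h2)))
    (contDiffAt_coeff_monicCurve fun j _ => (contDiff_cubicCoeff (k + 4) j).contDiffAt.of_le
      (by exact_mod_cast (by omega)))
  have hR1 := (hred.signedCoeff_one (by norm_num) hP hR).self_of_nhds
  have hR2 := (eventuallyEq_of_pow_mul (j := 2 * 1) (f := fun t => signedCoeff 3 (R t) 2)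
    (hR.continuousAt_signedCoeff 2).self_of_nhds hg.continuousAt (by
      filter_upwards [hred] with t ht
      rw [← ht 2 (by decide), h2])).self_of_nhds
  have hR3 := (eventuallyEq_of_pow_mul (j := 3 * 1) (f := fun t => signedCoeff 3 (R t) 3)
    (hR.continuousAt_signedCoeff 3).self_of_nhds hg'.continuousAt (by
      filter_upwards [hred] with t ht
      rw [← ht 3 (by decide), h3])).self_of_nhds
  simp only [halfPower_zero] at hR2 hR3
  have hinj : Function.Injective ![(0 : ℝ), 1, -1] :=
    injective_vec_three (by norm_num) (by norm_num) (by norm_num)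
  have hR0 : R 0 = rootPoly ![0, 1, -1] := by
    have e := hR.1.self_of_nhds
    have h1 : R 0 = monicCurve 3 (fun j _ => signedCoeff 3 (R 0) j) 0 :=
      eq_of_signedCoeff_eq e.1 e.2.1 monicCurve_monic_natDegree.1 monicCurve_monic_natDegree.2
        fun k hk => (signedCoeff_monicCurve (a := fun j _ => signedCoeff 3 (R 0) j) hk).symm
    rw [monicCurve_three, hR1, hR2, hR3] at h1
    rw [h1, rootPoly, Fin.prod_univ_three]
    simp
    ring
  have hloc := hR.isLocalParam_ordRoot.hasLocalGamma_of_injective (by norm_num)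
    (hR.isLocalParam_ordRoot.injective hinj hR0)
  exact HasLocalGamma.reduce hP (by norm_num)
    ⟨0, by rw [cubic_of_nonpos le_rfl, ← rootPoly_const]; congr 1; ext i; fin_cases i <;> simp⟩
    (multiplicityAt_pow_mul (.of_forall fun t => hg.continuousAt) (by simp [halfPower_zero])
      (.of_forall h2)) hred hloc

variable {J : Set ℝ}

theorem isRigidAt_cubic (hq : 3 < q) (h : t ∈ Set.Ioo (-(1 / 4)) (1 / 4 : ℝ)) (h0 : t ≠ 0) :
    IsRigidAt t 3 (monicCurve 3 (cubicCoeff q)) := by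
  obtain ⟨x, hx, hP⟩ := exists_cubic_roots hq h h0
  have hy := (isHyperbolicCurveNear_cubic hq h).isLocalParam_ordRoot
  exact hy.isRigidAt_of_injective (hy.injective hx hP)

theorem hasGamma_cubic (hq : 3 < q) (h0 : (0 : ℝ) ∈ J) (hJ : J ⊆ Set.Ioo (-(1 / 4)) (1 / 4)) :
    HasGamma J 3 (monicCurve 3 (cubicCoeff q)) 3 1 := by
  refine ⟨fun t => if t = 0 then 3 else 0, fun t => if t = 0 then 1 else 0, fun t ht => ?_,
    ⟨?_, fun b hb => by simpa using hb ⟨0, h0, rfl⟩⟩, 2,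
    ⟨?_, fun b hb => by simpa using hb ⟨0, h0, rfl⟩⟩, rfl⟩
  · rcases eq_or_ne t 0 with rfl | hne
    · simpa using hasLocalGamma_cubic_zero hq
    · simp only [if_neg hne]
      obtain ⟨x, hx, hP⟩ := exists_cubic_roots hq (hJ ht) hne
      have hy := (isHyperbolicCurveNear_cubic hq (hJ ht)).isLocalParam_ordRoot
      exact hy.hasLocalGamma_of_injective (by norm_num) (hy.injective hx hP)
  · rintro _ ⟨t, -, rfl⟩
    dsimp only
    split_ifs <;> norm_num
  · rintro _ ⟨t, -, rfl⟩
    dsimp only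
    split_ifs <;> norm_num

/-- A root of the cubic which is small compared to `t` is not too small. -/
theorem le_abs_of_isRoot_cubic {x : ℝ} (ht : 0 < t) (ht' : t < 1) (hx : |x| ≤ t / 2)
    (h : (monicCurve 3 (cubicCoeff q) t).eval x = 0) (hq : 1 ≤ q) : t ^ (q - 1) ≤ |x| := by
  rw [eval_cubic, halfPower_of_nonneg ht.le] at h
  obtain ⟨k, rfl⟩ := Nat.exists_eq_add_of_le' hq
  have hpow : t ^ (k + 1 + 1) = t ^ k * t ^ 2 := by ring
  rw [hpow] at h
  rw [Nat.add_sub_cancel]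
  have hk : 0 < t ^ k := by positivity
  have ht2 : 0 < t ^ 2 := by positivity
  have hx2 := abs_le.1 hx
  have hlt : x ^ 2 < t ^ 2 := by nlinarith
  have hx0 : x ≤ 0 := by
    by_contra! hc
    -- A positive root is impossible: x(x²-t²) would be negative but equal to f(x-1)² ≥ 0. For x ≤ 0
    -- one has (x-1)² ≥ 1, whence |x|t² ≥ f = t^{q+1}.
    nlinarith [mul_pos hc (sub_pos.2 hlt), mul_nonneg (mul_pos hk ht2).le (sq_nonneg (x - 1))]
  rw [abs_of_nonpos hx0]
  have h1 : 1 ≤ (x - 1) ^ 2 := by nlinarith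
  have h2 : t ^ k * t ^ 2 ≤ -x * t ^ 2 := by
    have h3 : t ^ k * t ^ 2 * 1 ≤ t ^ k * t ^ 2 * (x - 1) ^ 2 :=
      mul_le_mul_of_nonneg_left h1 (mul_pos hk ht2).le
    nlinarith [mul_nonneg (neg_nonneg.2 hx0) (sq_nonneg x)]
  exact le_of_mul_le_mul_right h2 ht2

theorem not_exists_contDiffOn_cubic (hq : 3 < q) (hJo : IsOpen J) (hJc : J.OrdConnected)
    (h0 : (0 : ℝ) ∈ J) (hJ : J ⊆ Set.Ioo (-(1 / 4)) (1 / 4)) :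
    ¬ ∃ r : Fin 3 → ℝ → ℝ, IsRootParam J 3 (monicCurve 3 (cubicCoeff q)) r ∧
        ∀ i, ContDiffOn ℝ ((q - 1 : ℕ) : WithTop ℕ∞) (r i) J := by
  rintro ⟨r, hr, hrC⟩
  have hloc : ∀ t ∈ J, IsLocalParam t 3 (monicCurve 3 (cubicCoeff q)) r := fun t ht => by
    refine ⟨fun i => ?_, ?_⟩
    · filter_upwards [hJo.mem_nhds ht] with s hs
      exact (hrC i).continuousOn.continuousAt (hJo.mem_nhds hs)
    · filter_upwards [hJo.mem_nhds ht] with s hs using hr s hs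
  have hz : ∀ t ∈ J ∩ Set.Iio 0, IsLocalParam t 3 (monicCurve 3 (cubicCoeff q))
      ![fun _ => 0, fun t => t, fun t => -t] := fun t ht => by
    refine ⟨fun i => .of_forall fun s => ?_, ?_⟩
    · fin_cases i
      exacts [continuousAt_const, continuousAt_id, continuousAt_id.neg]
    · filter_upwards [gt_mem_nhds ht.2] with s hs
      rw [cubic_of_nonpos hs.le]
      congr 1
      ext i
      fin_cases i <;> rfl
  obtain ⟨t₁, ht₁⟩ : (J ∩ Set.Iio 0).Nonempty := by
    have : ∀ᶠ t in 𝓝[<] (0 : ℝ), t ∈ J ∩ Set.Iio 0 := by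
      filter_upwards [mem_nhdsWithin_of_mem_nhds (hJo.mem_nhds h0), self_mem_nhdsWithin]
        with t h1 h2 using ⟨h1, h2⟩
    exact this.exists
  obtain ⟨σ, hσ⟩ := IsLocalParam.eqOn_of_isRigidAt (hJc.inter Set.ordConnected_Iio).isPreconnected
    (fun t ht => isRigidAt_cubic hq (hJ ht.1) ht.2.ne) (fun t ht => hloc t ht.1) hz ht₁
  -- For t < 0 the roots are 0, t, -t up to a fixed permutation; f is the one that vanishes there.
  set f := r (σ.symm 0) with hf
  have hneg : ∀ᶠ t in 𝓝[<] (0 : ℝ), f t = 0 := by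
    filter_upwards [mem_nhdsWithin_of_mem_nhds (hJo.mem_nhds h0), self_mem_nhdsWithin] with t h1 h2
    have := hσ t ⟨h1, h2⟩ (σ.symm 0)
    rwa [σ.apply_symm_apply] at this
  -- Vanishing on the left excludes a finite order of vanishing up to q - 1, so f would be
  -- o(t^{q-1}); on the right this makes |f| ≤ t/2 and |f| < t^{q-1}, against the lower bound for
  -- such roots.
  rcases ((hrC (σ.symm 0)).contDiffAt (hJo.mem_nhds h0)).isLittleO_or_exists with
    h | ⟨k, -, g, hg, hg0, hk⟩
  · have h1 := (h.bound (show (0 : ℝ) < 1 / 2 by norm_num)).filter_mono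
      (nhdsWithin_le_nhds (s := Set.Ioi 0))
    have h2 : ∀ᶠ t in 𝓝[>] (0 : ℝ), False := by
      filter_upwards [h1, mem_nhdsWithin_of_mem_nhds (hJo.mem_nhds h0), self_mem_nhdsWithin]
        with t h1 h2 h3
      have ht : (0 : ℝ) < t := h3
      have ht4 := (hJ h2).2
      rw [sub_zero, Real.norm_eq_abs, Real.norm_eq_abs, abs_of_pos (pow_pos ht _)] at h1
      have hpow : t ^ (q - 1) ≤ t := pow_le_of_le_one ht.le (by linarith) (by omega)
      have hroot : (monicCurve 3 (cubicCoeff q) t).eval (f t) = 0 := by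
        rw [hr t h2]
        exact rootPoly_isRoot.2 ⟨σ.symm 0, rfl⟩
      have := le_abs_of_isRoot_cubic ht (by linarith) (by linarith : |f t| ≤ t / 2) hroot (by omega)
      have := pow_pos ht (q - 1)
      linarith
    exact h2.exists.elim fun _ h => h
  · have h1 : Tendsto g (𝓝[<] 0) (𝓝 0) := by
      refine tendsto_const_nhds.congr' ?_
      filter_upwards [hneg, hk.filter_mono nhdsWithin_le_nhds, self_mem_nhdsWithin] with t h1 h2 h3
      rw [← hf, h1, eq_comm, mul_eq_zero, sub_zero] at h2
      exact (h2.resolve_left (pow_ne_zero _ (ne_of_lt h3))).symm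
    exact hg0 (tendsto_nhds_unique (hg.continuousAt.tendsto.mono_left nhdsWithin_le_nhds) h1)

end cubic

/-! ### Assembly of the theorem -/

theorem theorem5p1 (M : OMinimalStructure) :
    (∀ (I : Set ℝ) (n : ℕ) (a : ℕ → ℝ → ℝ),
      IsOpen I → I.OrdConnected → I.Nonempty → 1 ≤ n →
      (∀ j ∈ Finset.Icc 1 n, M.DefinableOn I (a j)) →
      (∀ t ∈ I, (monicCurve n a t).Splits) →
      -- well-definedness of the integers `Γ(P)` and `γ(P)`
      ((∀ j ∈ Finset.Icc 1 n, ContDiffOn ℝ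
          (((n * (n + 1) / 2 - 1 : ℕ) * maxContactOrder I n (monicCurve n a) + 2 : ℕ∞) :
            WithTop ℕ∞) (a j) I) →
        ∃ Γ γ : ℕ, HasGamma I n (monicCurve n a) Γ γ) ∧
      ∀ Γ γ : ℕ, HasGamma I n (monicCurve n a) Γ γ →
        (∀ Γ' γ' : ℕ, HasGamma I n (monicCurve n a) Γ' γ' → Γ' = Γ ∧ γ' = γ) ∧
        γ ≤ Γ ∧
        (Γ : ℕ∞) ≤ (n * (n + 1) / 2 - 1 : ℕ) * maxContactOrder I n (monicCurve n a) + 1 ∧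
        -- differentiable roots
        ∀ p : ℕ, 0 < p →
          (∀ j ∈ Finset.Icc 1 n, ContDiffOn ℝ ((p + Γ : ℕ) : WithTop ℕ∞) (a j) I) →
          ∃ r : Fin n → ℝ → ℝ, IsRootParam I n (monicCurve n a) r ∧
            ∀ i, M.DefinableOn I (r i) ∧ ContDiffOn ℝ ((p + γ : ℕ) : WithTop ℕ∞) (r i) I) ∧
    -- sharpness
    (∀ q : ℕ, 3 < q → ∃ ε : ℝ, 0 < ε ∧ ∀ J : Set ℝ,
      IsOpen J → J.OrdConnected → (0 : ℝ) ∈ J → J ⊆ Set.Ioo (-ε) ε →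
      (∀ j ∈ Finset.Icc 1 3, M.DefinableOn J (cubicCoeff q j) ∧
        ContDiff ℝ (q : WithTop ℕ∞) (cubicCoeff q j) ∧
        LocallyLipschitz (iteratedDeriv q (cubicCoeff q j))) ∧
      (∀ t ∈ J, (monicCurve 3 (cubicCoeff q) t).Splits) ∧
      HasGamma J 3 (monicCurve 3 (cubicCoeff q)) 3 1 ∧
      (∃ r : Fin 3 → ℝ → ℝ, IsRootParam J 3 (monicCurve 3 (cubicCoeff q)) r ∧
        ∀ i, M.DefinableOn J (r i) ∧ ContDiffOn ℝ ((q - 2 : ℕ) : WithTop ℕ∞) (r i) J) ∧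
      ¬ ∃ r : Fin 3 → ℝ → ℝ, IsRootParam J 3 (monicCurve 3 (cubicCoeff q)) r ∧
        ∀ i, ContDiffOn ℝ ((q - 1 : ℕ) : WithTop ℕ∞) (r i) J) := by
  refine ⟨fun I n a hI hI' hne hn ha hs => ⟨fun hC => exists_hasGamma M hI hI' hne hn ha hs hC,
    fun Γ γ h => ⟨fun Γ' γ' h' => h.unique h', h.le,
      (h.le_maxContactOrder hI hne).trans le_self_add, fun p hp hC =>
        h.exists_contDiffOn_roots M hI hI' ha hp hC⟩⟩, fun q hq => ⟨1 / 4, by norm_num,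
    fun J hJ hJ' h0 hJs => ?_⟩⟩
  have hdef : ∀ j ∈ Finset.Icc 1 3, M.DefinableOn J (cubicCoeff q j) := fun j _ =>
    (M.def_cubicCoeff q j).definableOn (OMinimalStructure.def₁_of_isOpen hJ hJ')
  refine ⟨fun j hj => ⟨hdef j hj, contDiff_cubicCoeff q j,
    locallyLipschitz_iteratedDeriv_cubicCoeff q j⟩, fun t ht => splits_cubic hq (hJs ht),
    hasGamma_cubic hq h0 hJs, ?_, not_exists_contDiffOn_cubic hq hJ hJ' h0 hJs⟩
  -- With Γ = 3 and γ = 1 the available C^q regularity corresponds to p = q - 3, which is positive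
  -- because q > 3 and gives roots of class q - 2.
  have := (hasGamma_cubic hq h0 hJs).exists_contDiffOn_roots M hJ hJ' hdef (p := q - 3) (by omega)
    fun j _ => by
      rw [show q - 3 + 3 = q by omega]
      exact (contDiff_cubicCoeff q j).contDiffOn
  rwa [show q - 3 + 1 = q - 2 by omega] at this
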